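/- **Setting.** Let $(\Omega,\mathcal F,P)$ be a probability space, $\mathcal I$ a finite index set with $n=|\mathcal I|$, equipped with an extended metric $\mathbf d:\mathcal I\times\mathcal I\to[0,\infty]$, and let $X_i:\Omega\to\mathbb R^d$ ($i\in\mathcal I$) be random vectors. For $I,J\subset\mathcal I$ put $\mathbf d(I,J)=\inf_{i\in I,j\in J}\mathbf d(i,j)$. Let $H:\mathbb R^d\times\mathbb R^d\to\mathbb R$ be measurable and symmetric. A tilde denotes an independent copy: $\tilde X_k$ has the law of $X_k$ and is independent of the other variable that occurs with it. Assume $\mathbb E\,H(X_i,\tilde X_j)^2<\infty$ for all $i\ne j$ and that $H$ is degenerate: for all $i\neq k$, $\mathbb E\,H(X_k,x)=0$ for almost every $x$ with respect to the law of $X_i$. *Mixing.* For $\sigma$-algebras $\mathcal F_1,\mathcal F_2$ let $\beta(\mathcal F_1,\mathcal F_2)=\sup\frac12\sum_{a,b}|P(A_a\cap B_b)-P(A_a)P(B_b)|$, the supremum being over finite partitions $(A_a)\subset\mathcal F_1$, $(B_b)\subset\mathcal F_2$ of $\Omega$. Let $\beta(n_1,n_2,m)\in[0,\infty]$, $n_1,n_2\in\mathbb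 N\cup\{\infty\}$, be numbers with $\beta(\sigma(X_i:i\in I),\sigma(X_j:j\in J))\le\beta(n_1,n_2,m)$ whenever $|I|\le n_1$, $|J|\le n_2$ and $\mathbf d(I,J)\ge m$. Put $\beta_q(m)=\max\{\beta(q_1,q_2,m):q_1,q_2\ge1,\ q_1+q_2=q\}$. *Sparsity.* For $m>0$ and $\mathbf i=(i_1,\dots,i_q)\in\mathcal I^q$, call two entries of $\mathbf i$ $m$-connected in $\mathbf i$ if they can be joined by a chain of entries of $\mathbf i$ whose consecutive distances are at most $m$. The $m$-profile of $\mathbf i$ is the list, in descending order, of the numbers of positions $j\le q$ with $i_j$ in each equivalence class. Let $\tau^m_{q_1,\dots,q_S}$ be the number of $\mathbf i\in\mathcal I^{q_1+\dots+q_S}$ with $m$-profile $(q_1,\dots,q_S)$, and $\hat\tau^m_4=\tau^m_{3,1}+\tau^m_{2,1,1}+\tau^m_{1,1,1,1}$. *Moments.* Let $\mathbf H_p=\sup_{i\neq k}\max\{\|H(X_i,X_k)\|_p,\|H(X_i,\tilde X_k)\|_p\}$ and $\tilde{\mathbf H}_2=\sup_{i\ne k}\|H(X_i,\tilde X_k)\|_2$.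 With $\Gamma^{i,j}(x,y)=\mathbb E[H(X_i,x)H(X_j,y)]$, let $\mathbf\Gamma_{m,p}=\sup\{\|\Gamma^{i,j}(X_{k_1},\tilde X_{k_2})\|_p:\ \mathbf d(i,j)\le m,\ \mathbf d(k_1,k_2)>m\}$. These quantities may be infinite; $0\cdot\infty=0$. Let $S_n=\sum_{i\neq k}H(X_i,X_k)$ (ordered pairs), $s_n^2=\operatorname{Var}(S_n)$, assume $s_n>0$, and let $W_n=(S_n-\mathbb ES_n)/s_n$, $Z\sim N(0,1)$. Let $d_W(U,V)=\sup_g|\mathbb Eg(U)-\mathbb Eg(V)|$ over all $1$-Lipschitz $g:\mathbb R\to\mathbb R$. **Theorem.** There is an absolute constant $C<\infty$ such that in every such setting, for all $m>0$ and $\delta>0$, there are $A_0,\dots,A_5\in[0,\infty]$ with $$d_W(W_n,Z)\le A_0+2A_1+\sqrt{\tfrac2\pi}\,A_2+\sqrt{\tfrac2\pi}\,A_3+2A_4+A_5$$ and \begin{align*} A_0&\le \frac{C}{s_n}\sqrt{\tau_4^{4m}\mathbf H_2^2+\tau_{2,2}^{4m}\mathbf H_{2+\delta}^2\,\beta_4(4m)^{\frac{\delta}{2+\delta}}},\\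 A_1&\le C\,\frac{n^2}{s_n}\,\mathbf H_{1+\delta}\,\beta(1,\infty,m)^{\frac{\delta}{1+\delta}},\\ A_2&\le \frac{C}{s_n^2}\Big[\tau_4^{4m}\mathbf H_2^2+n^4\mathbf H_{2+\delta}^2\,\beta_4(m)^{\frac{\delta}{2+\delta}}\Big],\\ A_3&\le C\,\frac{\tau_2^m}{s_n^2}\Big(n^2\mathbf H_{2+\delta}^2\,\beta(2,\infty,m)^{\frac{\delta}{2+\delta}}+\sqrt{\tau_4^m\mathbf H_4^4+\hat\tau_4^m\mathbf H_{4+\delta}^4\,\beta_4(m)^{\frac{\delta}{4+\delta}}+\tau_{2,2}^m\mathbf\Gamma_{m,2}^2}\Big),\\ A_4+A_5&\le C\,\frac{\sqrt{\tau_2^m\tau_4^m+n\tau_5^m}}{s_n^3}\Big[(\tau_4^m+\tau_{2,2}^m)\mathbf H_4^4+\hat\tau_4^m\mathbf H_{4+\delta}^4\,\beta(1,6,m)^{\frac{\delta}{4+\delta}}\Big]^{\frac12}\Big[\tau_2^m\tilde{\mathbf H}_2^2+n^2\mathbf H_{2+\delta}^2\,\beta_4(m)^{\frac{\delta}{2+\delta}}\Big]^{\frac12}.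 \end{align*} -/

import Mathlib

open MeasureTheory ProbabilityTheory
open scoped ENNReal

universe u v

/-! ### Wasserstein distance -/

/-- The (Kantorovich–)Wasserstein distance between two laws on the real line: the supremum of
`|∫ g dP - ∫ g dQ|` over all `1`-Lipschitz functions `g`. -/
noncomputable def wassersteinDist (P Q : Measure ℝ) : ℝ≥0∞ :=
  ⨆ (g : ℝ → ℝ) (_ : LipschitzWith 1 g), ENNReal.ofReal |(∫ x, g x ∂P) - ∫ x, g x ∂Q|

/-! ### Profiles of index vectors and sparsity counts -/

section Profile

variable {ι : Type v} [EMetricSpace ι]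

/-- Equivalence of the positions of an index vector `i = (i_1, …, i_q)`: the positions `a` and `b`
are equivalent when one can go from `i_a` to `i_b` by steps of length at most `m` through nodes that
occur in `i` (that is, `i_a` and `i_b` are `m`-connected in `i`). -/
def mConnected (m : ℝ) {q : ℕ} (i : Fin q → ι) : Setoid (Fin q) where
  r := Relation.ReflTransGen fun a b => edist (i a) (i b) ≤ ENNReal.ofReal m
  iseqv :=
    { refl := fun _ => Relation.ReflTransGen.refl
      symm := by
        intro a b h
        induction h with
        | refl => exact Relation.ReflTransGen.refl
        | tail _ hbc ih =>
          exact Relation.ReflTransGen.head (by rw [edist_comm]; exact hbc) ih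
      trans := fun h₁ h₂ => h₁.trans h₂ }

open Classical in
/-- The `m`-profile of an index vector: the multiset of the numbers of positions (occurrences,
counted with duplicates) in the `m`-connectedness classes. A multiset carries the same information
as the list of these numbers in descending order. -/
noncomputable def profile (m : ℝ) {q : ℕ} (i : Fin q → ι) : Multiset ℕ :=
  (Finpartition.ofSetoid (mConnected m i)).parts.val.map Finset.card

variable (ι) in
/-- The sparsity count `τ^m_{q_1, …, q_S}`: the number of index vectors of length
`q_1 + ⋯ + q_S` whose `m`-profile is `(q_1, …, q_S)`. -/
noncomputable def tau (m : ℝ) (l : List ℕ) : ℝ≥0∞ :=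
  (Nat.card {i : Fin l.sum → ι // profile m i = (l : Multiset ℕ)} : ℝ≥0∞)

variable (ι) in
/-- `τ̂^m_4 = τ^m_{3,1} + τ^m_{2,1,1} + τ^m_{1,1,1,1}`. -/
noncomputable def tauHat4 (m : ℝ) : ℝ≥0∞ :=
  tau ι m [3, 1] + tau ι m [2, 1, 1] + tau ι m [1, 1, 1, 1]

end Profile

/-! ### Beta-mixing -/

section Mixing

variable {Ω : Type u}

/-- `A` is a finite partition of `Ω` (empty pieces are allowed, they do not affect any of the sums
below) into sets of the sigma-algebra `F`. -/
structure IsFinPartition (F : MeasurableSpace Ω) {k : ℕ} (A : Fin k → Set Ω) : Prop where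
  measurableSet : ∀ a, MeasurableSet[F] (A a)
  disjoint : Pairwise fun a b => Disjoint (A a) (A b)
  iUnion_eq : ⋃ a, A a = Set.univ

/-- The `β`-mixing coefficient between the sigma-algebras `F₁` and `F₂`. -/
noncomputable def betaSigma {mΩ : MeasurableSpace Ω} (μ : Measure Ω) (F₁ F₂ : MeasurableSpace Ω) :
    ℝ≥0∞ :=
  ⨆ (k : ℕ) (l : ℕ) (A : Fin k → Set Ω) (B : Fin l → Set Ω)
    (_ : IsFinPartition F₁ A) (_ : IsFinPartition F₂ B),
    ENNReal.ofReal
      ((1 / 2) * ∑ a, ∑ b, |μ.real (A a ∩ B b) - μ.real (A a) * μ.real (B b)|)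

variable {ι : Type v} {E : Type*} [MeasurableSpace E]

/-- The sigma-algebra generated by the variables `X i`, `i ∈ I`. -/
@[reducible] def sigmaOf (X : ι → Ω → E) (I : Set ι) : MeasurableSpace Ω :=
  ⨆ i ∈ I, MeasurableSpace.comap (X i) inferInstance

/-- The distance between two groups of nodes (`∞` if one of them is empty). -/
noncomputable def groupDist [EMetricSpace ι] (I J : Set ι) : ℝ≥0∞ :=
  ⨅ i ∈ I, ⨅ j ∈ J, edist i j

/-- The sample `X` is `β`-mixing with coefficients `β n₁ n₂ m` (where `n₁`, `n₂` may be `∞`): any two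
groups of at most `n₁` and `n₂` nodes at distance at least `m` have a mixing coefficient of at most
`β n₁ n₂ m`. -/
def IsBetaMixing [EMetricSpace ι] {mΩ : MeasurableSpace Ω} (μ : Measure Ω) (X : ι → Ω → E)
    (β : ℕ∞ → ℕ∞ → ℝ → ℝ≥0∞) : Prop :=
  ∀ (n₁ n₂ : ℕ∞) (m : ℝ) (I J : Set ι), I.encard ≤ n₁ → J.encard ≤ n₂ →
    ENNReal.ofReal m ≤ groupDist I J → betaSigma μ (sigmaOf X I) (sigmaOf X J) ≤ β n₁ n₂ m

/-- `β_q(m)`, the maximum of `β(q₁, q₂, m)` over positive integers with `q₁ + q₂ = q`. -/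
noncomputable def betaMax (β : ℕ∞ → ℕ∞ → ℝ → ℝ≥0∞) (q : ℕ) (m : ℝ) : ℝ≥0∞ :=
  ⨆ (q₁ : ℕ) (q₂ : ℕ) (_ : 0 < q₁) (_ : 0 < q₂) (_ : q₁ + q₂ = q), β q₁ q₂ m

end Mixing

/-! ### The U-statistic, its kernel and the moments of the kernel -/

section Kernel

variable {Ω : Type u} [MeasurableSpace Ω] {ι : Type v} {E : Type*} [MeasurableSpace E]

/-- The joint law of `X i` and an independent copy of `X j`. -/
noncomputable def indepLaw (μ : Measure Ω) (X : ι → Ω → E) (i j : ι) : Measure (E × E) :=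
  (μ.map (X i)).prod (μ.map (X j))

open Classical in
/-- The U-statistic `S = ∑_{i ≠ k} H(X_i, X_k)` (sum over ordered pairs). -/
noncomputable def uStat [Fintype ι] (X : ι → Ω → E) (H : E → E → ℝ) (ω : Ω) : ℝ :=
  ∑ i, ∑ k ∈ Finset.univ.filter (fun k => k ≠ i), H (X i ω) (X k ω)

/-- The standard deviation `s` of the U-statistic. -/
noncomputable def uStd [Fintype ι] (μ : Measure Ω) (X : ι → Ω → E) (H : E → E → ℝ) : ℝ :=
  √(variance (uStat X H) μ)

/-- The standardised U-statistic `W = (S - 𝔼 S) / s`. -/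
noncomputable def uStatStd [Fintype ι] (μ : Measure Ω) (X : ι → Ω → E) (H : E → E → ℝ) (ω : Ω) : ℝ :=
  (uStat X H ω - ∫ ω', uStat X H ω' ∂μ) / uStd μ X H

/-- The regularity conditions on the kernel: it is measurable and symmetric, and `H(X_i, X̃_j)` is
square integrable for `i ≠ j`, where `X̃_j` is a copy of `X_j` independent of `X_i`. -/
structure IsRegularKernel (μ : Measure Ω) (X : ι → Ω → E) (H : E → E → ℝ) : Prop where
  measurable : Measurable fun z : E × E => H z.1 z.2
  symm : ∀ x y, H x y = H y x
  memLp_two : ∀ i j, i ≠ j → MemLp (fun z : E × E => H z.1 z.2) 2 (indepLaw μ X i j)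

/-- Degeneracy: for `i ≠ k`, `𝔼 H(X_k, x) = 0` for almost every `x` under the law of `X_i`. -/
def IsDegenerate (μ : Measure Ω) (X : ι → Ω → E) (H : E → E → ℝ) : Prop :=
  ∀ i k, i ≠ k → ∀ᵐ x ∂(μ.map (X i)), ∫ ω, H (X k ω) x ∂μ = 0

/-- `𝐇̃_p = sup_{i ≠ k} ‖H(X_i, X̃_k)‖_p`, where `X̃_k` is a copy of `X_k` independent of `X_i`. -/
noncomputable def kernelMomentIndep (μ : Measure Ω) (X : ι → Ω → E) (H : E → E → ℝ) (p : ℝ) :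
    ℝ≥0∞ :=
  ⨆ (i : ι) (k : ι) (_ : i ≠ k),
    eLpNorm (fun z : E × E => H z.1 z.2) (ENNReal.ofReal p) (indepLaw μ X i k)

/-- `𝐇_p`, the supremum over `i ≠ k` of both `‖H(X_i, X_k)‖_p` and `‖H(X_i, X̃_k)‖_p`. -/
noncomputable def kernelMoment (μ : Measure Ω) (X : ι → Ω → E) (H : E → E → ℝ) (p : ℝ) : ℝ≥0∞ :=
  (⨆ (i : ι) (k : ι) (_ : i ≠ k),
    eLpNorm (fun ω => H (X i ω) (X k ω)) (ENNReal.ofReal p) μ) ⊔ kernelMomentIndep μ X H p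

/-- `Γ^{i,j}(x, y) = 𝔼 [H(X_i, x) H(X_j, y)]`. -/
noncomputable def gammaKernel (μ : Measure Ω) (X : ι → Ω → E) (H : E → E → ℝ) (i j : ι) (x y : E) :
    ℝ :=
  ∫ ω, H (X i ω) x * H (X j ω) y ∂μ

/-- `𝚪_{m,p}`, the supremum of `‖Γ^{i,j}(X_{k₁}, X̃_{k₂})‖_p` over all nodes `i, j, k₁, k₂` with
`d(i, j) ≤ m` and `d(k₁, k₂) > m`, where `X̃_{k₂}` is a copy of `X_{k₂}` independent of `X_{k₁}`. -/
noncomputable def gammaMoment [EMetricSpace ι] (μ : Measure Ω) (X : ι → Ω → E) (H : E → E → ℝ)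
    (m p : ℝ) : ℝ≥0∞ :=
  ⨆ (i : ι) (j : ι) (k₁ : ι) (k₂ : ι) (_ : edist i j ≤ ENNReal.ofReal m)
    (_ : ENNReal.ofReal m < edist k₁ k₂),
    eLpNorm (fun z : E × E => gammaKernel μ X H i j z.1 z.2) (ENNReal.ofReal p)
      (indepLaw μ X k₁ k₂)

end Kernel

/-! Cut the statistic at distance m. Near pairs contribute a sum whose variance is controlled by
counting connected quadruples, and the mean of the sum F over far pairs is nearly zero by
degeneracy. So the standardised statistic W is L²-close to U = tF with t = 1/s_n
(`eLpNorm_uStatStd_sub_le`), and it remains to bound E[f'(U) - U f(U)] for the bounded solutions f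
of Stein's equation (`wassersteinDist_map_le`).

Mixing enters through one decoupling inequality: two groups of variables at distance more than m may
be made independent at the price of a moment times a power of β
(`enorm_integral_sub_integral_prod_le`). It rests on a Hahn decomposition and Hölder's inequality.
Degeneracy is exploited through its corollary `enorm_integral_mul_le_of_centered`: a node far from
all other nodes of a product can be decoupled and then integrates to zero. When a moment of sums of
kernels is expanded, index vectors with an isolated node therefore cost only a mixing error; the
others are counted by the numbers τ (`sum_le_tau_four`).

For the Stein discrepancy write F = ∑ A_i, where A_i collects the far pairs that start at i, and let
G_i be the far sum without the nodes near i. Expanding f(tG_i) at tF splits the discrepancy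
(`enorm_integral_stein_le`) into A_i f(tG_i), where X_i is isolated; a Taylor remainder, handled by
L² and L⁴ bounds on weighted sums; the products A_i (F - G_i) against the centred f'(tF); the defect
E U² - 1; and A_i G_i, where X_i is isolated again.

The products are the heart of the matter (`enorm_integral_mul_sub_integral_le`). F - G_i is a sum
over nodes a near i. For each pair (i, a), every factor is first restricted to the nodes J far from
both i and a. Decoupling (X_i, X_a) from J then replaces H(X_i, X_k) H(X_a, X_l) by Γ^{i,a}(X_k,
X_l). The sum of these over k, l in J is close to a constant in L²
(`exists_eLpNorm_sum_gamma_sub_le`), and a constant contributes nothing against a centred factor.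

Two degenerate situations are treated apart: if W and U are not close in L², the distance is at most
2 and the bound is trivial; if the fourth moment is infinite, the bound itself is infinite. -/

set_option linter.unusedSectionVars false

/-! ### Stein's equation for Lipschitz test functions -/

section Stein

open Filter Topology Set

/-- A function with bounded values, bounded derivative and Lipschitz derivative, with the bounds
that hold for the solution of the Stein equation of a `1`-Lipschitz function. -/
structure IsSteinFun (f f' : ℝ → ℝ) : Prop where
  hasDerivAt : ∀ x, HasDerivAt f (f' x) x
  abs_le : ∀ x, |f x| ≤ 3
  abs_deriv_le : ∀ x, |f' x| ≤ 5
  abs_deriv_sub_le : ∀ x y, |f' x - f' y| ≤ 8 * |x - y|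

lemma hasDerivAt_exp_neg_sq_half (x : ℝ) :
    HasDerivAt (fun x : ℝ => Real.exp (-x ^ 2 / 2)) (-x * Real.exp (-x ^ 2 / 2)) x := by
  have h : HasDerivAt (fun x : ℝ => -x ^ 2 / 2) (-x) x := by
    have := ((hasDerivAt_pow 2 x).neg).div_const 2
    convert! this using 1
    simp; ring
  have := h.exp
  convert! this using 1
  ring

/-- A barrier argument: the derivative of b(x) exp(-x²/2) is (b' - x b) exp(-x²/2), hence at most
-|Φ'|. So b exp(-x²/2) ∓ Φ decreases to its limit 0 and is nonnegative. -/
lemma abs_le_of_gaussian_supersolution {Φ k b b' : ℝ → ℝ} {x₀ : ℝ}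
    (hΦ : ∀ x, x₀ ≤ x → HasDerivAt Φ (k x * Real.exp (-x ^ 2 / 2)) x)
    (hlim : Tendsto Φ atTop (𝓝 0))
    (hb : ∀ x, x₀ ≤ x → HasDerivAt b (b' x) x)
    (hblim : Tendsto (fun x => b x * Real.exp (-x ^ 2 / 2)) atTop (𝓝 0))
    (hineq : ∀ x, x₀ ≤ x → b' x - x * b x ≤ -|k x|) {x : ℝ} (hx : x₀ ≤ x) :
    |Φ x| ≤ b x * Real.exp (-x ^ 2 / 2) := by
  have main : ∀ (σ : ℝ), |σ| = 1 → 0 ≤ b x * Real.exp (-x ^ 2 / 2) - σ * Φ x := by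
    intro σ hσ
    set ψ : ℝ → ℝ := fun x => b x * Real.exp (-x ^ 2 / 2) - σ * Φ x
    have hd : ∀ y, x₀ ≤ y → HasDerivAt ψ
        ((b' y - y * b y - σ * k y) * Real.exp (-y ^ 2 / 2)) y := by
      intro y hy
      have := ((hb y hy).mul (hasDerivAt_exp_neg_sq_half y)).sub ((hΦ y hy).const_mul σ)
      convert! this using 1
      ring
    have hanti : AntitoneOn ψ (Ici x₀) := by
      refine antitoneOn_of_deriv_nonpos (convex_Ici _)
        (fun y hy => (hd y hy).continuousAt.continuousWithinAt) ?_ ?_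
      · intro y hy
        rw [interior_Ici] at hy
        exact (hd y (le_of_lt hy)).differentiableAt.differentiableWithinAt
      · intro y hy
        rw [interior_Ici] at hy
        rw [(hd y (le_of_lt hy)).deriv]
        refine mul_nonpos_of_nonpos_of_nonneg ?_ (Real.exp_pos _).le
        have h1 := hineq y (le_of_lt hy)
        have h2 : -(σ * k y) ≤ |k y| := by
          rw [← one_mul |k y|, ← hσ, ← abs_mul]; exact neg_le_abs _
        linarith
    have hl : Tendsto ψ atTop (𝓝 0) := by
      have := hblim.sub (hlim.const_mul σ)
      simpa using this
    exact le_of_tendsto hl ((eventually_ge_atTop x).mono fun y hy =>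
      hanti (show x ∈ Ici x₀ from hx) (show y ∈ Ici x₀ from hx.trans hy) hy)
  have h1 := main 1 (by simp)
  have h2 := main (-1) (by simp)
  rw [abs_le]; constructor <;> linarith

lemma tendsto_affine_mul_exp_neg_sq_half (a c : ℝ) :
    Tendsto (fun x : ℝ => (a * |x| + c) * Real.exp (-x ^ 2 / 2)) (cocompact ℝ) (𝓝 0) := by
  have h1 := tendsto_rpow_abs_mul_exp_neg_mul_sq_cocompact (a := 1 / 2) (by norm_num) 1
  have h0 := tendsto_rpow_abs_mul_exp_neg_mul_sq_cocompact (a := 1 / 2) (by norm_num) 0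
  have := (h1.const_mul a).add (h0.const_mul c)
  simp only [mul_zero, add_zero] at this
  refine this.congr fun x => ?_
  have : -(1 / 2) * x ^ 2 = -x ^ 2 / 2 := by ring
  rw [this, Real.rpow_one, Real.rpow_zero]; ring

/-- The solution is exp(x²/2) times the primitive F of the weighted test function. One barrier
bounds F, hence f; a second bounds x f'(x), hence f' and f''. -/
lemma exists_isSteinFun_of_centered {g g' : ℝ → ℝ} (hg : ∀ x, HasDerivAt g (g' x) x)
    (hg' : ∀ x, |g' x| ≤ 1) (hbd : ∀ x, |g x| ≤ |x| + 1)
    (hint : ∫ t, g t * Real.exp (-t ^ 2 / 2) = 0) :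
    ∃ f f' : ℝ → ℝ, IsSteinFun f f' ∧ ∀ x, f' x - x * f x = g x := by
  have hgc : Continuous g := continuous_iff_continuousAt.2 fun x => (hg x).continuousAt
  set w : ℝ → ℝ := fun t => g t * Real.exp (-t ^ 2 / 2) with hw
  have hwc : Continuous w := by fun_prop
  have hexp : ∀ x : ℝ, Real.exp (x ^ 2 / 2) * Real.exp (-x ^ 2 / 2) = 1 := fun x => by
    rw [← Real.exp_add]; ring_nf; exact Real.exp_zero
  have hwi : Integrable w := by
    have e1 : Integrable fun x : ℝ => |x| * Real.exp (-x ^ 2 / 2) := by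
      have := (integrable_mul_exp_neg_mul_sq (b := 1 / 2) (by norm_num)).norm
      refine this.congr (Eventually.of_forall fun x => ?_)
      have h : -(1 / 2) * x ^ 2 = -x ^ 2 / 2 := by ring
      simp only [norm_mul, Real.norm_eq_abs, h, Real.abs_exp]
    have e2 : Integrable fun x : ℝ => Real.exp (-x ^ 2 / 2) := by
      refine (integrable_exp_neg_mul_sq (b := 1 / 2) (by norm_num)).congr
        (Eventually.of_forall fun x => ?_)
      have h : -(1 / 2) * x ^ 2 = -x ^ 2 / 2 := by ring
      simp only [h]
    refine (e1.add e2).mono' hwc.aestronglyMeasurable (Eventually.of_forall fun x => ?_)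
    rw [Real.norm_eq_abs, hw, abs_mul, Real.abs_exp, Pi.add_apply, ← add_one_mul]
    exact mul_le_mul_of_nonneg_right (hbd x) (Real.exp_pos _).le
  -- F is the primitive that vanishes at -∞; since g is centred it vanishes at +∞ as well, so each
  -- half-line can be treated from its own infinite end.
  set F : ℝ → ℝ := fun x => (∫ t in Iic (0 : ℝ), w t) + ∫ t in (0 : ℝ)..x, w t with hF
  have hFd : ∀ x, HasDerivAt F (w x) x := fun x => by
    have := (intervalIntegral.integral_hasDerivAt_right (hwc.intervalIntegrable 0 x)
      (hwc.stronglyMeasurableAtFilter _ _) hwc.continuousAt)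
    exact this.const_add _
  have hFtop : Tendsto F atTop (𝓝 0) := by
    have h1 := intervalIntegral_tendsto_integral_Ioi 0 hwi.integrableOn tendsto_id
    have h2 := h1.const_add (∫ t in Iic (0 : ℝ), w t)
    rw [intervalIntegral.integral_Iic_add_Ioi hwi.integrableOn hwi.integrableOn, hint] at h2
    exact h2
  have hFbot : Tendsto F atBot (𝓝 0) := by
    have h1 := intervalIntegral_tendsto_integral_Iic 0 hwi.integrableOn tendsto_id
    have h2 := h1.const_sub (∫ t in Iic (0 : ℝ), w t)
    rw [sub_self] at h2
    refine h2.congr fun x => ?_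
    simp only [hF, id]
    rw [intervalIntegral.integral_symm]; ring
  have hFneg : ∀ x, HasDerivAt (fun y => F (-y)) (-g (-x) * Real.exp (-x ^ 2 / 2)) x := fun x => by
    have := (hFd (-x)).comp x (hasDerivAt_neg x)
    convert! this using 1
    simp [hw]
  -- The barrier 1 + 2/(1 + x) is at most 3 on x ≥ 0 and absorbs a source of size |x| + 1;
  -- reflection makes it serve the left half-line too.
  have hbneg : ∀ x : ℝ, 0 ≤ x → -2 / (1 + x) ^ 2 - x * (1 + 2 / (1 + x)) ≤ -(|x| + 1) := by
    intro x hx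
    rw [abs_of_nonneg hx]
    have : -2 / (1 + x) ^ 2 - x * (1 + 2 / (1 + x)) + (x + 1) = -(1 + x ^ 2) / (1 + x) ^ 2 := by
      field_simp; ring
    have h2 : -(1 + x ^ 2) / (1 + x) ^ 2 ≤ 0 := div_nonpos_of_nonpos_of_nonneg (by nlinarith) (by positivity)
    linarith
  have hbd1 : ∀ x : ℝ, 0 ≤ x → HasDerivAt (fun x : ℝ => 1 + 2 / (1 + x)) (-2 / (1 + x) ^ 2) x := by
    intro x hx
    have h := ((hasDerivAt_id x).const_add 1)
    have := ((hasDerivAt_const x (2 : ℝ)).div h (by simp; positivity)).const_add 1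
    convert! this using 1
    simp
  have hblim : Tendsto (fun x : ℝ => (1 + 2 / (1 + x)) * Real.exp (-x ^ 2 / 2)) atTop (𝓝 0) := by
    have h := (tendsto_affine_mul_exp_neg_sq_half 0 3).mono_left atTop_le_cocompact
    refine squeeze_zero' ((eventually_ge_atTop 0).mono fun x hx => by positivity)
      ((eventually_ge_atTop 0).mono fun x hx => ?_) h
    have : 2 / (1 + x) ≤ 2 := div_le_self zero_le_two (by linarith)
    rw [zero_mul, zero_add]
    gcongr
    linarith
  have hF3 : ∀ x, 0 ≤ x → |F x| ≤ 3 * Real.exp (-x ^ 2 / 2) ∧ |F (-x)| ≤ 3 * Real.exp (-x ^ 2 / 2) := by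
    intro x hx
    have h3 : (1 + 2 / (1 + x)) * Real.exp (-x ^ 2 / 2) ≤ 3 * Real.exp (-x ^ 2 / 2) := by
      have : 2 / (1 + x) ≤ 2 := div_le_self zero_le_two (by linarith)
      gcongr
      linarith
    refine ⟨le_trans ?_ h3, le_trans ?_ h3⟩
    · exact abs_le_of_gaussian_supersolution (x₀ := 0) (fun y _ => hFd y) hFtop hbd1 hblim
        (fun y hy => (hbneg y hy).trans (neg_le_neg (hbd y))) hx
    · refine abs_le_of_gaussian_supersolution (Φ := fun y => F (-y)) (x₀ := 0)
        (fun y _ => hFneg y) (hFbot.comp tendsto_neg_atTop_atBot) hbd1 hblim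
        (fun y hy => (hbneg y hy).trans (neg_le_neg ?_)) hx
      simpa using hbd (-y)
  have hF3' : ∀ x, |F x| ≤ 3 * Real.exp (-x ^ 2 / 2) := by
    intro x
    rcases le_total 0 x with hx | hx
    · exact (hF3 x hx).1
    · simpa using (hF3 (-x) (by linarith)).2
  set f : ℝ → ℝ := fun x => Real.exp (x ^ 2 / 2) * F x with hf
  set f' : ℝ → ℝ := fun x => x * f x + g x with hf'
  have hexpd : ∀ x : ℝ, HasDerivAt (fun x : ℝ => Real.exp (x ^ 2 / 2)) (x * Real.exp (x ^ 2 / 2)) x := by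
    intro x
    have h : HasDerivAt (fun x : ℝ => x ^ 2 / 2) x x := by
      have := (hasDerivAt_pow 2 x).div_const 2
      convert! this using 1
      simp
    have := h.exp
    convert! this using 1
    ring
  have hfd : ∀ x, HasDerivAt f (f' x) x := by
    intro x
    have := (hexpd x).mul (hFd x)
    convert! this using 1
    simp only [hf', hf, hw]
    linear_combination (-g x) * hexp x
  have hf3 : ∀ x, |f x| ≤ 3 := by
    intro x
    rw [hf, abs_mul, Real.abs_exp]
    calc _ ≤ Real.exp (x ^ 2 / 2) * (3 * Real.exp (-x ^ 2 / 2)) := by gcongr; exact hF3' x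
      _ = 3 := by linear_combination 3 * hexp x
  -- Differentiating Stein's equation gives f'' = x f' + r, so f' solves an equation of the same
  -- kind whose source is bounded by 3 + 1 = 4.
  set r : ℝ → ℝ := fun x => f x + g' x with hr
  have hr4 : ∀ x, |r x| ≤ 4 := fun x => (abs_add_le _ _).trans (by linarith [hf3 x, hg' x])
  have hf'd : ∀ x, HasDerivAt f' (x * f' x + r x) x := by
    intro x
    have := ((hasDerivAt_id x).mul (hfd x)).add (hg x)
    convert! this using 1
    simp [hr]; ring
  set Φ : ℝ → ℝ := fun x => f' x * Real.exp (-x ^ 2 / 2) with hΦ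
  have hΦd : ∀ x, HasDerivAt Φ (r x * Real.exp (-x ^ 2 / 2)) x := by
    intro x
    have := (hf'd x).mul (hasDerivAt_exp_neg_sq_half x)
    convert! this using 1
    ring
  have hΦlim : Tendsto Φ (cocompact ℝ) (𝓝 0) := by
    refine squeeze_zero_norm (fun x => ?_) (tendsto_affine_mul_exp_neg_sq_half 4 1)
    rw [Real.norm_eq_abs, hΦ, abs_mul, Real.abs_exp]
    gcongr
    calc |x * f x + g x| ≤ |x| * |f x| + |g x| := (abs_add_le _ _).trans (by rw [abs_mul])
      _ ≤ |x| * 3 + (|x| + 1) := by gcongr; exacts [hf3 x, hbd x]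
      _ = _ := by ring
  have hΦneg : ∀ x, HasDerivAt (fun y => Φ (-y)) (-r (-x) * Real.exp (-x ^ 2 / 2)) x := fun x => by
    have := (hΦd (-x)).comp x (hasDerivAt_neg x)
    convert! this using 1
    simp
  -- The barrier is now 4/y on [x, ∞): y · (4/y) = 4 matches the bound on r. It yields |x f'(x)| ≤
  -- 4, and then |f''| ≤ 4 + 4 = 8.
  have hv : ∀ x, 0 < x → |x * f' x| ≤ 4 ∧ |(-x) * f' (-x)| ≤ 4 := by
    intro x hx
    have hbd2 : ∀ y, x ≤ y → HasDerivAt (fun y : ℝ => 4 / y) (-4 / y ^ 2) y := by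
      intro y hy
      have := ((hasDerivAt_const y (4 : ℝ)).div (hasDerivAt_id y) (by simp; linarith))
      convert! this using 1
      simp
    have hbl : Tendsto (fun y : ℝ => 4 / y * Real.exp (-y ^ 2 / 2)) atTop (𝓝 0) := by
      have h := (tendsto_affine_mul_exp_neg_sq_half 0 4).mono_left atTop_le_cocompact
      refine squeeze_zero' ((eventually_ge_atTop 1).mono fun x hx => by positivity)
        ((eventually_ge_atTop 1).mono fun x hx => ?_) h
      have : 4 / x ≤ 4 := div_le_self (by norm_num) hx
      rw [zero_mul, zero_add]
      gcongr
    have hin : ∀ y, x ≤ y → -4 / y ^ 2 - y * (4 / y) ≤ -4 := by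
      intro y hy
      have hy0 : y ≠ 0 := by linarith
      have : y * (4 / y) = 4 := by field_simp
      have h2 : -4 / y ^ 2 ≤ 0 := div_nonpos_of_nonpos_of_nonneg (by norm_num) (by positivity)
      linarith
    have e1 : |Φ x| ≤ 4 / x * Real.exp (-x ^ 2 / 2) :=
      abs_le_of_gaussian_supersolution (fun y _ => hΦd y) (hΦlim.mono_left atTop_le_cocompact)
        hbd2 hbl (fun y hy => (hin y hy).trans (neg_le_neg (hr4 y))) le_rfl
    have e2 : |Φ (-x)| ≤ 4 / x * Real.exp (-x ^ 2 / 2) := by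
      refine abs_le_of_gaussian_supersolution (Φ := fun y => Φ (-y)) (fun y _ => hΦneg y)
        ((hΦlim.mono_left atBot_le_cocompact).comp tendsto_neg_atTop_atBot)
        hbd2 hbl (fun y hy => (hin y hy).trans (neg_le_neg ?_)) le_rfl
      simpa using hr4 (-y)
    have fin : ∀ y, |y| * Real.exp (-x ^ 2 / 2) ≤ 4 / x * Real.exp (-x ^ 2 / 2) → |x * y| ≤ 4 := by
      intro y hy
      have := le_of_mul_le_mul_right hy (Real.exp_pos _)
      rw [abs_mul, abs_of_pos hx]
      calc x * |y| ≤ x * (4 / x) := by gcongr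
        _ = 4 := by field_simp
    refine ⟨fin _ ?_, ?_⟩
    · rwa [hΦ, abs_mul, Real.abs_exp] at e1
    · rw [neg_mul, abs_neg]
      refine fin _ ?_
      simp only [hΦ] at e2
      rwa [abs_mul, Real.abs_exp, neg_sq] at e2
  have hv' : ∀ x, |x * f' x| ≤ 4 := by
    intro x
    rcases lt_trichotomy x 0 with hx | hx | hx
    · simpa using (hv (-x) (by linarith)).2
    · simp [hx]
    · exact (hv x hx).1
  refine ⟨f, f', ⟨hfd, hf3, fun x => ?_, fun x y => ?_⟩, fun x => by simp [hf']⟩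
  · rcases le_total |x| 1 with hx | hx
    · calc |x * f x + g x| ≤ |x| * |f x| + |g x| := (abs_add_le _ _).trans (by rw [abs_mul])
        _ ≤ 1 * 3 + (1 + 1) := by gcongr; exacts [hf3 x, (hbd x).trans (by linarith)]
        _ = _ := by norm_num
    · have := hv' x
      rw [abs_mul] at this
      nlinarith [abs_nonneg (f' x)]
  · have := Convex.norm_image_sub_le_of_norm_hasDerivWithin_le (f := f') (C := 8)
      (fun z _ => (hf'd z).hasDerivWithinAt)
      (fun z _ => (abs_add_le _ _).trans (by linarith [hv' z, hr4 z])) convex_univ (mem_univ y)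
      (mem_univ x)
    exact this

/-- Centring by the Gaussian mean reduces to the previous lemma; its growth hypothesis |g| ≤ |x| + 1
holds because E|Z| ≤ 1, which follows from |z| ≤ (1 + z²)/2. -/
lemma exists_isSteinFun {g g' : ℝ → ℝ} (hg : ∀ x, HasDerivAt g (g' x) x)
    (hg' : ∀ x, |g' x| ≤ 1) :
    ∃ f f' : ℝ → ℝ, IsSteinFun f f' ∧
      ∀ x, f' x - x * f x = g x - ∫ z, g z ∂(gaussianReal 0 1) := by
  set γ := gaussianReal 0 1
  have hlip : ∀ x y, |g x - g y| ≤ |x - y| := fun x y => by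
    have := Convex.norm_image_sub_le_of_norm_hasDerivWithin_le (f := g) (C := 1)
      (fun z _ => (hg z).hasDerivWithinAt) (fun z _ => hg' z) convex_univ (mem_univ y) (mem_univ x)
    simpa using this
  have hgc : Continuous g := continuous_iff_continuousAt.2 fun x => (hg x).continuousAt
  have hid : Integrable (fun z : ℝ => z) γ := by
    have := (memLp_id_gaussianReal (μ := 0) (v := 1) 1).integrable (by simp)
    exact this
  have hid2 : MemLp (fun z : ℝ => z) 2 γ := memLp_id_gaussianReal (μ := 0) (v := 1) 2
  have hgi : Integrable g γ := by
    refine ((integrable_const |g 0|).add hid.norm).mono' hgc.aestronglyMeasurable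
      (Eventually.of_forall fun x => ?_)
    have := hlip x 0
    have h2 := abs_sub_abs_le_abs_sub (g x) (g 0)
    simp only [sub_zero, Real.norm_eq_abs, Pi.add_apply] at *
    linarith
  have habs : ∫ z, |z| ∂γ ≤ 1 := by
    have hv : ∫ z, z ^ 2 ∂γ = 1 := by
      have h1 := variance_id_gaussianReal (μ := 0) (v := 1)
      rw [variance_eq_integral (by fun_prop)] at h1
      have h2 := integral_id_gaussianReal (μ := 0) (v := 1)
      simp only [id, h2, sub_zero, NNReal.coe_one] at h1
      exact h1
    have h2 : ∫ z, |z| ∂γ ≤ ∫ z, (1 / 2 + 1 / 2 * z ^ 2) ∂γ := by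
      refine integral_mono hid.abs ((integrable_const _).add (hid2.integrable_sq.const_mul _))
        fun z => ?_
      simp only
      nlinarith [sq_nonneg (|z| - 1), sq_abs z]
    rw [integral_add (integrable_const _) (hid2.integrable_sq.const_mul _), integral_const_mul,
      hv] at h2
    simp at h2
    linarith
  refine exists_isSteinFun_of_centered (g := fun x => g x - ∫ z, g z ∂γ)
    (fun x => (hg x).sub_const _) hg' (fun x => ?_) ?_
  · have e : g x - ∫ z, g z ∂γ = ∫ z, (g x - g z) ∂γ := by
      rw [integral_sub (integrable_const _) hgi]; simp
    rw [e]
    calc |∫ z, (g x - g z) ∂γ| ≤ ∫ z, |g x - g z| ∂γ := abs_integral_le_integral_abs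
      _ ≤ ∫ z, (|x| + |z|) ∂γ := by
          refine integral_mono ((integrable_const _).sub hgi).abs
            ((integrable_const _).add hid.abs) fun z => ?_
          exact (hlip x z).trans (abs_sub _ _)
      _ = |x| + ∫ z, |z| ∂γ := by
          rw [integral_add (integrable_const _) hid.abs]; simp
      _ ≤ |x| + 1 := by linarith
  · have h0 : ∫ t, (g t - ∫ z, g z ∂γ) ∂γ = 0 := by
      rw [integral_sub hgi (integrable_const _)]; simp
    rw [integral_gaussianReal_eq_integral_smul (by simp)] at h0
    simp only [gaussianPDFReal, smul_eq_mul, NNReal.coe_one, mul_one, sub_zero] at h0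
    have e : ∀ t, (√(2 * Real.pi))⁻¹ * Real.exp (-t ^ 2 / 2) * (g t - ∫ z, g z ∂γ) =
        (√(2 * Real.pi))⁻¹ * ((g t - ∫ z, g z ∂γ) * Real.exp (-t ^ 2 / 2)) := fun t => by ring
    simp only [e] at h0
    rw [integral_const_mul] at h0
    rcases mul_eq_zero.1 h0 with h | h
    · exfalso; have : 0 < (√(2 * Real.pi))⁻¹ := by positivity
      linarith
    · exact h

/-- Averages of a `1`-Lipschitz function over short intervals are differentiable, `1`-Lipschitz and
uniformly close to it. -/
lemma exists_hasDerivAt_approx {g : ℝ → ℝ} (hg : LipschitzWith 1 g) {ε : ℝ} (hε : 0 < ε) :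
    ∃ h h' : ℝ → ℝ, (∀ x, HasDerivAt h (h' x) x) ∧ (∀ x, |h' x| ≤ 1) ∧
      ∀ x, |h x - g x| ≤ ε := by
  have hlip : ∀ x y, |g x - g y| ≤ |x - y| := fun x y => by
    simpa [Real.dist_eq] using hg.dist_le_mul x y
  have hgc := hg.continuous
  set P : ℝ → ℝ := fun x => ∫ t in (0 : ℝ)..x, g t
  have hP : ∀ x, HasDerivAt P (g x) x := fun x =>
    intervalIntegral.integral_hasDerivAt_right (hgc.intervalIntegrable 0 x)
      (hgc.stronglyMeasurableAtFilter _ _) hgc.continuousAt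
  refine ⟨fun x => (P (x + ε) - P x) / ε, fun x => (g (x + ε) - g x) / ε, fun x => ?_,
    fun x => ?_, fun x => ?_⟩
  · exact (((hP (x + ε)).comp_add_const x ε).sub (hP x)).div_const ε
  · rw [abs_div, abs_of_pos hε, div_le_one hε]
    have := hlip (x + ε) x
    simpa [abs_of_pos hε] using this
  · have e : (P (x + ε) - P x) / ε - g x = (∫ t in x..(x + ε), (g t - g x)) / ε := by
      rw [intervalIntegral.integral_sub (hgc.intervalIntegrable _ _)
        (intervalIntegrable_const), intervalIntegral.integral_const,
        ← intervalIntegral.integral_interval_sub_left (hgc.intervalIntegrable 0 _)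
          (hgc.intervalIntegrable 0 _)]
      simp only [add_sub_cancel_left, smul_eq_mul]
      field_simp
      rfl
    rw [e, abs_div, abs_of_pos hε, div_le_iff₀ hε]
    have := intervalIntegral.norm_integral_le_of_norm_le_const (a := x) (b := x + ε)
      (f := fun t => g t - g x) (C := ε) fun t ht => by
        rw [uIoc_of_le (by linarith)] at ht
        refine (hlip t x).trans ?_
        rw [abs_of_nonneg (by linarith [ht.1])]
        linarith [ht.2]
    simpa [abs_of_pos hε] using this

/-- Stein's method: the Wasserstein distance to the standard normal law. -/
theorem wassersteinDist_map_le {Ω : Type*} [MeasurableSpace Ω] {μ : Measure Ω}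
    [IsProbabilityMeasure μ] {W U : Ω → ℝ} (hWm : Measurable W) (hW : Integrable W μ)
    (hU : Integrable U μ) {K : ℝ≥0∞}
    (hK : ∀ f f', IsSteinFun f f' → ‖∫ ω, (f' (U ω) - U ω * f (U ω)) ∂μ‖ₑ ≤ K) :
    wassersteinDist (μ.map W) (gaussianReal 0 1) ≤ ∫⁻ ω, ‖W ω - U ω‖ₑ ∂μ + K := by
  refine iSup₂_le fun g hg => ?_
  have hlip : ∀ x y, |g x - g y| ≤ |x - y| := fun x y => by
    simpa [Real.dist_eq] using hg.dist_le_mul x y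
  have hcomp : ∀ {V : Ω → ℝ}, Integrable V μ → ∀ {h : ℝ → ℝ}, Continuous h →
      (∃ c, ∀ x, |h x| ≤ c + |x|) → Integrable (fun ω => h (V ω)) μ := by
    rintro V hV h hh ⟨c, hc⟩
    exact ((integrable_const c).add hV.norm).mono' (hh.comp_aestronglyMeasurable hV.1)
      (Eventually.of_forall fun ω => hc _)
  have hgb : ∀ x, |g x| ≤ |g 0| + |x| := fun x => by
    have := hlip x 0
    have h2 := abs_sub_abs_le_abs_sub (g x) (g 0)
    rw [sub_zero] at this
    linarith
  have hid : Integrable (fun z : ℝ => z) (gaussianReal 0 1) := by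
    have := (memLp_id_gaussianReal (μ := 0) (v := 1) 1).integrable (by simp)
    exact this
  rw [integral_map hWm.aemeasurable hg.continuous.aestronglyMeasurable]
  apply ENNReal.le_of_forall_pos_le_add
  intro ε hε _
  -- The test function is smoothed so that it has a derivative everywhere. The error ε/2 is paid
  -- twice, under the law of U and under the Gaussian law.
  obtain ⟨h, h', hh, hh1, hhg⟩ := exists_hasDerivAt_approx hg (ε := ε / 2) (by positivity)
  have hhc : Continuous h := continuous_iff_continuousAt.2 fun x => (hh x).continuousAt
  have hhb : ∀ x, |h x| ≤ (|g 0| + ε) + |x| := fun x => by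
    have h1 := hhg x
    have h2 := abs_sub_abs_le_abs_sub (h x) (g x)
    have h3 := hgb x
    have : (0 : ℝ) ≤ ε := ε.2
    linarith
  obtain ⟨f, f', hf, hfe⟩ := exists_isSteinFun hh hh1
  have h1 : |(∫ ω, g (W ω) ∂μ) - ∫ ω, g (U ω) ∂μ| ≤ ∫ ω, |W ω - U ω| ∂μ := by
    rw [← integral_sub (hcomp hW hg.continuous ⟨_, hgb⟩) (hcomp hU hg.continuous ⟨_, hgb⟩)]
    refine abs_integral_le_integral_abs.trans (integral_mono
      ((hcomp hW hg.continuous ⟨_, hgb⟩).sub (hcomp hU hg.continuous ⟨_, hgb⟩)).abs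
      (hW.sub hU).abs fun ω => hlip _ _)
  have h2 : |(∫ ω, h (U ω) ∂μ) - ∫ ω, g (U ω) ∂μ| ≤ ε / 2 := by
    rw [← integral_sub (hcomp hU hhc ⟨_, hhb⟩) (hcomp hU hg.continuous ⟨_, hgb⟩)]
    refine abs_integral_le_integral_abs.trans ?_
    refine (integral_mono ((hcomp hU hhc ⟨_, hhb⟩).sub (hcomp hU hg.continuous ⟨_, hgb⟩)).abs
      (integrable_const _) fun ω => hhg _).trans (by simp)
  have hgz : Integrable g (gaussianReal 0 1) :=
    ((integrable_const |g 0|).add hid.norm).mono' hg.continuous.aestronglyMeasurable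
      (Eventually.of_forall fun ω => hgb _)
  have hhz : Integrable h (gaussianReal 0 1) :=
    ((integrable_const (|g 0| + ε)).add hid.norm).mono' hhc.aestronglyMeasurable
      (Eventually.of_forall fun ω => hhb _)
  have h3 : |(∫ z, h z ∂(gaussianReal 0 1)) - ∫ z, g z ∂(gaussianReal 0 1)| ≤ ε / 2 := by
    rw [← integral_sub hhz hgz]
    refine abs_integral_le_integral_abs.trans ?_
    exact (integral_mono (hhz.sub hgz).abs (integrable_const _) fun ω => hhg _).trans (by simp)
  have h4 : ∫ ω, (f' (U ω) - U ω * f (U ω)) ∂μ =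
      (∫ ω, h (U ω) ∂μ) - ∫ z, h z ∂(gaussianReal 0 1) := by
    simp only [hfe]
    rw [integral_sub (hcomp hU hhc ⟨_, hhb⟩) (integrable_const _)]
    simp
  have h5 := hK f f' hf
  set a := ∫ ω, (f' (U ω) - U ω * f (U ω)) ∂μ
  have h6 : |(∫ ω, g (W ω) ∂μ) - ∫ z, g z ∂(gaussianReal 0 1)| ≤
      ∫ ω, |W ω - U ω| ∂μ + |a| + ε := by
    rw [h4]
    rw [abs_le] at *
    have h7 := le_abs_self ((∫ ω, h (U ω) ∂μ) - ∫ z, h z ∂(gaussianReal 0 1))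
    have h8 := neg_abs_le ((∫ ω, h (U ω) ∂μ) - ∫ z, h z ∂(gaussianReal 0 1))
    constructor <;> linarith [h1.1, h1.2, h2.1, h2.2, h3.1, h3.2]
  calc _ ≤ ENNReal.ofReal (∫ ω, |W ω - U ω| ∂μ + |a| + ε) := ENNReal.ofReal_le_ofReal h6
    _ ≤ ENNReal.ofReal (∫ ω, |W ω - U ω| ∂μ) + ENNReal.ofReal |a| + ENNReal.ofReal ε :=
        ENNReal.ofReal_add_le.trans (add_le_add_left ENNReal.ofReal_add_le _)
    _ ≤ _ := by
        rw [ENNReal.ofReal_coe_nnreal, ← Real.enorm_eq_ofReal_abs]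
        gcongr
        have := ofReal_integral_norm_eq_lintegral_enorm (hW.sub hU)
        exact this.le

end Stein

/-! ### From mixing coefficients to differences of integrals -/

section BetaCoupling

variable {Ω A B : Type*} [MeasurableSpace A] [MeasurableSpace B]

/-- Subsets of a product space that depend only on finitely many measurable cells in each
coordinate. -/
def gridSets (A B : Type*) [MeasurableSpace A] [MeasurableSpace B] : Set (Set (A × B)) :=
  {E | ∃ (k l : ℕ) (f : A → Fin k) (g : B → Fin l) (T : Set (Fin k × Fin l)),
    Measurable f ∧ Measurable g ∧ E = {p | (f p.1, g p.2) ∈ T}}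

/-- For a union, the two grids are refined to a common one; its cells are pairs of cells, encoded in
`Fin (k * k')`. -/
lemma isSetAlgebra_gridSets : IsSetAlgebra (gridSets A B) where
  empty_mem := ⟨1, 1, fun _ => 0, fun _ => 0, ∅, measurable_const, measurable_const, by simp⟩
  compl_mem := by
    rintro s ⟨k, l, f, g, T, hf, hg, rfl⟩
    exact ⟨k, l, f, g, Tᶜ, hf, hg, by ext; simp⟩
  union_mem := by
    rintro s t ⟨k, l, f, g, T, hf, hg, rfl⟩ ⟨k', l', f', g', T', hf', hg', rfl⟩
    refine ⟨k * k', l * l', fun x => finProdFinEquiv (f x, f' x),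
      fun x => finProdFinEquiv (g x, g' x),
      {p | ((finProdFinEquiv.symm p.1).1, (finProdFinEquiv.symm p.2).1) ∈ T ∨
        ((finProdFinEquiv.symm p.1).2, (finProdFinEquiv.symm p.2).2) ∈ T'}, ?_, ?_, ?_⟩
    · exact (measurable_of_finite _).comp (hf.prodMk hf')
    · exact (measurable_of_finite _).comp (hg.prodMk hg')
    · ext p; simp only [Set.mem_union, Set.mem_ofPred_eq, Equiv.symm_apply_apply]

lemma generateFrom_gridSets :
    (inferInstance : MeasurableSpace (A × B)) = MeasurableSpace.generateFrom (gridSets A B) := by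
  classical
  apply le_antisymm
  · rw [← generateFrom_prod]
    apply MeasurableSpace.generateFrom_mono
    rintro _ ⟨s, hs, t, ht, rfl⟩
    refine ⟨2, 2, fun x => if x ∈ s then 1 else 0, fun x => if x ∈ t then 1 else 0, {(1, 1)},
      Measurable.ite hs measurable_const measurable_const,
      Measurable.ite ht measurable_const measurable_const, ?_⟩
    ext p
    by_cases h1 : p.1 ∈ s <;> by_cases h2 : p.2 ∈ t <;> simp [h1, h2]
  · apply MeasurableSpace.generateFrom_le
    rintro _ ⟨k, l, f, g, T, hf, hg, rfl⟩
    exact ((hf.comp measurable_fst).prodMk (hg.comp measurable_snd)) (T.toFinite.measurableSet)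

/-- A grid set is a disjoint union of product cells, so the difference is a partial sum of the terms
in the definition of β; the factor 2 cancels the 1/2 there. -/
lemma abs_sub_le_betaSigma_of_mem_gridSets {F₁ F₂ : MeasurableSpace Ω} {mΩ : MeasurableSpace Ω}
    {μ : Measure Ω} [IsProbabilityMeasure μ] (h₁ : F₁ ≤ mΩ) (h₂ : F₂ ≤ mΩ)
    {Y : Ω → A} {Z : Ω → B} (hY : Measurable[F₁] Y) (hZ : Measurable[F₂] Z)
    {E : Set (A × B)} (hE : E ∈ gridSets A B) :
    ENNReal.ofReal |(μ.map fun ω => (Y ω, Z ω)).real E - ((μ.map Y).prod (μ.map Z)).real E|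
      ≤ 2 * betaSigma μ F₁ F₂ := by
  classical
  obtain ⟨k, l, f, g, T, hf, hg, rfl⟩ := hE
  have hY' : Measurable Y := hY.mono h₁ le_rfl
  have hZ' : Measurable Z := hZ.mono h₂ le_rfl
  have hpr := Measure.isProbabilityMeasure_map (μ := μ) hY'.aemeasurable
  have hpr2 := Measure.isProbabilityMeasure_map (μ := μ) hZ'.aemeasurable
  have hpr3 := Measure.isProbabilityMeasure_map (μ := μ) (hY'.prodMk hZ').aemeasurable
  set P : Fin k → Set Ω := fun a => Y ⁻¹' (f ⁻¹' {a})
  set Q : Fin l → Set Ω := fun b => Z ⁻¹' (g ⁻¹' {b})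
  have hdec : {p : A × B | (f p.1, g p.2) ∈ T} =
      ⋃ c ∈ T.toFinset, (f ⁻¹' {c.1}) ×ˢ (g ⁻¹' {c.2}) := by
    ext p; simp
  have hms : ∀ c : Fin k × Fin l, MeasurableSet ((f ⁻¹' {c.1}) ×ˢ (g ⁻¹' {c.2})) := fun c =>
    (hf (measurableSet_singleton _)).prod (hg (measurableSet_singleton _))
  have hdisj : (T.toFinset : Set (Fin k × Fin l)).PairwiseDisjoint
      fun c => (f ⁻¹' {c.1}) ×ˢ (g ⁻¹' {c.2}) := by
    intro c _ c' _ hcc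
    rw [Function.onFun, Set.disjoint_left]
    rintro p ⟨h1, h2⟩ ⟨h3, h4⟩
    simp only [Set.mem_preimage, Set.mem_singleton_iff] at h1 h2 h3 h4
    exact hcc (Prod.ext (h1.symm.trans h3) (h2.symm.trans h4))
  have e1 : (μ.map fun ω => (Y ω, Z ω)).real {p : A × B | (f p.1, g p.2) ∈ T} =
      ∑ c ∈ T.toFinset, μ.real (P c.1 ∩ Q c.2) := by
    rw [hdec, measureReal_biUnion_finset hdisj (fun c _ => hms c)]
    refine Finset.sum_congr rfl fun c _ => ?_
    rw [map_measureReal_apply (hY'.prodMk hZ') (hms c)]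
    rfl
  have e2 : ((μ.map Y).prod (μ.map Z)).real {p : A × B | (f p.1, g p.2) ∈ T} =
      ∑ c ∈ T.toFinset, μ.real (P c.1) * μ.real (Q c.2) := by
    rw [hdec, measureReal_biUnion_finset hdisj (fun c _ => hms c)]
    refine Finset.sum_congr rfl fun c _ => ?_
    rw [measureReal_prod_prod, map_measureReal_apply hY' (hf (measurableSet_singleton _)),
      map_measureReal_apply hZ' (hg (measurableSet_singleton _))]
  rw [e1, e2, ← Finset.sum_sub_distrib]
  have hP : IsFinPartition F₁ P := by
    refine ⟨fun a => hY (hf (measurableSet_singleton _)), fun a b hab => ?_, ?_⟩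
    · refine Set.disjoint_left.2 ?_; rintro ω h1 h2
      exact hab (Eq.trans (Eq.symm h1) h2)
    · ext ω; simp [P]
  have hQ : IsFinPartition F₂ Q := by
    refine ⟨fun a => hZ (hg (measurableSet_singleton _)), fun a b hab => ?_, ?_⟩
    · refine Set.disjoint_left.2 ?_; rintro ω h1 h2
      exact hab (Eq.trans (Eq.symm h1) h2)
    · ext ω; simp [Q]
  have hle : ENNReal.ofReal ((1 / 2) * ∑ a, ∑ b, |μ.real (P a ∩ Q b) - μ.real (P a) * μ.real (Q b)|)
      ≤ betaSigma μ F₁ F₂ :=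
    le_iSup_of_le k <| le_iSup_of_le l <| le_iSup_of_le P <| le_iSup_of_le Q <|
      le_iSup_of_le hP <| le_iSup_of_le hQ le_rfl
  calc _ ≤ ENNReal.ofReal (2 * ((1 / 2) *
          ∑ a, ∑ b, |μ.real (P a ∩ Q b) - μ.real (P a) * μ.real (Q b)|)) := by
        apply ENNReal.ofReal_le_ofReal
        rw [← mul_assoc, mul_one_div_cancel two_ne_zero, one_mul, ← Fintype.sum_prod_type']
        exact (Finset.abs_sum_le_sum_abs _ _).trans
          (Finset.sum_le_univ_sum_of_nonneg fun _ => abs_nonneg _)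
    _ ≤ _ := by
        rw [ENNReal.ofReal_mul zero_le_two, ENNReal.ofReal_ofNat]
        gcongr

/-- The grid sets form an algebra that generates the product σ-algebra. Density with respect to the
sum of the joint law and the product law approximates a measurable set under both at once. -/
lemma measure_le_add_betaSigma {F₁ F₂ : MeasurableSpace Ω} {mΩ : MeasurableSpace Ω}
    {μ : Measure Ω} [IsProbabilityMeasure μ] (h₁ : F₁ ≤ mΩ) (h₂ : F₂ ≤ mΩ)
    {Y : Ω → A} {Z : Ω → B} (hY : Measurable[F₁] Y) (hZ : Measurable[F₂] Z)
    {E : Set (A × B)} (hE : MeasurableSet E) :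
    ENNReal.ofReal |(μ.map fun ω => (Y ω, Z ω)).real E - ((μ.map Y).prod (μ.map Z)).real E|
      ≤ 2 * betaSigma μ F₁ F₂ := by
  have hY' : Measurable Y := hY.mono h₁ le_rfl
  have hZ' : Measurable Z := hZ.mono h₂ le_rfl
  have hpr := Measure.isProbabilityMeasure_map (μ := μ) hY'.aemeasurable
  have hpr2 := Measure.isProbabilityMeasure_map (μ := μ) hZ'.aemeasurable
  have hpr3 := Measure.isProbabilityMeasure_map (μ := μ) (hY'.prodMk hZ').aemeasurable
  set ν₁ := μ.map fun ω => (Y ω, Z ω)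
  set ν₂ := (μ.map Y).prod (μ.map Z)
  apply ENNReal.le_of_forall_pos_le_add
  intro ε hε _
  have hd := Measure.MeasureDense.of_generateFrom_isSetAlgebra_finite (μ := ν₁ + ν₂)
    (isSetAlgebra_gridSets (A := A) (B := B)) generateFrom_gridSets
  obtain ⟨t, ht, hlt⟩ := hd.approx E hE (measure_ne_top _ _) ε (by exact_mod_cast hε)
  have htm := hd.measurable t ht
  have hlt' : ν₁.real (symmDiff E t) + ν₂.real (symmDiff E t) ≤ ε := by
    have := ENNReal.toReal_mono ENNReal.ofReal_ne_top hlt.le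
    rw [Measure.add_apply, ENNReal.toReal_add (measure_ne_top _ _) (measure_ne_top _ _),
      ENNReal.toReal_ofReal ε.coe_nonneg] at this
    exact this
  have ha : |ν₁.real E - ν₁.real t| ≤ ν₁.real (symmDiff E t) :=
    abs_measureReal_sub_le_measureReal_symmDiff hE.nullMeasurableSet htm.nullMeasurableSet
  have hb : |ν₂.real E - ν₂.real t| ≤ ν₂.real (symmDiff E t) :=
    abs_measureReal_sub_le_measureReal_symmDiff hE.nullMeasurableSet htm.nullMeasurableSet
  have hkey : |ν₁.real E - ν₂.real E| ≤ |ν₁.real t - ν₂.real t| + ε := by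
    rw [abs_le] at ha hb ⊢
    have h1 := le_abs_self (ν₁.real t - ν₂.real t)
    have h2 := neg_abs_le (ν₁.real t - ν₂.real t)
    constructor <;> linarith [ha.1, ha.2, hb.1, hb.2]
  calc ENNReal.ofReal |ν₁.real E - ν₂.real E| ≤ ENNReal.ofReal (|ν₁.real t - ν₂.real t| + ε) :=
        ENNReal.ofReal_le_ofReal hkey
    _ ≤ ENNReal.ofReal |ν₁.real t - ν₂.real t| + ENNReal.ofReal ε := ENNReal.ofReal_add_le
    _ ≤ 2 * betaSigma μ F₁ F₂ + ε := by
        rw [ENNReal.ofReal_coe_nnreal]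
        gcongr
        exact abs_sub_le_betaSigma_of_mem_gridSets h₁ h₂ hY hZ ht

/-- A difference of integrals with respect to two finite measures, bounded by means of their
distance in total variation and the `r`-th moments of the integrand. -/
lemma enorm_integral_sub_integral_le {α : Type*} [MeasurableSpace α] {ν₁ ν₂ : Measure α}
    [IsFiniteMeasure ν₁] [IsFiniteMeasure ν₂] {η : ℝ≥0∞}
    (hη : ∀ E, MeasurableSet E → ENNReal.ofReal |ν₁.real E - ν₂.real E| ≤ η)
    {h : α → ℝ} (hi₁ : Integrable h ν₁) (hi₂ : Integrable h ν₂) {r : ℝ} (hr : 1 ≤ r) :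
    ‖∫ x, h x ∂ν₁ - ∫ x, h x ∂ν₂‖ₑ ≤
      (eLpNorm h (ENNReal.ofReal r) ν₁ + eLpNorm h (ENNReal.ofReal r) ν₂)
        * (2 * η) ^ (1 - 1 / r) := by
  -- On s the measure ν₁ dominates, on its complement ν₂ does. The excesses ρ₁ and ρ₂ have mass at
  -- most η each.
  obtain ⟨s, hs, h1, h2⟩ := hahn_decomposition ν₁ ν₂
  have hle1 : ν₂.restrict s ≤ ν₁.restrict s := by
    refine Measure.le_iff.2 fun t ht => ?_
    rw [Measure.restrict_apply ht, Measure.restrict_apply ht]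
    exact h1 _ (ht.inter hs) Set.inter_subset_right
  have hle2 : ν₁.restrict sᶜ ≤ ν₂.restrict sᶜ := by
    refine Measure.le_iff.2 fun t ht => ?_
    rw [Measure.restrict_apply ht, Measure.restrict_apply ht]
    exact h2 _ (ht.inter hs.compl) Set.inter_subset_right
  set ρ₁ := ν₁.restrict s - ν₂.restrict s
  set ρ₂ := ν₂.restrict sᶜ - ν₁.restrict sᶜ
  have d1 : ρ₁ + ν₂.restrict s = ν₁.restrict s := Measure.sub_add_cancel_of_le hle1
  have d2 : ρ₂ + ν₁.restrict sᶜ = ν₂.restrict sᶜ := Measure.sub_add_cancel_of_le hle2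
  have l1 : ρ₁ ≤ ν₁ := (Measure.sub_le).trans Measure.restrict_le_self
  have l2 : ρ₂ ≤ ν₂ := (Measure.sub_le).trans Measure.restrict_le_self
  have b1 : ρ₁ Set.univ ≤ η := by
    have e : ρ₁ Set.univ + ν₂ s = ν₁ s := by
      have := congrArg (fun m => m Set.univ) d1
      simpa using this
    have e' : ρ₁ Set.univ = ENNReal.ofReal (ν₁.real s - ν₂.real s) := by
      have hn : ρ₁ Set.univ ≠ ∞ := ((l1 Set.univ).trans_lt (measure_lt_top _ _)).ne
      rw [measureReal_def, measureReal_def, ← e, ENNReal.toReal_add hn (measure_ne_top _ _),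
        add_sub_cancel_right, ENNReal.ofReal_toReal hn]
    rw [e']
    exact (ENNReal.ofReal_le_ofReal (le_abs_self _)).trans (hη s hs)
  have b2 : ρ₂ Set.univ ≤ η := by
    have e : ρ₂ Set.univ + ν₁ sᶜ = ν₂ sᶜ := by
      have := congrArg (fun m => m Set.univ) d2
      simpa using this
    have e' : ρ₂ Set.univ = ENNReal.ofReal (ν₂.real sᶜ - ν₁.real sᶜ) := by
      have hn : ρ₂ Set.univ ≠ ∞ := ((l2 Set.univ).trans_lt (measure_lt_top _ _)).ne
      rw [measureReal_def, measureReal_def, ← e, ENNReal.toReal_add hn (measure_ne_top _ _),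
        add_sub_cancel_right, ENNReal.ofReal_toReal hn]
    rw [e']
    refine (ENNReal.ofReal_le_ofReal (le_abs_self _)).trans ?_
    rw [abs_sub_comm]
    exact hη sᶜ hs.compl
  -- Both integrals contain the same contribution of ν₂ on s and ν₁ off s, so only the integrals
  -- against ρ₁ and ρ₂ survive in the difference.
  have i1 : ∫ x, h x ∂ν₁ = ∫ x, h x ∂ρ₁ + ∫ x in s, h x ∂ν₂ + ∫ x in sᶜ, h x ∂ν₁ := by
    rw [← integral_add_compl hs hi₁, ← d1,
      integral_add_measure (hi₁.mono_measure l1) hi₂.restrict]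
  have i2 : ∫ x, h x ∂ν₂ = ∫ x in s, h x ∂ν₂ + (∫ x, h x ∂ρ₂ + ∫ x in sᶜ, h x ∂ν₁) := by
    rw [← integral_add_compl hs hi₂, ← d2,
      integral_add_measure (hi₂.mono_measure l2) hi₁.restrict]
  -- Hölder's inequality on the small measure ρ: its mass enters with exponent 1 - 1/r, and its r-th
  -- moments are bounded by those of ν.
  have key : ∀ {ρ ν : Measure α}, ρ ≤ ν → ρ Set.univ ≤ η → Integrable h ν →
      ‖∫ x, h x ∂ρ‖ₑ ≤ eLpNorm h (ENNReal.ofReal r) ν * (2 * η) ^ (1 - 1 / r) := by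
    intro ρ ν hl hb hi
    calc ‖∫ x, h x ∂ρ‖ₑ ≤ ∫⁻ x, ‖h x‖ₑ ∂ρ := enorm_integral_le_lintegral_enorm _
      _ = eLpNorm h 1 ρ := eLpNorm_one_eq_lintegral_enorm.symm
      _ ≤ eLpNorm h (ENNReal.ofReal r) ρ * ρ Set.univ ^ (1 - 1 / r) := by
          have := eLpNorm_le_eLpNorm_mul_rpow_measure_univ (μ := ρ) (p := 1)
            (q := ENNReal.ofReal r) (by simpa using hr) (hi.1.mono_measure hl)
          simpa [ENNReal.toReal_ofReal (zero_le_one.trans hr)] using this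
      _ ≤ _ := by
          have hr' : 0 ≤ 1 - 1 / r := by
            rw [sub_nonneg, div_le_one (by linarith)]; exact hr
          exact mul_le_mul' (eLpNorm_mono_measure h hl) (ENNReal.rpow_le_rpow
            (hb.trans (le_mul_of_one_le_left zero_le one_le_two)) hr')
  have : ∫ x, h x ∂ν₁ - ∫ x, h x ∂ν₂ = ∫ x, h x ∂ρ₁ - ∫ x, h x ∂ρ₂ := by rw [i1, i2]; ring
  rw [this, add_mul]
  exact enorm_sub_le.trans (add_le_add (key l1 b1 hi₁) (key l2 b2 hi₂))

end BetaCoupling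

/-! ### Profiles of index vectors and inequalities between sparsity counts -/

section Counting

variable {ι : Type v} [EMetricSpace ι] {m : ℝ}

lemma mConnected_of_edist_le {q : ℕ} {i : Fin q → ι} {a b : Fin q}
    (h : edist (i a) (i b) ≤ ENNReal.ofReal m) : mConnected m i a b :=
  Relation.ReflTransGen.single h

/-- This is how positions are shown not to be connected: exhibit a label that is constant along
short steps but separates them. -/
lemma eq_of_mConnected {q : ℕ} {i : Fin q → ι} {α : Type*} {c : Fin q → α}
    (hc : ∀ a b, edist (i a) (i b) ≤ ENNReal.ofReal m → c a = c b) {a b : Fin q}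
    (h : mConnected m i a b) : c a = c b := by
  induction h with
  | refl => rfl
  | tail _ hbc ih => exact ih.trans (hc _ _ hbc)

open Classical in
lemma mem_profile {q : ℕ} {i : Fin q → ι} {c : ℕ} :
    c ∈ profile m i ↔ ∃ a, (Finset.univ.filter fun b => mConnected m i a b).card = c := by
  have hpart : ∀ a, (Finpartition.ofSetoid (mConnected m i)).part a =
      Finset.univ.filter fun b => mConnected m i a b := by
    intro a; ext b
    rw [Finpartition.mem_part_ofSetoid_iff_rel]
    simp
  unfold profile
  rw [Multiset.mem_map]
  constructor
  · rintro ⟨s, hs, rfl⟩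
    rw [Finset.mem_val] at hs
    obtain ⟨a, ha⟩ := Finpartition.nonempty_of_mem_parts _ hs
    refine ⟨a, ?_⟩
    rw [← hpart, Finpartition.part_eq_of_mem _ hs ha]
  · rintro ⟨a, rfl⟩
    refine ⟨_, (Finpartition.part_mem (P := Finpartition.ofSetoid (mConnected m i))).2
      (Finset.mem_univ a), ?_⟩
    rw [hpart]

lemma sum_profile {q : ℕ} (i : Fin q → ι) : (profile m i).sum = q := by
  classical
  have := (Finpartition.ofSetoid (mConnected m i)).sum_card_parts
  rw [Finset.card_univ, Fintype.card_fin] at this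
  refine Eq.trans ?_ this
  unfold profile
  rfl

lemma pos_of_mem_profile {q : ℕ} {i : Fin q → ι} {c : ℕ} (hc : c ∈ profile m i) : 0 < c := by
  classical
  obtain ⟨a, rfl⟩ := mem_profile.1 hc
  exact Finset.card_pos.2 ⟨a, by simp⟩

lemma profile_eq_singleton {q : ℕ} (hq : 0 < q) {i : Fin q → ι}
    (h : ∀ a b, mConnected m i a b) : profile m i = {q} := by
  classical
  have h1 : ∀ c ∈ profile m i, c = q := by
    intro c hc
    obtain ⟨a, rfl⟩ := mem_profile.1 hc
    rw [Finset.filter_true_of_mem fun b _ => h a b]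
    simp
  have h2 := Multiset.eq_replicate_of_mem h1
  have h3 := sum_profile (m := m) i
  rw [h2, Multiset.sum_replicate, smul_eq_mul] at h3
  have h4 : Multiset.card (profile m i) = 1 := by
    have : Multiset.card (profile m i) * q = 1 * q := by rw [h3, one_mul]
    exact Nat.eq_of_mul_eq_mul_right hq this
  rw [h2, h4]; rfl

lemma mConnected_of_profile_eq_singleton {q : ℕ} {i : Fin q → ι} (h : profile m i = {q})
    (a b : Fin q) : mConnected m i a b := by
  classical
  have h1 : (Finset.univ.filter fun b => mConnected m i a b).card ∈ profile m i :=
    mem_profile.2 ⟨a, rfl⟩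
  rw [h, Multiset.mem_singleton] at h1
  have h2 := Finset.eq_univ_of_card _ (h1.trans (Fintype.card_fin q).symm)
  have := Finset.mem_univ b
  rw [← h2] at this
  exact (Finset.mem_filter.1 this).2

/-- Profiles with a part equal to 1 are the ones to which degeneracy applies. -/
lemma exists_isolated {q : ℕ} {i : Fin q → ι} (h : 1 ∈ profile m i) :
    ∃ a, ∀ b, b ≠ a → ENNReal.ofReal m < edist (i a) (i b) := by
  classical
  obtain ⟨a, ha⟩ := mem_profile.1 h
  refine ⟨a, fun b hb => ?_⟩
  by_contra hlt
  have h1 : a ∈ Finset.univ.filter fun b => mConnected m i a b := by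
    simp
  have h2 : b ∈ Finset.univ.filter fun b => mConnected m i a b := by
    simpa using mConnected_of_edist_le (not_lt.1 hlt)
  exact hb (Finset.card_le_one.1 ha.le _ h2 _ h1)

lemma multiset_of_sum_eq_four {s : Multiset ℕ} (hs : s.sum = 4) (hpos : ∀ c ∈ s, 0 < c) :
    s = {4} ∨ s = {2, 2} ∨ s = {3, 1} ∨ s = {2, 1, 1} ∨ s = {1, 1, 1, 1} := by
  induction s using Quotient.inductionOn with | _ l =>
  simp only [Multiset.quot_mk_to_coe, Multiset.sum_coe, Multiset.mem_coe] at hs hpos ⊢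
  match l with
  | [] => simp at hs
  | [a] =>
    simp only [List.sum_cons, List.sum_nil, add_zero] at hs
    subst hs; decide
  | [a, b] =>
    simp only [List.sum_cons, List.sum_nil, List.mem_cons, List.not_mem_nil, or_false,
      forall_eq_or_imp, forall_eq] at hs hpos
    have : a ≤ 4 := by omega
    obtain rfl : b = 4 - a := by omega
    interval_cases a <;> first | omega | decide
  | [a, b, c] =>
    simp only [List.sum_cons, List.sum_nil, List.mem_cons, List.not_mem_nil, or_false,
      forall_eq_or_imp, forall_eq] at hs hpos
    have ha : a ≤ 2 := by omega
    have hb : b ≤ 2 := by omega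
    obtain rfl : c = 4 - a - b := by omega
    interval_cases a <;> interval_cases b <;> first | omega | decide
  | [a, b, c, d] =>
    simp only [List.sum_cons, List.sum_nil, List.mem_cons, List.not_mem_nil, or_false,
      forall_eq_or_imp, forall_eq] at hs hpos
    obtain ⟨rfl, rfl, rfl, rfl⟩ : a = 1 ∧ b = 1 ∧ c = 1 ∧ d = 1 := by omega
    decide
  | a :: b :: c :: d :: e :: t =>
    simp only [List.sum_cons, List.mem_cons, forall_eq_or_imp] at hs hpos
    omega

lemma profile_four_cases (i : Fin 4 → ι) :
    profile m i = {4} ∨ profile m i = {2, 2} ∨ profile m i = {3, 1} ∨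
      profile m i = {2, 1, 1} ∨ profile m i = {1, 1, 1, 1} :=
  multiset_of_sum_eq_four (sum_profile i) fun _ hc => pos_of_mem_profile hc

lemma mConnected_four {i : Fin 4 → ι} {a b c d : Fin 4} (habcd : ∀ x, x = a ∨ x = b ∨ x = c ∨ x = d)
    (hb : mConnected m i a b) (hc : mConnected m i a c) (hd : mConnected m i a d) :
    profile m i = {4} := by
  refine profile_eq_singleton (by norm_num) fun x y => ?_
  have : ∀ x, mConnected m i a x := by
    intro x
    rcases habcd x with rfl | rfl | rfl | rfl
    exacts [(mConnected m i).refl _, hb, hc, hd]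
  exact (mConnected m i).trans ((mConnected m i).symm (this x)) (this y)

/-- In a vector with profile `(2, 2)` two disjoint adjacent pairs are far from one another. -/
lemma far_of_profile_two_two {i : Fin 4 → ι} (h : profile m i = {2, 2}) {a b c d : Fin 4}
    (habcd : ∀ x, x = a ∨ x = b ∨ x = c ∨ x = d)
    (hab : edist (i a) (i b) ≤ ENNReal.ofReal m) (hcd : edist (i c) (i d) ≤ ENNReal.ofReal m) :
    ENNReal.ofReal m < edist (i a) (i c) ∧ ENNReal.ofReal m < edist (i a) (i d) ∧
      ENNReal.ofReal m < edist (i b) (i c) ∧ ENNReal.ofReal m < edist (i b) (i d) := by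
  have hne : profile m i ≠ {4} := by rw [h]; decide
  have R := mConnected m i
  have e1 := mConnected_of_edist_le hab
  have e2 := mConnected_of_edist_le hcd
  have key : ∀ x y, (x = a ∨ x = b) → (y = c ∨ y = d) → ENNReal.ofReal m < edist (i x) (i y) := by
    intro x y hx hy
    by_contra hlt
    apply hne
    have e3 := mConnected_of_edist_le (not_lt.1 hlt)
    have hx' : mConnected m i a x := by
      rcases hx with rfl | rfl
      exacts [(mConnected m i).refl _, e1]
    have hyc : mConnected m i y c := by
      rcases hy with rfl | rfl
      exacts [(mConnected m i).refl _, (mConnected m i).symm e2]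
    have hac := (mConnected m i).trans ((mConnected m i).trans hx' e3) hyc
    exact mConnected_four habcd e1 hac ((mConnected m i).trans hac e2)
  exact ⟨key _ _ (.inl rfl) (.inl rfl), key _ _ (.inl rfl) (.inr rfl),
    key _ _ (.inr rfl) (.inl rfl), key _ _ (.inr rfl) (.inr rfl)⟩

/-- No class is a singleton, so each position has a neighbour. Suppose a, b are adjacent while c, d
are not: then c and d both attach to {a, b} and the whole vector is connected, a contradiction. -/
lemma exists_matching_of_profile_two_two {i : Fin 4 → ι} (h : profile m i = {2, 2}) :
    (edist (i 0) (i 1) ≤ ENNReal.ofReal m ∧ edist (i 2) (i 3) ≤ ENNReal.ofReal m) ∨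
    (edist (i 0) (i 2) ≤ ENNReal.ofReal m ∧ edist (i 1) (i 3) ≤ ENNReal.ofReal m) ∨
    (edist (i 0) (i 3) ≤ ENNReal.ofReal m ∧ edist (i 1) (i 2) ≤ ENNReal.ofReal m) := by
  classical
  have hne : profile m i ≠ {4} := by rw [h]; decide
  have hiso : ∀ a, ∃ b, b ≠ a ∧ edist (i a) (i b) ≤ ENNReal.ofReal m := by
    intro a
    by_contra hcon
    push Not at hcon
    have h1 : (Finset.univ.filter fun b => mConnected m i a b) = {a} := by
      ext b
      simp only [Finset.mem_filter, Finset.mem_univ, true_and, Finset.mem_singleton]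
      constructor
      · intro hb
        have := eq_of_mConnected (c := fun x => decide (x = a)) (fun x y hxy => by
          by_cases hx : x = a
          · subst hx
            by_cases hy : y = x
            · simp [hy]
            · exact absurd hxy (not_le.2 (hcon y hy))
          · by_cases hy : y = a
            · subst hy
              rw [edist_comm] at hxy
              exact absurd hxy (not_le.2 (hcon x hx))
            · simp [hx, hy]) hb
        simpa using this.symm
      · rintro rfl; exact (mConnected m i).refl b
    have : 1 ∈ profile m i := mem_profile.2 ⟨a, by rw [h1]; simp⟩
    rw [h] at this
    exact absurd this (by decide)
  have main : ∀ a b c d : Fin 4, (∀ x, x = a ∨ x = b ∨ x = c ∨ x = d) → 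
      edist (i a) (i b) ≤ ENNReal.ofReal m → edist (i c) (i d) ≤ ENNReal.ofReal m := by
    intro a b c d hall hab
    by_contra hcd
    apply hne
    have e1 := mConnected_of_edist_le hab
    have key : ∀ x y, (x = c ∧ y = d ∨ x = d ∧ y = c) → mConnected m i a x := by
      intro x y hxy
      obtain ⟨z, hz, hxz⟩ := hiso x
      have e := mConnected_of_edist_le hxz
      have hcd' : ¬ edist (i d) (i c) ≤ ENNReal.ofReal m := by rwa [edist_comm]
      rcases hxy with ⟨rfl, rfl⟩ | ⟨rfl, rfl⟩
      · rcases hall z with rfl | rfl | rfl | rfl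
        · exact (mConnected m i).symm e
        · exact (mConnected m i).trans e1 ((mConnected m i).symm e)
        · exact absurd rfl hz
        · exact absurd hxz hcd
      · rcases hall z with rfl | rfl | rfl | rfl
        · exact (mConnected m i).symm e
        · exact (mConnected m i).trans e1 ((mConnected m i).symm e)
        · exact absurd hxz hcd'
        · exact absurd rfl hz
    exact mConnected_four hall e1 (key c d (.inl ⟨rfl, rfl⟩)) (key d c (.inr ⟨rfl, rfl⟩))
  obtain ⟨b, hb, h0b⟩ := hiso 0
  have hb' : b = 1 ∨ b = 2 ∨ b = 3 :=
    (by decide : ∀ b : Fin 4, b ≠ 0 → b = 1 ∨ b = 2 ∨ b = 3) b hb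
  rcases hb' with rfl | rfl | rfl
  · exact .inl ⟨h0b, main 0 1 2 3 (by decide) h0b⟩
  · exact .inr (.inl ⟨h0b, main 0 2 1 3 (by decide) h0b⟩)
  · exact .inr (.inr ⟨h0b, main 0 3 1 2 (by decide) h0b⟩)

/-- The label "is the last position" is constant along short steps, so the class of 0 is exactly {0,
1, 2}; (3, 1) is the only partition of 4 with a part 3. -/
lemma profile_eq_three_one {i : Fin 4 → ι}
    (h1 : edist (i 0) (i 1) ≤ ENNReal.ofReal m) (h2 : edist (i 0) (i 2) ≤ ENNReal.ofReal m)
    (f0 : ENNReal.ofReal m < edist (i 0) (i 3)) (f1 : ENNReal.ofReal m < edist (i 1) (i 3))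
    (f2 : ENNReal.ofReal m < edist (i 2) (i 3)) : profile m i = {3, 1} := by
  classical
  have hinv : ∀ a b : Fin 4, mConnected m i a b → decide (a = 3) = decide (b = 3) := by
    intro a b hab
    refine eq_of_mConnected (c := fun x => decide (x = 3)) (fun x y hxy => ?_) hab
    have hyx := hxy
    rw [edist_comm] at hyx
    fin_cases x <;> fin_cases y <;> first | rfl | (apply absurd hxy (not_le.2 _); assumption) |
      (apply absurd hyx (not_le.2 _); assumption)
  have e : (Finset.univ.filter fun b => mConnected m i 0 b) = {0, 1, 2} := by
    ext b
    simp only [Finset.mem_filter, Finset.mem_univ, true_and]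
    constructor
    · intro hb
      exact (by decide : ∀ b : Fin 4, decide (0 = (3 : Fin 4)) = decide (b = 3) →
        b ∈ ({0, 1, 2} : Finset (Fin 4))) b (hinv _ _ hb)
    · intro hb
      simp only [Finset.mem_insert, Finset.mem_singleton] at hb
      rcases hb with rfl | rfl | rfl
      exacts [(mConnected m i).refl _, mConnected_of_edist_le h1, mConnected_of_edist_le h2]
  have h3 : 3 ∈ profile m i := mem_profile.2 ⟨0, by rw [e]; rfl⟩
  rcases profile_four_cases (m := m) i with h | h | h | h | h <;> rw [h] at h3 ⊢ <;>
    exact absurd h3 (by decide)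

lemma sum_fin_four {ι : Type*} [Fintype ι] {M : Type*} [AddCommMonoid M] (F : (Fin 4 → ι) → M) :
    ∑ k, F k = ∑ a, ∑ b, ∑ c, ∑ d, F ![a, b, c, d] := by
  let e : ι × ι × ι × ι ≃ (Fin 4 → ι) :=
    { toFun := fun p => ![p.1, p.2.1, p.2.2.1, p.2.2.2]
      invFun := fun k => (k 0, k 1, k 2, k 3)
      left_inv := fun p => rfl
      right_inv := fun k => by ext j; fin_cases j <;> rfl }
  rw [← Equiv.sum_comp e, Fintype.sum_prod_type]
  simp only [Fintype.sum_prod_type]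
  rfl

/-! ### Comparison of the counts τ with neighbourhood sizes and with one another -/

section Tau

variable [Fintype ι]

open Classical in
lemma tau_eq_sum (l : List ℕ) : tau ι m l =
    ∑ i : Fin l.sum → ι, if profile m i = (l : Multiset ℕ) then 1 else 0 := by
  rw [Finset.sum_boole, tau, Nat.card_eq_fintype_card, Fintype.card_subtype]

/-- A sum over index vectors of length four is controlled by the sparsity counts. -/
lemma sum_le_tau_four {f : (Fin 4 → ι) → ℝ≥0∞} {a b c : ℝ≥0∞}
    (ha : ∀ k, profile m k = {4} → f k ≤ a) (hb : ∀ k, profile m k = {2, 2} → f k ≤ b)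
    (hc : ∀ k, 1 ∈ profile m k → f k ≤ c) :
    ∑ k, f k ≤ tau ι m [4] * a + tau ι m [2, 2] * b + tauHat4 ι m * c := by
  classical
  have e : ∀ (l : List ℕ) (x : ℝ≥0∞), l.sum = 4 → tau ι m l * x =
      ∑ k : Fin 4 → ι, if profile m k = (l : Multiset ℕ) then x else 0 := by
    intro l x hl
    rw [tau_eq_sum, Finset.sum_mul]
    simp only [ite_mul, one_mul, zero_mul]
    rw [hl]
  rw [tauHat4, add_mul, add_mul, e [4] a rfl, e [2, 2] b rfl, e [3, 1] c rfl, e [2, 1, 1] c rfl,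
    e [1, 1, 1, 1] c rfl]
  simp only [← Finset.sum_add_distrib]
  refine Finset.sum_le_sum fun k _ => ?_
  rcases profile_four_cases (m := m) k with h | h | h | h | h
  · exact (ha k h).trans (by rw [if_pos (by rw [h]; rfl)]; rw [add_assoc]; exact le_self_add)
  · exact (hb k h).trans (by
      rw [if_pos (c := profile m k = (([2, 2] : List ℕ) : Multiset ℕ)) (by rw [h]; rfl)]
      exact le_add_right le_add_self)
  · exact (hc k (by rw [h]; decide)).trans (by
      rw [if_pos (c := profile m k = (([3, 1] : List ℕ) : Multiset ℕ)) (by rw [h]; rfl)]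
      exact le_add_left (le_add_right le_self_add))
  · exact (hc k (by rw [h]; decide)).trans (by
      rw [if_pos (c := profile m k = (([2, 1, 1] : List ℕ) : Multiset ℕ)) (by rw [h]; rfl)]
      exact le_add_left (le_add_right le_add_self))
  · exact (hc k (by rw [h]; decide)).trans (by
      rw [if_pos (c := profile m k = (([1, 1, 1, 1] : List ℕ) : Multiset ℕ)) (by rw [h]; rfl)]
      exact le_add_left le_add_self)

open Classical in
/-- The nodes at distance at most `m` from `i`. -/
noncomputable def nbhd (m : ℝ) (i : ι) : Finset ι :=
  Finset.univ.filter fun j => edist i j ≤ ENNReal.ofReal m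

lemma mem_nbhd {i j : ι} : j ∈ nbhd m i ↔ edist i j ≤ ENNReal.ofReal m := by
  simp [nbhd]

lemma mem_nbhd_self (i : ι) : i ∈ nbhd m i := by simp [mem_nbhd]

lemma sum_card_nbhd_le : ∑ i : ι, ((nbhd m i).card : ℝ≥0∞) ≤ tau ι m [2] := by
  classical
  rw [tau_eq_sum]
  change _ ≤ ∑ k : Fin 2 → ι, if profile m k = {2} then 1 else 0
  rw [← Equiv.sum_comp (finTwoArrowEquiv ι).symm, Fintype.sum_prod_type]
  refine Finset.sum_le_sum fun i _ => ?_
  rw [nbhd, ← Finset.sum_boole]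
  refine Finset.sum_le_sum fun j _ => ?_
  by_cases h : edist i j ≤ ENNReal.ofReal m
  · rw [if_pos h, if_pos]
    refine profile_eq_singleton (by norm_num) fun a b => ?_
    have h' := h
    rw [edist_comm] at h'
    fin_cases a <;> fin_cases b
    · exact Setoid.refl' _ _
    · exact mConnected_of_edist_le h
    · exact mConnected_of_edist_le h'
    · exact Setoid.refl' _ _
  · rw [if_neg h]; exact zero_le

/-- A node together with three of its neighbours is a star, hence a connected vector of length four.
-/
lemma sum_card_nbhd_pow_three_le : ∑ i : ι, ((nbhd m i).card : ℝ≥0∞) ^ 3 ≤ tau ι m [4] := by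
  classical
  rw [tau_eq_sum]
  change _ ≤ ∑ k : Fin 4 → ι, if profile m k = {4} then 1 else 0
  rw [sum_fin_four]
  refine Finset.sum_le_sum fun i _ => ?_
  rw [nbhd, ← Finset.sum_boole, pow_three, Finset.sum_mul_sum, Finset.sum_mul_sum]
  refine Finset.sum_le_sum fun a _ => ?_
  simp only [Finset.mul_sum]
  refine Finset.sum_le_sum fun b _ => Finset.sum_le_sum fun c _ => ?_
  by_cases ha : edist i a ≤ ENNReal.ofReal m
  swap; · simp [ha]
  by_cases hb : edist i b ≤ ENNReal.ofReal m
  swap; · simp [hb]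
  by_cases hc : edist i c ≤ ENNReal.ofReal m
  swap; · simp [hc]
  have h4 : profile m ![i, a, b, c] = {4} :=
    mConnected_four (a := 0) (b := 1) (c := 2) (d := 3) (by decide) (mConnected_of_edist_le ha)
      (mConnected_of_edist_le hb) (mConnected_of_edist_le hc)
  simp [h4, ha, hb, hc]

lemma card_le_tau_two : (Fintype.card ι : ℝ≥0∞) ≤ tau ι m [2] := by
  refine le_trans ?_ sum_card_nbhd_le
  rw [← Finset.card_univ, Finset.cast_card]
  refine Finset.sum_le_sum fun i _ => ?_
  exact_mod_cast Finset.card_pos.2 ⟨i, mem_nbhd_self i⟩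

lemma card_le_tau_four : (Fintype.card ι : ℝ≥0∞) ≤ tau ι m [4] := by
  refine le_trans ?_ sum_card_nbhd_pow_three_le
  rw [← Finset.card_univ, Finset.cast_card]
  refine Finset.sum_le_sum fun i _ => ?_
  exact_mod_cast Nat.one_le_pow _ _ (Finset.card_pos.2 ⟨i, mem_nbhd_self i⟩)

lemma tau_two_le_sq : tau ι m [2] ≤ (Fintype.card ι : ℝ≥0∞) ^ 2 := by
  classical
  have h : Nat.card {i : Fin ([2] : List ℕ).sum → ι // profile m i = (([2] : List ℕ) : Multiset ℕ)}
      ≤ Fintype.card ι ^ 2 := by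
    refine (Finite.card_subtype_le _).trans ?_
    rw [Nat.card_eq_fintype_card, Fintype.card_fun, Fintype.card_fin]
    exact le_rfl
  unfold tau
  exact_mod_cast h

lemma tau_four_mono {m' : ℝ} (h : m ≤ m') : tau ι m [4] ≤ tau ι m' [4] := by
  classical
  rw [tau_eq_sum, tau_eq_sum]
  change ∑ k : Fin 4 → ι, (if profile m k = {4} then 1 else 0) ≤
    ∑ k : Fin 4 → ι, (if profile m' k = {4} then 1 else 0)
  refine Finset.sum_le_sum fun k _ => ?_
  by_cases hk : profile m k = {4}
  · have : profile m' k = {4} := by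
      refine profile_eq_singleton (by decide) fun a b => ?_
      have hab : Relation.ReflTransGen _ a b := mConnected_of_profile_eq_singleton hk a b
      exact Relation.ReflTransGen.mono
        (fun x y (hxy : edist (k x) (k y) ≤ ENNReal.ofReal m) =>
          hxy.trans (ENNReal.ofReal_le_ofReal h)) _ _ hab
    rw [if_pos this]
    split_ifs <;> simp
  · rw [if_neg hk]; exact zero_le

/-- Cauchy–Schwarz with c² = c^{1/2} c^{3/2}. This is the source of the factor √(τ₂ τ₄) in the bound
on A₄ + A₅. -/
lemma sq_sum_card_nbhd_sq_le : (∑ i : ι, ((nbhd m i).card : ℝ≥0∞) ^ 2) ^ 2 ≤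
    tau ι m [2] * tau ι m [4] := by
  have h : (∑ i : ι, (nbhd m i).card ^ 2) ^ 2 ≤
      (∑ i : ι, (nbhd m i).card) * ∑ i : ι, (nbhd m i).card ^ 3 :=
    Finset.sum_sq_le_sum_mul_sum_of_sq_le_mul _ (fun _ _ => Nat.zero_le _)
      (fun _ _ => Nat.zero_le _) fun i _ => (by ring : _ = _).le
  refine le_trans ?_ (mul_le_mul' sum_card_nbhd_le sum_card_nbhd_pow_three_le)
  exact_mod_cast h

/-- Removes τ_{2,2} from mixing errors, where only τ̂₄ may appear. Two separated close pairs (a, b),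
(c, d) are counted by α(a, c) α(c, a), where α(a, c) is the number of b near a and far from c. By
the arithmetic-geometric mean this is controlled by α(a, c)², which counts two companions of a with
c isolated. The factor 3 is the number of matchings of four positions. -/
lemma tau_two_two_le : tau ι m [2, 2] ≤ 3 * tau ι m [3, 1] := by
  classical
  set r := ENNReal.ofReal m
  set M : ι → ι → ι → ι → ℝ≥0∞ := fun a b c d => 
    if edist a b ≤ r ∧ edist c d ≤ r ∧ r < edist a c ∧ r < edist a d ∧ r < edist b c ∧ r < edist b d
      then 1 else 0 with hM
  set α : ι → ι → ℕ := fun a c => 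
    (Finset.univ.filter fun b => edist a b ≤ r ∧ r < edist b c).card with hα
  -- M marks two close pairs with all cross distances large; one fixed matching is compared with
  -- τ_{3,1}.
  have hQ : ∑ a, ∑ b, ∑ c, ∑ d, M a b c d ≤ tau ι m [3, 1] := by
    have h1 : ∑ a, ∑ b, ∑ c, ∑ d, M a b c d ≤
        ∑ a, ∑ c, if r < edist a c then (α a c : ℝ≥0∞) * α c a else 0 := by
      refine Finset.sum_le_sum fun a _ => ?_
      rw [Finset.sum_comm]
      refine Finset.sum_le_sum fun c _ => ?_
      by_cases hac : r < edist a c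
      · rw [if_pos hac]
        simp only [hα]
        rw [← Finset.sum_boole, ← Finset.sum_boole, Finset.sum_mul_sum]
        refine Finset.sum_le_sum fun b _ => Finset.sum_le_sum fun d _ => ?_
        simp only [hM]
        split_ifs <;> simp_all [edist_comm]
      · simp [hM, hac]
    have h2 : ∑ a, ∑ c, (if r < edist a c then α a c * α c a else 0) ≤
        ∑ a, ∑ c, if r < edist a c then α a c ^ 2 else 0 := by
      have h3 : ∑ a, ∑ c, (if r < edist a c then α c a ^ 2 else 0) =
          ∑ a, ∑ c, if r < edist a c then α a c ^ 2 else 0 := by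
        rw [Finset.sum_comm]
        simp only [edist_comm]
      have h4 : 2 * ∑ a, ∑ c, (if r < edist a c then α a c * α c a else 0) ≤
          ∑ a, ∑ c, (if r < edist a c then α a c ^ 2 else 0) +
          ∑ a, ∑ c, (if r < edist a c then α c a ^ 2 else 0) := by
        rw [← Finset.sum_add_distrib, Finset.mul_sum]
        refine Finset.sum_le_sum fun a _ => ?_
        rw [← Finset.sum_add_distrib, Finset.mul_sum]
        refine Finset.sum_le_sum fun c _ => ?_
        split_ifs
        · have := two_mul_le_add_sq (α a c) (α c a)
          linarith
        · simp
      omega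
    have h2' : ∑ a, ∑ c, (if r < edist a c then (α a c : ℝ≥0∞) * α c a else 0) ≤
        ∑ a, ∑ c, if r < edist a c then (α a c : ℝ≥0∞) ^ 2 else 0 := by
      exact_mod_cast h2
    refine h1.trans (h2'.trans ?_)
    rw [tau_eq_sum]
    change _ ≤ ∑ k : Fin 4 → ι, if profile m k = {3, 1} then 1 else 0
    rw [sum_fin_four]
    refine Finset.sum_le_sum fun a _ => ?_
    have h5 : ∑ b, ∑ d, ∑ c, (if profile m ![a, b, d, c] = {3, 1} then (1 : ℝ≥0∞) else 0) =
        ∑ c, ∑ b, ∑ d, if profile m ![a, b, d, c] = {3, 1} then (1 : ℝ≥0∞) else 0 := by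
      rw [Finset.sum_comm (s := Finset.univ (α := ι)) (t := Finset.univ (α := ι))]
      exact (Finset.sum_congr rfl fun _ _ => Finset.sum_comm).trans Finset.sum_comm |>.trans
        (Finset.sum_congr rfl fun _ _ => Finset.sum_comm)
    rw [h5]
    refine Finset.sum_le_sum fun c _ => ?_
    by_cases hac : r < edist a c
    swap; · rw [if_neg hac]; exact zero_le
    rw [if_pos hac, sq]
    simp only [hα]
    rw [← Finset.sum_boole, Finset.sum_mul_sum]
    refine Finset.sum_le_sum fun b _ => Finset.sum_le_sum fun d _ => ?_
    by_cases hb : edist a b ≤ r ∧ r < edist b c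
    swap; · rw [if_neg hb, zero_mul]; exact zero_le
    by_cases hd : edist a d ≤ r ∧ r < edist d c
    swap; · rw [if_neg hd, mul_zero]; exact zero_le
    rw [if_pos (profile_eq_three_one (i := ![a, b, d, c]) hb.1 hd.1 hac hb.2 hd.2), if_pos hb,
      if_pos hd, one_mul]
  -- Every vector of profile (2, 2) realises at least one of the three matchings.
  have hle : tau ι m [2, 2] ≤ ∑ k : Fin 4 → ι,
      (M (k 0) (k 1) (k 2) (k 3) + M (k 0) (k 2) (k 1) (k 3) + M (k 0) (k 3) (k 1) (k 2)) := by
    rw [tau_eq_sum]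
    change ∑ k : Fin 4 → ι, (if profile m k = {2, 2} then 1 else 0) ≤ _
    refine Finset.sum_le_sum fun k _ => ?_
    split_ifs with h
    swap; · exact zero_le
    rcases exists_matching_of_profile_two_two h with h' | h' | h'
    · have := far_of_profile_two_two h (a := 0) (b := 1) (c := 2) (d := 3) (by decide) h'.1 h'.2
      have e : M (k 0) (k 1) (k 2) (k 3) = 1 := if_pos ⟨h'.1, h'.2, this⟩
      rw [e, add_assoc]; exact le_self_add
    · have := far_of_profile_two_two h (a := 0) (b := 2) (c := 1) (d := 3) (by decide) h'.1 h'.2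
      have e : M (k 0) (k 2) (k 1) (k 3) = 1 := if_pos ⟨h'.1, h'.2, this⟩
      rw [e]; exact le_add_right le_add_self
    · have := far_of_profile_two_two h (a := 0) (b := 3) (c := 1) (d := 2) (by decide) h'.1 h'.2
      have e : M (k 0) (k 3) (k 1) (k 2) = 1 := if_pos ⟨h'.1, h'.2, this⟩
      rw [e]; exact le_add_self
  refine hle.trans ?_
  rw [Finset.sum_add_distrib, Finset.sum_add_distrib, sum_fin_four, sum_fin_four, sum_fin_four]
  change ∑ a, ∑ b, ∑ c, ∑ d, M a b c d + ∑ a, ∑ b, ∑ c, ∑ d, M a c b d +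
    ∑ a, ∑ b, ∑ c, ∑ d, M a d b c ≤ _
  have e1 : ∑ a, ∑ b, ∑ c, ∑ d, M a c b d = ∑ a, ∑ b, ∑ c, ∑ d, M a b c d :=
    Finset.sum_congr rfl fun a _ => Finset.sum_comm
  have e2 : ∑ a, ∑ b, ∑ c, ∑ d, M a d b c = ∑ a, ∑ b, ∑ c, ∑ d, M a b c d := by
    refine Finset.sum_congr rfl fun a _ => ?_
    have : ∀ b, ∑ c, ∑ d, M a d b c = ∑ d, ∑ c, M a d b c := fun b => Finset.sum_comm
    simp only [this]
    exact Finset.sum_comm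
  rw [e1, e2]
  calc _ = 3 * ∑ a, ∑ b, ∑ c, ∑ d, M a b c d := by ring
    _ ≤ _ := by gcongr

lemma tau_two_two_le_tauHat : tau ι m [2, 2] ≤ 3 * tauHat4 ι m :=
  tau_two_two_le.trans (mul_le_mul_right (by rw [tauHat4, add_assoc]; exact le_self_add) _)

end Tau

end Counting

/-! ### Hölder and Jensen inequalities for `eLpNorm` -/

section LpHelpers

variable {T : Type*} [MeasurableSpace T] {ν : Measure T}

lemma holderTriple_ofReal_two_mul {r : ℝ} (hr : 0 < r) :
    ENNReal.HolderTriple (ENNReal.ofReal (2 * r)) (ENNReal.ofReal (2 * r)) (ENNReal.ofReal r) := by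
  constructor
  rw [← ENNReal.ofReal_inv_of_pos (by positivity), ← ENNReal.ofReal_inv_of_pos hr,
    ← ENNReal.ofReal_add (by positivity) (by positivity)]
  congr 1
  field_simp; norm_num

lemma eLpNorm_mul_le_of_le {r : ℝ} (hr : 0 < r) {f g : T → ℝ} (hf : AEStronglyMeasurable f ν)
    (hg : AEStronglyMeasurable g ν) {a b : ℝ≥0∞} (ha : eLpNorm f (ENNReal.ofReal (2 * r)) ν ≤ a)
    (hb : eLpNorm g (ENNReal.ofReal (2 * r)) ν ≤ b) :
    eLpNorm (fun x => f x * g x) (ENNReal.ofReal r) ν ≤ a * b := by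
  have := holderTriple_ofReal_two_mul hr
  exact (eLpNorm_smul_le_mul_eLpNorm hg hf).trans (mul_le_mul' ha hb)

lemma eLpNorm_mul_mul_mul_le_of_le {r : ℝ} (hr : 0 < r) {f₀ f₁ f₂ f₃ : T → ℝ}
    (h₀ : AEStronglyMeasurable f₀ ν) (h₁ : AEStronglyMeasurable f₁ ν)
    (h₂ : AEStronglyMeasurable f₂ ν) (h₃ : AEStronglyMeasurable f₃ ν) {a : ℝ≥0∞}
    (e₀ : eLpNorm f₀ (ENNReal.ofReal (4 * r)) ν ≤ a) (e₁ : eLpNorm f₁ (ENNReal.ofReal (4 * r)) ν ≤ a)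
    (e₂ : eLpNorm f₂ (ENNReal.ofReal (4 * r)) ν ≤ a)
    (e₃ : eLpNorm f₃ (ENNReal.ofReal (4 * r)) ν ≤ a) :
    eLpNorm (fun x => f₀ x * f₁ x * (f₂ x * f₃ x)) (ENNReal.ofReal r) ν ≤ a ^ 4 := by
  have e : 4 * r = 2 * (2 * r) := by ring
  rw [e] at e₀ e₁ e₂ e₃
  have := eLpNorm_mul_le_of_le hr (h₀.mul h₁) (h₂.mul h₃)
    (eLpNorm_mul_le_of_le (by positivity) h₀ h₁ e₀ e₁)
    (eLpNorm_mul_le_of_le (by positivity) h₂ h₃ e₂ e₃)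
  refine this.trans (le_of_eq (by ring))

lemma eLpNorm_mul_le_of_bound {p : ℝ≥0∞} {f g : T → ℝ} {c : NNReal} (hg : ∀ x, |g x| ≤ c) {a : ℝ≥0∞}
    (ha : eLpNorm f p ν ≤ a) : eLpNorm (fun x => f x * g x) p ν ≤ c * a := by
  have h := eLpNorm_le_nnreal_smul_eLpNorm_of_ae_le_mul (μ := ν) (p := p) (f := fun x => f x * g x)
    (g := f) (c := c) (Filter.Eventually.of_forall fun x => by
      rw [← NNReal.coe_le_coe]
      push_cast
      simp only [Real.norm_eq_abs, abs_mul]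
      rw [mul_comm]
      gcongr
      exact hg x)
  refine h.trans ?_
  rw [ENNReal.smul_def, smul_eq_mul]
  gcongr

lemma enorm_integral_le_eLpNorm [IsProbabilityMeasure ν] {f : T → ℝ}
    (hf : AEStronglyMeasurable f ν) {p : ℝ≥0∞} (hp : 1 ≤ p) : ‖∫ x, f x ∂ν‖ₑ ≤ eLpNorm f p ν :=
  (enorm_integral_le_lintegral_enorm _).trans
    (eLpNorm_one_eq_lintegral_enorm.symm.le.trans (eLpNorm_le_eLpNorm_of_exponent_le hp hf))

lemma eLpNorm_pow_eq_enorm_integral {q : ℕ} (hq : Even q) (hq0 : q ≠ 0) {f : T → ℝ}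
    (hf : Integrable (fun x => f x ^ q) ν) :
    eLpNorm f q ν ^ q = ‖∫ x, f x ^ q ∂ν‖ₑ := by
  have h1 : ‖∫ x, f x ^ q ∂ν‖ₑ = ∫⁻ x, ‖f x‖ₑ ^ q ∂ν := by
    rw [Real.enorm_of_nonneg (integral_nonneg fun x => hq.pow_nonneg _),
      ofReal_integral_eq_lintegral_ofReal hf (Filter.Eventually.of_forall fun x => hq.pow_nonneg _)]
    refine lintegral_congr fun x => ?_
    rw [← Real.enorm_of_nonneg (hq.pow_nonneg _), enorm_pow]
  rw [h1, eLpNorm_eq_lintegral_rpow_enorm_toReal (by exact_mod_cast hq0) (by simp)]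
  simp only [ENNReal.toReal_natCast, ENNReal.rpow_natCast]
  rw [← ENNReal.rpow_natCast, ← ENNReal.rpow_mul]
  rw [one_div, inv_mul_cancel₀ (by exact_mod_cast hq0), ENNReal.rpow_one]

/-- Jensen's inequality for partial integrals. -/
lemma eLpNorm_integral_le {S : Type*} [MeasurableSpace S] {μ : Measure S} [IsProbabilityMeasure μ]
    [IsProbabilityMeasure ν] {h : S × T → ℝ} (hh : Measurable h) {r : ℝ} (hr : 1 ≤ r) :
    eLpNorm (fun x => ∫ y, h (y, x) ∂μ) (ENNReal.ofReal r) ν ≤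
      eLpNorm h (ENNReal.ofReal r) (μ.prod ν) := by
  have hr0 : 0 < r := by linarith
  rw [eLpNorm_eq_lintegral_rpow_enorm_toReal (by simpa using hr0) (by simp),
    eLpNorm_eq_lintegral_rpow_enorm_toReal (by simpa using hr0) (by simp)]
  simp only [ENNReal.toReal_ofReal hr0.le]
  apply ENNReal.rpow_le_rpow _ (by positivity)
  rw [lintegral_prod_symm _ (by fun_prop)]
  refine lintegral_mono fun x => ?_
  have h1 : AEStronglyMeasurable (fun y => h (y, x)) μ :=
    (hh.comp measurable_prodMk_right).aestronglyMeasurable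
  have h2 := enorm_integral_le_eLpNorm h1 (p := ENNReal.ofReal r) (by simpa using hr)
  rw [eLpNorm_eq_lintegral_rpow_enorm_toReal (by simpa using hr0) (by simp),
    ENNReal.toReal_ofReal hr0.le] at h2
  calc ‖∫ y, h (y, x) ∂μ‖ₑ ^ r ≤ ((∫⁻ y, ‖h (y, x)‖ₑ ^ r ∂μ) ^ (1 / r)) ^ r := by gcongr
    _ = _ := by rw [← ENNReal.rpow_mul, one_div_mul_cancel hr0.ne', ENNReal.rpow_one]

lemma integrable_of_eLpNorm_le {f : T → ℝ} [IsProbabilityMeasure ν] {p : ℝ≥0∞} (hp : 1 ≤ p)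
    (hf : AEStronglyMeasurable f ν) {a : ℝ≥0∞} (h : eLpNorm f p ν ≤ a) (ha : a ≠ ∞) :
    Integrable f ν :=
  MemLp.integrable hp ⟨hf, h.trans_lt ha.lt_top⟩

end LpHelpers

/-! ### Decoupling, centred factors and covariances under mixing -/

section Coupling

lemma measurable_sigmaOf {Ω : Type u} {ι : Type v} {E : Type*} [MeasurableSpace E]
    {X : ι → Ω → E} {J : Set ι} {j : ι} (hj : j ∈ J) : Measurable[sigmaOf X J] (X j) :=
  (comap_measurable (X j)).mono (le_iSup₂ (f := fun i (_ : i ∈ J) =>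
    MeasurableSpace.comap (X i) inferInstance) j hj) le_rfl

variable {Ω : Type u} [MeasurableSpace Ω] {μ : Measure Ω} [IsProbabilityMeasure μ] {ι : Type v}
  {E : Type*} [MeasurableSpace E] {X : ι → Ω → E}

lemma sigmaOf_le (hX : ∀ i, Measurable (X i)) (J : Set ι) :
    sigmaOf X J ≤ (inferInstance : MeasurableSpace Ω) :=
  iSup₂_le fun i _ => (hX i).comap_le

variable [EMetricSpace ι] {β : ℕ∞ → ℕ∞ → ℝ → ℝ≥0∞}

/-- Replacing two distant groups of observations by independent copies. -/
lemma enorm_integral_sub_integral_prod_le {A B : Type*} [MeasurableSpace A] [MeasurableSpace B]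
    (hX : ∀ i, Measurable (X i)) (hβ : IsBetaMixing μ X β) {I J : Set ι} {n₁ n₂ : ℕ∞} {m : ℝ}
    (hI : I.encard ≤ n₁) (hJ : J.encard ≤ n₂)
    (hIJ : ∀ i ∈ I, ∀ j ∈ J, ENNReal.ofReal m < edist i j)
    {Y : Ω → A} {Z : Ω → B} (hY : Measurable[sigmaOf X I] Y) (hZ : Measurable[sigmaOf X J] Z)
    {h : A × B → ℝ} (hh : Measurable h) {r : ℝ} (hr : 1 ≤ r)
    (hi₁ : Integrable (fun ω => h (Y ω, Z ω)) μ)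
    (hi₂ : Integrable (fun p : Ω × Ω => h (Y p.1, Z p.2)) (μ.prod μ)) {K : ℝ≥0∞}
    (hK₁ : eLpNorm (fun ω => h (Y ω, Z ω)) (ENNReal.ofReal r) μ ≤ K)
    (hK₂ : eLpNorm (fun p : Ω × Ω => h (Y p.1, Z p.2)) (ENNReal.ofReal r) (μ.prod μ) ≤ K) :
    ‖∫ ω, h (Y ω, Z ω) ∂μ - ∫ p, h (Y p.1, Z p.2) ∂(μ.prod μ)‖ₑ ≤
      8 * K * β n₁ n₂ m ^ (1 - 1 / r) := by
  have hY' : Measurable Y := hY.mono (sigmaOf_le hX I) le_rfl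
  have hZ' : Measurable Z := hZ.mono (sigmaOf_le hX J) le_rfl
  have hpr := Measure.isProbabilityMeasure_map (μ := μ) hY'.aemeasurable
  have hpr2 := Measure.isProbabilityMeasure_map (μ := μ) hZ'.aemeasurable
  have hpr3 := Measure.isProbabilityMeasure_map (μ := μ) (hY'.prodMk hZ').aemeasurable
  have hprod : (μ.map Y).prod (μ.map Z) = (μ.prod μ).map (Prod.map Y Z) :=
    Measure.map_prod_map _ _ hY' hZ'
  have hmap : Measurable (Prod.map Y Z) := hY'.prodMap hZ'
  have hdist : ENNReal.ofReal m ≤ groupDist I J :=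
    le_iInf₂ fun i hi => le_iInf₂ fun j hj => (hIJ i hi j hj).le
  have hb := hβ n₁ n₂ m I J hI hJ hdist
  have key := enorm_integral_sub_integral_le (ν₁ := μ.map fun ω => (Y ω, Z ω))
    (ν₂ := (μ.map Y).prod (μ.map Z)) (η := 2 * β n₁ n₂ m)
    (fun S hS => (measure_le_add_betaSigma (sigmaOf_le hX I) (sigmaOf_le hX J) hY hZ hS).trans
      (by gcongr)) (h := h)
    ((integrable_map_measure hh.aestronglyMeasurable (hY'.prodMk hZ').aemeasurable).2 hi₁)
    (by rw [hprod]
        exact (integrable_map_measure hh.aestronglyMeasurable hmap.aemeasurable).2 hi₂) hr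
  rw [integral_map (hY'.prodMk hZ').aemeasurable hh.aestronglyMeasurable,
    eLpNorm_map_measure hh.aestronglyMeasurable (hY'.prodMk hZ').aemeasurable, hprod,
    integral_map hmap.aemeasurable hh.aestronglyMeasurable,
    eLpNorm_map_measure hh.aestronglyMeasurable hmap.aemeasurable] at key
  refine key.trans ?_
  have hr' : 0 ≤ 1 - 1 / r := by rw [sub_nonneg, div_le_one (by linarith)]; exact hr
  have hr1 : 1 - 1 / r ≤ 1 := by
    have : 0 ≤ 1 / r := by positivity
    linarith
  -- The total-variation bound is η = 2β and Hölder uses 2η = 4β. As the exponent is at most 1, the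
  -- constant stays below 4, and two moments K make 8 in all.
  have h4 : (2 * (2 * β n₁ n₂ m)) ^ (1 - 1 / r) ≤ 4 * β n₁ n₂ m ^ (1 - 1 / r) := by
    rw [← mul_assoc, ENNReal.mul_rpow_of_nonneg _ _ hr']
    gcongr
    calc ((2 : ℝ≥0∞) * 2) ^ (1 - 1 / r) ≤ (2 * 2) ^ (1 : ℝ) :=
          ENNReal.rpow_le_rpow_of_exponent_le (by norm_num) hr1
      _ = 4 := by rw [ENNReal.rpow_one]; norm_num
  calc _ ≤ (K + K) * (4 * β n₁ n₂ m ^ (1 - 1 / r)) :=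
        mul_le_mul' (add_le_add hK₁ hK₂) h4
    _ = _ := by ring

/-- If `K(X_k, x)` is centered, the expectation of `K(X_k, X_b) R` is small as soon as the node `k`
is far from `b` and from the nodes on which `R` depends. -/
lemma enorm_integral_mul_le_of_centered (hX : ∀ i, Measurable (X i)) (hβ : IsBetaMixing μ X β)
    {J : Set ι} {n₂ : ℕ∞} {m : ℝ} {k b : ι} (hb : b ∈ J) (hJ : J.encard ≤ n₂)
    (hfar : ∀ j ∈ J, ENNReal.ofReal m < edist k j)
    {K : E → E → ℝ} (hK : Measurable fun z : E × E => K z.1 z.2)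
    (hz : ∀ᵐ ω' ∂μ, ∫ ω, K (X k ω) (X b ω') ∂μ = 0)
    {R : Ω → ℝ} (hR : Measurable[sigmaOf X J] R) {r : ℝ} (hr : 1 ≤ r)
    (hi₁ : Integrable (fun ω => K (X k ω) (X b ω) * R ω) μ)
    (hi₂ : Integrable (fun p : Ω × Ω => K (X k p.1) (X b p.2) * R p.2) (μ.prod μ)) {L : ℝ≥0∞}
    (hL₁ : eLpNorm (fun ω => K (X k ω) (X b ω) * R ω) (ENNReal.ofReal r) μ ≤ L)
    (hL₂ : eLpNorm (fun p : Ω × Ω => K (X k p.1) (X b p.2) * R p.2) (ENNReal.ofReal r)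
      (μ.prod μ) ≤ L) :
    ‖∫ ω, K (X k ω) (X b ω) * R ω ∂μ‖ₑ ≤ 8 * L * β 1 n₂ m ^ (1 - 1 / r) := by
  -- X_b and R are bundled into one variable, since both lie on the J side of the decoupling.
  have hh : Measurable fun q : E × (E × ℝ) => K q.1 q.2.1 * q.2.2 :=
    (hK.comp (measurable_fst.prodMk measurable_snd.fst)).mul measurable_snd.snd
  have key := enorm_integral_sub_integral_prod_le hX hβ (I := {k}) (J := J) (n₁ := 1) (n₂ := n₂)
    (m := m) (by simp) hJ (by rintro i rfl j hj; exact hfar j hj) (Y := X k)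
    (Z := fun ω => (X b ω, R ω)) (measurable_sigmaOf (Set.mem_singleton k))
    ((measurable_sigmaOf hb).prodMk hR) hh hr hi₁ hi₂ hL₁ hL₂
  -- Under the product law X_k is integrated first, with X_b and R frozen; centring makes the inner
  -- integral vanish almost everywhere.
  have h0 : ∫ p : Ω × Ω, K (X k p.1) (X b p.2) * R p.2 ∂(μ.prod μ) = 0 := by
    rw [integral_prod_symm _ hi₂]
    refine integral_eq_zero_of_ae ?_
    filter_upwards [hz] with ω hω
    simp only [integral_mul_const, hω, zero_mul, Pi.zero_apply]
  simp only [h0, sub_zero] at key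
  exact key

/-- A covariance inequality for `β`-mixing variables. -/
lemma enorm_covariance_le (hX : ∀ i, Measurable (X i)) (hβ : IsBetaMixing μ X β) {I J : Set ι}
    {n₁ n₂ : ℕ∞} {m : ℝ} (hI : I.encard ≤ n₁) (hJ : J.encard ≤ n₂)
    (hIJ : ∀ i ∈ I, ∀ j ∈ J, ENNReal.ofReal m < edist i j) {Y Z : Ω → ℝ}
    (hY : Measurable[sigmaOf X I] Y) (hZ : Measurable[sigmaOf X J] Z) (hY2 : MemLp Y 2 μ)
    (hZ2 : MemLp Z 2 μ) {r : ℝ} (hr : 1 ≤ r) {a b : ℝ≥0∞}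
    (ha : eLpNorm Y (ENNReal.ofReal (2 * r)) μ ≤ a)
    (hb : eLpNorm Z (ENNReal.ofReal (2 * r)) μ ≤ b) :
    ‖cov[Y, Z; μ]‖ₑ ≤ 8 * (a * b) * β n₁ n₂ m ^ (1 - 1 / r) := by
  have hY' : Measurable Y := hY.mono (sigmaOf_le hX I) le_rfl
  have hZ' : Measurable Z := hZ.mono (sigmaOf_le hX J) le_rfl
  have hr0 : 0 < r := by linarith
  have key := enorm_integral_sub_integral_prod_le hX hβ hI hJ hIJ hY hZ
    (h := fun q : ℝ × ℝ => q.1 * q.2) (measurable_fst.mul measurable_snd) hr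
    (hY2.integrable_mul hZ2)
    ((hY2.integrable one_le_two).mul_prod (hZ2.integrable one_le_two))
    (eLpNorm_mul_le_of_le hr0 hY'.aestronglyMeasurable hZ'.aestronglyMeasurable ha hb)
    (eLpNorm_mul_le_of_le hr0 (hY'.comp measurable_fst).aestronglyMeasurable
      (hZ'.comp measurable_snd).aestronglyMeasurable
      ((eLpNorm_comp_measurePreserving hY'.aestronglyMeasurable measurePreserving_fst).le.trans ha)
      ((eLpNorm_comp_measurePreserving hZ'.aestronglyMeasurable measurePreserving_snd).le.trans hb))
  rw [covariance_eq_sub hY2 hZ2]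
  simp only [integral_prod_mul] at key
  exact key

end Coupling

/-! ### Moments of products of kernels: close and isolated nodes -/

section KernelMoments

variable {Ω : Type u} [MeasurableSpace Ω] {μ : Measure Ω} [IsProbabilityMeasure μ]
  {ι : Type v} [EMetricSpace ι] {E : Type*} [MeasurableSpace E]
  {X : ι → Ω → E} {H : E → E → ℝ} {β : ℕ∞ → ℕ∞ → ℝ → ℝ≥0∞} {m δ : ℝ}

/-- The standing assumptions: a `β`-mixing sample and a degenerate kernel with finite fourth
moments. -/
structure IsMixingKernel (μ : Measure Ω) (X : ι → Ω → E) (H : E → E → ℝ)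
    (β : ℕ∞ → ℕ∞ → ℝ → ℝ≥0∞) : Prop where
  measurable_sample : ∀ i, Measurable (X i)
  mixing : IsBetaMixing μ X β
  regular : IsRegularKernel μ X H
  degenerate : IsDegenerate μ X H
  moment_four : kernelMoment μ X H 4 ≠ ∞

/-- The summand `H(X_i, X_k)` of the U-statistic. -/
def kernelRV (X : ι → Ω → E) (H : E → E → ℝ) (i k : ι) (ω : Ω) : ℝ := H (X i ω) (X k ω)

lemma ne_of_lt_edist {i k : ι} (h : ENNReal.ofReal m < edist i k) : i ≠ k := by
  rintro rfl; simp at h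

lemma lt_edist_comm {i k : ι} (h : ENNReal.ofReal m < edist i k) : ENNReal.ofReal m < edist k i := by
  rwa [edist_comm]

lemma encard_two_le (a b : ι) : ({a, b} : Set ι).encard ≤ 2 := by
  refine (Set.encard_insert_le _ _).trans ?_
  rw [Set.encard_singleton]; norm_num

lemma encard_triple_le (a b c : ι) : ({a, b, c} : Set ι).encard ≤ 3 := by
  refine (Set.encard_insert_le _ _).trans ?_
  calc ({b, c} : Set ι).encard + 1 ≤ 2 + 1 := by gcongr; exact encard_two_le b c
    _ = 3 := by norm_num

lemma le_betaMax (β : ℕ∞ → ℕ∞ → ℝ → ℝ≥0∞) {q₁ q₂ q : ℕ} (h₁ : 0 < q₁) (h₂ : 0 < q₂)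
    (h : q₁ + q₂ = q) (m : ℝ) : β q₁ q₂ m ≤ betaMax β q m :=
  le_iSup_of_le q₁ <| le_iSup_of_le q₂ <| le_iSup_of_le h₁ <| le_iSup_of_le h₂ <|
    le_iSup_of_le h le_rfl

lemma kernelMomentIndep_le (p : ℝ) : kernelMomentIndep μ X H p ≤ kernelMoment μ X H p := le_sup_right

lemma eLpNorm_kernelRV_le {i k : ι} (hik : i ≠ k) (p : ℝ) :
    eLpNorm (kernelRV X H i k) (ENNReal.ofReal p) μ ≤ kernelMoment μ X H p :=
  le_trans (le_iSup_of_le (f := fun i => ⨆ (k : ι) (_ : i ≠ k),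
    eLpNorm (fun ω => H (X i ω) (X k ω)) (ENNReal.ofReal p) μ) i <| le_iSup_of_le k <|
      le_iSup (fun _ : i ≠ k => eLpNorm (fun ω => H (X i ω) (X k ω)) (ENNReal.ofReal p) μ) hik)
    le_sup_left

namespace IsMixingKernel

lemma measurable_kernelRV (S : IsMixingKernel μ X H β) (i k : ι) :
    Measurable (kernelRV X H i k) :=
  S.regular.measurable.comp ((S.measurable_sample i).prodMk (S.measurable_sample k))

lemma ae_integral_eq_zero (S : IsMixingKernel μ X H β) {i k : ι} (hik : i ≠ k) :
    ∀ᵐ ω' ∂μ, ∫ ω, H (X k ω) (X i ω') ∂μ = 0 :=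
  ae_of_ae_map (S.measurable_sample i).aemeasurable (S.degenerate i k hik)

lemma kernelRV_comm (S : IsMixingKernel μ X H β) (i k : ι) :
    kernelRV X H i k = kernelRV X H k i := by
  ext ω; exact S.regular.symm _ _

lemma measurable_kernelRV_sigmaOf (S : IsMixingKernel μ X H β) {J : Set ι} {i k : ι} (hi : i ∈ J)
    (hk : k ∈ J) : Measurable[sigmaOf X J] (kernelRV X H i k) :=
  S.regular.measurable.comp ((measurable_sigmaOf hi).prodMk (measurable_sigmaOf hk))

/-- The copies are realised by arbitrary maps U, V that jointly preserve the product measure, so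
that the same bound serves on Ω × Ω and under the extra integration in Γ. -/
lemma eLpNorm_indep_le (S : IsMixingKernel μ X H β) {i k : ι} (hik : i ≠ k) (p : ℝ) {T : Type*}
    [MeasurableSpace T] {ν : Measure T} {U V : T → Ω}
    (hUV : MeasurePreserving (fun t => (U t, V t)) ν (μ.prod μ)) :
    eLpNorm (fun t => H (X i (U t)) (X k (V t))) (ENNReal.ofReal p) ν ≤
      kernelMomentIndep μ X H p := by
  have hX := S.measurable_sample
  have hH := S.regular.measurable
  have hm : Measurable (Prod.map (X i) (X k)) := (hX i).prodMap (hX k)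
  have e1 : eLpNorm (fun t => H (X i (U t)) (X k (V t))) (ENNReal.ofReal p) ν =
      eLpNorm (fun z : E × E => H z.1 z.2) (ENNReal.ofReal p) (indepLaw μ X i k) := by
    have h1 : indepLaw μ X i k = (μ.prod μ).map (Prod.map (X i) (X k)) := by
      have := Measure.isProbabilityMeasure_map (μ := μ) (hX i).aemeasurable
      have := Measure.isProbabilityMeasure_map (μ := μ) (hX k).aemeasurable
      exact Measure.map_prod_map _ _ (hX i) (hX k)
    rw [h1, eLpNorm_map_measure hH.aestronglyMeasurable hm.aemeasurable]
    have h2 := eLpNorm_comp_measurePreserving (p := ENNReal.ofReal p)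
      (g := fun z : Ω × Ω => H (X i z.1) (X k z.2)) (hH.comp hm).aestronglyMeasurable hUV
    exact h2
  rw [e1]
  exact le_iSup_of_le (f := fun i => ⨆ (k : ι) (_ : i ≠ k),
    eLpNorm (fun z : E × E => H z.1 z.2) (ENNReal.ofReal p) (indepLaw μ X i k)) i <|
      le_iSup_of_le k <| le_iSup (fun _ : i ≠ k =>
        eLpNorm (fun z : E × E => H z.1 z.2) (ENNReal.ofReal p) (indepLaw μ X i k)) hik

lemma measurable_kernelRV_snd (S : IsMixingKernel μ X H β) (i k : ι) :
    Measurable (fun t : Ω × Ω => kernelRV X H i k t.2) :=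
  (S.measurable_kernelRV i k).comp measurable_snd

lemma eLpNorm_prod_le (S : IsMixingKernel μ X H β) {i k : ι} (hik : i ≠ k) (p : ℝ) :
    eLpNorm (fun t : Ω × Ω => H (X i t.1) (X k t.2)) (ENNReal.ofReal p) (μ.prod μ) ≤
      kernelMomentIndep μ X H p :=
  S.eLpNorm_indep_le hik p (MeasurePreserving.id _)

lemma eLpNorm_snd_le (S : IsMixingKernel μ X H β) {i k : ι} (hik : i ≠ k) (p : ℝ) :
    eLpNorm (fun t : Ω × Ω => kernelRV X H i k t.2) (ENNReal.ofReal p) (μ.prod μ) ≤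
      kernelMoment μ X H p :=
  (eLpNorm_comp_measurePreserving (S.measurable_kernelRV i k).aestronglyMeasurable
    measurePreserving_snd).le.trans (eLpNorm_kernelRV_le hik p)

lemma memLp_kernelRV (S : IsMixingKernel μ X H β) {i k : ι} (hik : i ≠ k) :
    MemLp (kernelRV X H i k) 4 μ := by
  refine ⟨(S.measurable_kernelRV i k).aestronglyMeasurable, ?_⟩
  have := (eLpNorm_kernelRV_le (μ := μ) (X := X) (H := H) hik 4).trans_lt S.moment_four.lt_top
  rwa [ENNReal.ofReal_ofNat] at this

lemma measurable_prod_kernel (S : IsMixingKernel μ X H β) (i k : ι) :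
    Measurable (fun t : Ω × Ω => H (X i t.1) (X k t.2)) :=
  S.regular.measurable.comp
    (((S.measurable_sample i).comp measurable_fst).prodMk ((S.measurable_sample k).comp measurable_snd))

lemma kernelMoment_mono (S : IsMixingKernel μ X H β) {p q : ℝ} (hpq : p ≤ q) :
    kernelMoment μ X H p ≤ kernelMoment μ X H q := by
  refine sup_le_sup ?_ ?_
  · refine iSup_mono fun i => iSup_mono fun k => iSup_mono fun _ => ?_
    exact eLpNorm_le_eLpNorm_of_exponent_le (ENNReal.ofReal_le_ofReal hpq)
      (S.measurable_kernelRV i k).aestronglyMeasurable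
  · refine iSup_mono fun i => iSup_mono fun k => iSup_mono fun _ => ?_
    have := Measure.isProbabilityMeasure_map (μ := μ) (S.measurable_sample i).aemeasurable
    have := Measure.isProbabilityMeasure_map (μ := μ) (S.measurable_sample k).aemeasurable
    have : IsProbabilityMeasure (indepLaw μ X i k) := by unfold indepLaw; infer_instance
    exact eLpNorm_le_eLpNorm_of_exponent_le (ENNReal.ofReal_le_ofReal hpq)
      S.regular.measurable.aestronglyMeasurable

lemma integrable_mul {T : Type*} [MeasurableSpace T] {ν : Measure T} [IsProbabilityMeasure ν]
    (S : IsMixingKernel μ X H β) {f g : T → ℝ} (hf : AEStronglyMeasurable f ν)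
    (hg : AEStronglyMeasurable g ν) (h1 : ∀ p, eLpNorm f (ENNReal.ofReal p) ν ≤ kernelMoment μ X H p)
    (h2 : ∀ p, eLpNorm g (ENNReal.ofReal p) ν ≤ kernelMoment μ X H p) :
    Integrable (fun x => f x * g x) ν := by
  have h := eLpNorm_mul_le_of_le (r := 1) one_pos hf hg (h1 _) (h2 _)
  refine integrable_of_eLpNorm_le (by simp) (hf.mul hg) h (ENNReal.mul_ne_top ?_ ?_) <;>
  exact ((S.kernelMoment_mono (by norm_num)).trans_lt S.moment_four.lt_top).ne

lemma integrable_mul_mul_mul {T : Type*} [MeasurableSpace T] {ν : Measure T}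
    [IsProbabilityMeasure ν] (S : IsMixingKernel μ X H β) {f₀ f₁ f₂ f₃ : T → ℝ}
    (m₀ : AEStronglyMeasurable f₀ ν) (m₁ : AEStronglyMeasurable f₁ ν)
    (m₂ : AEStronglyMeasurable f₂ ν) (m₃ : AEStronglyMeasurable f₃ ν)
    (h₀ : ∀ p, eLpNorm f₀ (ENNReal.ofReal p) ν ≤ kernelMoment μ X H p)
    (h₁ : ∀ p, eLpNorm f₁ (ENNReal.ofReal p) ν ≤ kernelMoment μ X H p)
    (h₂ : ∀ p, eLpNorm f₂ (ENNReal.ofReal p) ν ≤ kernelMoment μ X H p)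
    (h₃ : ∀ p, eLpNorm f₃ (ENNReal.ofReal p) ν ≤ kernelMoment μ X H p) :
    Integrable (fun x => f₀ x * f₁ x * (f₂ x * f₃ x)) ν := by
  have h := eLpNorm_mul_mul_mul_le_of_le (r := 1) one_pos m₀ m₁ m₂ m₃ (h₀ _) (h₁ _) (h₂ _) (h₃ _)
  refine integrable_of_eLpNorm_le (by simp) ((m₀.mul m₁).mul (m₂.mul m₃)) h (ENNReal.pow_ne_top ?_)
  rw [mul_one]; exact S.moment_four

/-- X_k occurs in the first factor only and is far from all other nodes, so it decouples and
integrates to zero. -/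
lemma enorm_integral_isolated_pair_le (S : IsMixingKernel μ X H β) (hδ : 0 < δ) {k b c d : ι}
    (hb : ENNReal.ofReal m < edist k b) (hc : ENNReal.ofReal m < edist k c)
    (hd : ENNReal.ofReal m < edist k d) (hcd : c ≠ d) :
    ‖∫ ω, kernelRV X H k b ω * kernelRV X H c d ω ∂μ‖ₑ ≤
      8 * (kernelMoment μ X H (2 + δ) ^ 2 * betaMax β 4 m ^ (δ / (2 + δ))) := by
  have hkb := ne_of_lt_edist hb
  have hr0 : 0 < (2 + δ) / 2 := by positivity
  have e2 : 2 * ((2 + δ) / 2) = 2 + δ := by ring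
  have ex : 1 - 1 / ((2 + δ) / 2) = δ / (2 + δ) := by field_simp; ring
  have m1 := (S.measurable_kernelRV k b).aestronglyMeasurable (μ := μ)
  have m2 := (S.measurable_kernelRV c d).aestronglyMeasurable (μ := μ)
  have m3 := (S.measurable_prod_kernel k b).aestronglyMeasurable (μ := μ.prod μ)
  have m4 := (S.measurable_kernelRV_snd c d).aestronglyMeasurable (μ := μ.prod μ)
  have l3 := fun p => (S.eLpNorm_prod_le hkb p).trans (kernelMomentIndep_le p)
  have key := enorm_integral_mul_le_of_centered S.measurable_sample S.mixing (J := {b, c, d})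
    (n₂ := (3 : ℕ)) (k := k) (b := b) (by simp) (encard_triple_le b c d)
    (m := m) (by rintro j (rfl | rfl | rfl) <;> assumption) (K := H) S.regular.measurable
    (S.ae_integral_eq_zero hkb.symm) (R := kernelRV X H c d)
    (S.measurable_kernelRV_sigmaOf (by simp) (by simp)) (r := (2 + δ) / 2) (by linarith)
    (L := kernelMoment μ X H (2 + δ) ^ 2)
    (S.integrable_mul m1 m2 (eLpNorm_kernelRV_le hkb) (eLpNorm_kernelRV_le hcd))
    (S.integrable_mul m3 m4 l3 (S.eLpNorm_snd_le hcd))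
    ((eLpNorm_mul_le_of_le hr0 m1 m2 (eLpNorm_kernelRV_le hkb _)
      (eLpNorm_kernelRV_le hcd _)).trans (by rw [e2, sq]))
    ((eLpNorm_mul_le_of_le hr0 m3 m4 (l3 _) (S.eLpNorm_snd_le hcd _)).trans (by rw [e2, sq]))
  rw [ex] at key
  refine key.trans ?_
  rw [mul_assoc]
  gcongr
  exact le_betaMax β (q₁ := 1) (q₂ := 3) (by norm_num) (by norm_num) (by norm_num) m

/-- Nothing is isolated when k and l may be close, but X_i is still far from both. Decoupling it
before Cauchy–Schwarz makes the leading term a moment under independent copies, as the last factor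
of the theorem requires. -/
lemma enorm_integral_close_pair_le (S : IsMixingKernel μ X H β) (hδ : 0 < δ) {i k l : ι}
    (hk : ENNReal.ofReal m < edist i k) (hl : ENNReal.ofReal m < edist i l) :
    ‖∫ ω, kernelRV X H i k ω * kernelRV X H i l ω ∂μ‖ₑ ≤ kernelMomentIndep μ X H 2 ^ 2 +
      8 * (kernelMoment μ X H (2 + δ) ^ 2 * betaMax β 4 m ^ (δ / (2 + δ))) := by
  have hik := ne_of_lt_edist hk
  have hil := ne_of_lt_edist hl
  have hr0 : 0 < (2 + δ) / 2 := by positivity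
  have e2 : 2 * ((2 + δ) / 2) = 2 + δ := by ring
  have ex : 1 - 1 / ((2 + δ) / 2) = δ / (2 + δ) := by field_simp; ring
  have m1 := (S.measurable_kernelRV i k).aestronglyMeasurable (μ := μ)
  have m2 := (S.measurable_kernelRV i l).aestronglyMeasurable (μ := μ)
  have m3 := (S.measurable_prod_kernel i k).aestronglyMeasurable (μ := μ.prod μ)
  have m4 := (S.measurable_prod_kernel i l).aestronglyMeasurable (μ := μ.prod μ)
  have l3 := fun p => (S.eLpNorm_prod_le hik p).trans (kernelMomentIndep_le p)
  have l4 := fun p => (S.eLpNorm_prod_le hil p).trans (kernelMomentIndep_le p)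
  have hH := S.regular.measurable
  have hh : Measurable fun q : E × (E × E) => H q.1 q.2.1 * H q.1 q.2.2 :=
    (hH.comp (measurable_fst.prodMk measurable_snd.fst)).mul
      (hH.comp (measurable_fst.prodMk measurable_snd.snd))
  -- The second group has at most two nodes; the larger size 3 is used so that the sizes add up to 4
  -- and β₄ applies.
  have key := enorm_integral_sub_integral_prod_le S.measurable_sample S.mixing (I := {i})
    (J := {k, l}) (n₁ := (1 : ℕ)) (n₂ := (3 : ℕ)) (m := m) (by simp)
    ((encard_two_le k l).trans (by norm_num))
    (by rintro a rfl j (rfl | rfl) <;> assumption) (Y := X i) (Z := fun ω => (X k ω, X l ω))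
    (measurable_sigmaOf (Set.mem_singleton i))
    ((measurable_sigmaOf (by simp)).prodMk (measurable_sigmaOf (by simp))) hh
    (r := (2 + δ) / 2) (by linarith) (K := kernelMoment μ X H (2 + δ) ^ 2)
    (S.integrable_mul m1 m2 (eLpNorm_kernelRV_le hik) (eLpNorm_kernelRV_le hil))
    (S.integrable_mul m3 m4 l3 l4)
    ((eLpNorm_mul_le_of_le hr0 m1 m2 (eLpNorm_kernelRV_le hik _)
      (eLpNorm_kernelRV_le hil _)).trans (by rw [e2, sq]))
    ((eLpNorm_mul_le_of_le hr0 m3 m4 (l3 _) (l4 _)).trans (by rw [e2, sq]))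
  rw [ex] at key
  have h2 : ‖∫ p : Ω × Ω, H (X i p.1) (X k p.2) * H (X i p.1) (X l p.2) ∂(μ.prod μ)‖ₑ ≤
      kernelMomentIndep μ X H 2 ^ 2 := by
    refine (enorm_integral_le_eLpNorm (p := ENNReal.ofReal 1) (m3.mul m4) (by simp)).trans ?_
    rw [sq]
    refine eLpNorm_mul_le_of_le one_pos m3 m4 ?_ ?_
    · rw [mul_one]; exact S.eLpNorm_prod_le hik 2
    · rw [mul_one]; exact S.eLpNorm_prod_le hil 2
  have h3 := enorm_add_le (∫ ω, kernelRV X H i k ω * kernelRV X H i l ω ∂μ -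
      ∫ p : Ω × Ω, H (X i p.1) (X k p.2) * H (X i p.1) (X l p.2) ∂(μ.prod μ))
    (∫ p : Ω × Ω, H (X i p.1) (X k p.2) * H (X i p.1) (X l p.2) ∂(μ.prod μ))
  rw [sub_add_cancel] at h3
  refine h3.trans ?_
  rw [add_comm]
  refine add_le_add h2 (key.trans ?_)
  rw [mul_assoc]
  gcongr
  exact le_betaMax β (q₁ := 1) (q₂ := 3) (by norm_num) (by norm_num) (by norm_num) m

/-- Here k is far from i and from l, l', l'', so symmetry of the kernel lets H(X_k, X_i) play the
centred factor while the remaining three kernels form R. -/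
lemma enorm_integral_isolated_quadruple_le (S : IsMixingKernel μ X H β) (hδ : 0 < δ)
    {i k l l' l'' : ι} (hik : ENNReal.ofReal m < edist i k) (hil : ENNReal.ofReal m < edist i l)
    (hil' : ENNReal.ofReal m < edist i l') (hil'' : ENNReal.ofReal m < edist i l'')
    (hkl : ENNReal.ofReal m < edist k l) (hkl' : ENNReal.ofReal m < edist k l')
    (hkl'' : ENNReal.ofReal m < edist k l'') :
    ‖∫ ω, kernelRV X H i k ω * kernelRV X H i l ω *
      (kernelRV X H i l' ω * kernelRV X H i l'' ω) ∂μ‖ₑ ≤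
      8 * (kernelMoment μ X H (4 + δ) ^ 4 * β 1 6 m ^ (δ / (4 + δ))) := by
  have nik := ne_of_lt_edist hik
  have nil := ne_of_lt_edist hil
  have nil' := ne_of_lt_edist hil'
  have nil'' := ne_of_lt_edist hil''
  have hr0 : 0 < (4 + δ) / 4 := by positivity
  have e2 : 4 * ((4 + δ) / 4) = 4 + δ := by ring
  have ex : 1 - 1 / ((4 + δ) / 4) = δ / (4 + δ) := by field_simp; ring
  have m0 := (S.measurable_kernelRV k i).aestronglyMeasurable (μ := μ)
  have m1 := (S.measurable_kernelRV i l).aestronglyMeasurable (μ := μ)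
  have m2 := (S.measurable_kernelRV i l').aestronglyMeasurable (μ := μ)
  have m3 := (S.measurable_kernelRV i l'').aestronglyMeasurable (μ := μ)
  have p0 := (S.measurable_prod_kernel k i).aestronglyMeasurable (μ := μ.prod μ)
  have p1 := (S.measurable_kernelRV_snd i l).aestronglyMeasurable (μ := μ.prod μ)
  have p2 := (S.measurable_kernelRV_snd i l').aestronglyMeasurable (μ := μ.prod μ)
  have p3 := (S.measurable_kernelRV_snd i l'').aestronglyMeasurable
    (μ := μ.prod μ)
  have q0 := fun p => (S.eLpNorm_prod_le nik.symm p).trans (kernelMomentIndep_le p)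
  -- Four nodes suffice; the bound 6 matches the coefficient β(1, 6, m) of the theorem.
  have hcard : ({i, l, l', l''} : Set ι).encard ≤ 6 := by
    refine (Set.encard_insert_le _ _).trans ?_
    calc ({l, l', l''} : Set ι).encard + 1 ≤ 3 + 1 := by gcongr; exact encard_triple_le _ _ _
      _ ≤ 6 := by norm_num
  have i1 := S.integrable_mul_mul_mul m0 m1 m2 m3 (eLpNorm_kernelRV_le nik.symm)
    (eLpNorm_kernelRV_le nil) (eLpNorm_kernelRV_le nil') (eLpNorm_kernelRV_le nil'')
  have i2 := S.integrable_mul_mul_mul p0 p1 p2 p3 q0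
    (S.eLpNorm_snd_le nil) (S.eLpNorm_snd_le nil') (S.eLpNorm_snd_le nil'')
  have b1 := eLpNorm_mul_mul_mul_le_of_le hr0 m0 m1 m2 m3 (eLpNorm_kernelRV_le nik.symm _)
    (eLpNorm_kernelRV_le nil _) (eLpNorm_kernelRV_le nil' _) (eLpNorm_kernelRV_le nil'' _)
  have b2 := eLpNorm_mul_mul_mul_le_of_le hr0 p0 p1 p2 p3 (q0 _)
    (S.eLpNorm_snd_le nil _) (S.eLpNorm_snd_le nil' _) (S.eLpNorm_snd_le nil'' _)
  simp only [mul_assoc, e2] at i1 i2 b1 b2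
  have key := enorm_integral_mul_le_of_centered S.measurable_sample S.mixing
    (J := {i, l, l', l''}) (n₂ := 6) (k := k) (b := i) (by simp) hcard
    (m := m) (by rintro j (rfl | rfl | rfl | rfl); exacts [lt_edist_comm hik, hkl, hkl', hkl''])
    (K := H) S.regular.measurable (S.ae_integral_eq_zero nik)
    (R := fun ω => kernelRV X H i l ω * (kernelRV X H i l' ω * kernelRV X H i l'' ω))
    ((S.measurable_kernelRV_sigmaOf (by simp) (by simp)).mul
      ((S.measurable_kernelRV_sigmaOf (by simp) (by simp)).mul
        (S.measurable_kernelRV_sigmaOf (by simp) (by simp)))) (r := (4 + δ) / 4) (by linarith)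
    (L := kernelMoment μ X H (4 + δ) ^ 4) i1 i2 b1 b2
  rw [ex, mul_assoc] at key
  refine le_trans (le_of_eq ?_) key
  congr 2 with ω
  rw [S.kernelRV_comm i k]
  simp only [kernelRV]; ring

end IsMixingKernel

end KernelMoments

/-! ### Second and fourth moments of weighted sums of kernels with a common node -/

section WeightedSums

variable {Ω : Type u} [MeasurableSpace Ω] {μ : Measure Ω} [IsProbabilityMeasure μ]
  {ι : Type v} [EMetricSpace ι] {E : Type*} [MeasurableSpace E]
  {X : ι → Ω → E} {H : E → E → ℝ} {β : ℕ∞ → ℕ∞ → ℝ → ℝ≥0∞} {m δ : ℝ}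

/-- R is bounded, so only a moment of order 1 + δ of the kernel is needed; R may depend on any
number of nodes, whence β(1, ∞, m). -/
lemma IsMixingKernel.enorm_integral_mul_bounded_le (S : IsMixingKernel μ X H β) (hδ : 0 < δ)
    {J : Set ι} {i k : ι} (hk : k ∈ J) (hJ : ∀ j ∈ J, ENNReal.ofReal m < edist i j) {R : Ω → ℝ}
    (hR : Measurable[sigmaOf X J] R) {c : NNReal} (hc : ∀ ω, |R ω| ≤ c) :
    ‖∫ ω, kernelRV X H i k ω * R ω ∂μ‖ₑ ≤
      8 * c * (kernelMoment μ X H (1 + δ) * β 1 ⊤ m ^ (δ / (1 + δ))) := by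
  have hik := ne_of_lt_edist (hJ k hk)
  have hR' : Measurable R := hR.mono (sigmaOf_le S.measurable_sample J) le_rfl
  have ex : 1 - 1 / (1 + δ) = δ / (1 + δ) := by field_simp; ring
  have i1 : Integrable (fun ω => kernelRV X H i k ω * R ω) μ :=
    ((S.memLp_kernelRV hik).integrable (by norm_num)).mul_bdd hR'.aestronglyMeasurable
      (Filter.Eventually.of_forall fun ω => hc ω)
  have l3 := fun p => (S.eLpNorm_prod_le hik p).trans (kernelMomentIndep_le p)
  have i2 : Integrable (fun p : Ω × Ω => H (X i p.1) (X k p.2) * R p.2) (μ.prod μ) :=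
    (integrable_of_eLpNorm_le (p := ENNReal.ofReal 4) (by simp)
      (S.measurable_prod_kernel i k).aestronglyMeasurable (l3 4) S.moment_four).mul_bdd
      (hR'.comp measurable_snd).aestronglyMeasurable
      (Filter.Eventually.of_forall fun p => hc p.2)
  have b1 := eLpNorm_mul_le_of_bound (g := R) hc
    (eLpNorm_kernelRV_le (μ := μ) (X := X) (H := H) hik (1 + δ))
  have b2 := eLpNorm_mul_le_of_bound (g := fun p : Ω × Ω => R p.2) (fun p => hc p.2) (l3 (1 + δ))
  have key := enorm_integral_mul_le_of_centered S.measurable_sample S.mixing (J := J) (n₂ := ⊤)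
    hk le_top hJ S.regular.measurable (S.ae_integral_eq_zero hik.symm) hR (r := 1 + δ) (by linarith)
    (L := c * kernelMoment μ X H (1 + δ)) i1 i2
    b1 b2
  rw [ex] at key
  refine key.trans (le_of_eq (by ring))

variable [Fintype ι]

/-- The weighted sum `∑_k w_k H(X_i, X_k)`. -/
def wsum (X : ι → Ω → E) (H : E → E → ℝ) (i : ι) (w : ι → ℝ) (ω : Ω) : ℝ :=
  ∑ k, w k * kernelRV X H i k ω

/-- Weights that are bounded by `2` and vanish in the neighbourhood of `i`. -/
structure IsFarWeight (m : ℝ) (i : ι) (w : ι → ℝ) : Prop where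
  abs_le : ∀ k, |w k| ≤ 2
  far : ∀ k, w k ≠ 0 → ENNReal.ofReal m < edist i k

lemma IsFarWeight.enorm_le {i : ι} {w : ι → ℝ} (hw : IsFarWeight m i w) (k : ι) : ‖w k‖ₑ ≤ 2 := by
  rw [Real.enorm_eq_ofReal_abs, ← ENNReal.ofReal_ofNat]
  exact ENNReal.ofReal_le_ofReal (hw.abs_le k)

namespace IsMixingKernel

lemma measurable_wsum (S : IsMixingKernel μ X H β) (i : ι) (w : ι → ℝ) :
    Measurable (wsum X H i w) :=
  Finset.measurable_sum _ fun k _ => (S.measurable_kernelRV i k).const_mul _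

lemma memLp_wsum (S : IsMixingKernel μ X H β) {i : ι} {w : ι → ℝ} (hw : IsFarWeight m i w) :
    MemLp (wsum X H i w) 4 μ := by
  have : wsum X H i w = ∑ k, fun ω => w k * kernelRV X H i k ω := by
    ext ω; simp [wsum]
  rw [this]
  refine memLp_finsetSum' _ fun k _ => ?_
  by_cases h : w k = 0
  · simp [h]
  · exact (S.memLp_kernelRV (ne_of_lt_edist (hw.far k h))).const_mul _

lemma integrable_mul_of_memLp {T : Type*} [MeasurableSpace T] {ν : Measure T}
    [IsProbabilityMeasure ν] {f g : T → ℝ} (hf : MemLp f 4 ν) (hg : MemLp g 4 ν) :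
    Integrable (fun x => f x * g x) ν :=
  (hf.mono_exponent (by norm_num : (2 : ℝ≥0∞) ≤ 4)).integrable_mul
    (hg.mono_exponent (by norm_num : (2 : ℝ≥0∞) ≤ 4))

/-- The bound on second moments of weighted sums. -/
noncomputable def boundTwo (μ : Measure Ω) (X : ι → Ω → E) (H : E → E → ℝ)
    (β : ℕ∞ → ℕ∞ → ℝ → ℝ≥0∞) (m δ : ℝ) : ℝ≥0∞ :=
  tau ι m [2] * kernelMomentIndep μ X H 2 ^ 2 + (Fintype.card ι : ℝ≥0∞) ^ 2 *
    kernelMoment μ X H (2 + δ) ^ 2 * betaMax β 4 m ^ (δ / (2 + δ))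

/-- The bound on fourth moments of weighted sums. -/
noncomputable def boundFour (μ : Measure Ω) (X : ι → Ω → E) (H : E → E → ℝ)
    (β : ℕ∞ → ℕ∞ → ℝ → ℝ≥0∞) (m δ : ℝ) : ℝ≥0∞ :=
  (tau ι m [4] + tau ι m [2, 2]) * kernelMoment μ X H 4 ^ 4 +
    tauHat4 ι m * kernelMoment μ X H (4 + δ) ^ 4 * β 1 6 m ^ (δ / (4 + δ))

-- If k and l are close the pair bound with independent copies applies. If not, k is far from i and
-- from l, hence isolated. The constants are 2² from the weights and 4 · 8 = 32.
open Classical in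
lemma enorm_integral_pair_le (S : IsMixingKernel μ X H β) (hδ : 0 < δ) {i : ι} {w : ι → ℝ}
    (hw : IsFarWeight m i w) (k l : ι) :
    ‖∫ ω, w k * kernelRV X H i k ω * (w l * kernelRV X H i l ω) ∂μ‖ₑ ≤
      (if l ∈ nbhd m k then 4 * kernelMomentIndep μ X H 2 ^ 2 else 0) +
      32 * (kernelMoment μ X H (2 + δ) ^ 2 * betaMax β 4 m ^ (δ / (2 + δ))) := by
  have e : ∫ ω, w k * kernelRV X H i k ω * (w l * kernelRV X H i l ω) ∂μ =
      w k * w l * ∫ ω, kernelRV X H i k ω * kernelRV X H i l ω ∂μ := by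
    rw [← integral_const_mul]; congr with ω; ring
  by_cases hk : w k = 0
  · simp [hk]
  by_cases hl : w l = 0
  · simp [hl]
  rw [e, enorm_mul, enorm_mul]
  have h4 : ‖w k‖ₑ * ‖w l‖ₑ ≤ 4 :=
    (mul_le_mul' (hw.enorm_le k) (hw.enorm_le l)).trans (by norm_num)
  refine (mul_le_mul_left h4 _).trans ?_
  split_ifs with hkl
  · refine (mul_le_mul_right (S.enorm_integral_close_pair_le hδ (hw.far k hk) (hw.far l hl)) _).trans ?_
    rw [mul_add, ← mul_assoc 4 8]; norm_num
  · have hfar : ENNReal.ofReal m < edist k l := not_le.1 fun h => hkl (mem_nbhd.2 h)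
    have := S.enorm_integral_isolated_pair_le hδ (lt_edist_comm (hw.far k hk))
      (lt_edist_comm (hw.far k hk)) hfar (ne_of_lt_edist (hw.far l hl))
    rw [S.kernelRV_comm k i] at this
    refine (mul_le_mul_right this _).trans ?_
    rw [← mul_assoc 4 8, zero_add]; norm_num

/-- The square is expanded; the close pairs (k, l) number at most τ₂, and all others cost a mixing
error only. -/
lemma eLpNorm_wsum_two_sq_le (S : IsMixingKernel μ X H β) (hδ : 0 < δ) {i : ι} {w : ι → ℝ}
    (hw : IsFarWeight m i w) : eLpNorm (wsum X H i w) 2 μ ^ 2 ≤ 32 * boundTwo μ X H β m δ := by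
  classical
  have hterm : ∀ k, MemLp (fun ω => w k * kernelRV X H i k ω) 4 μ := fun k => by
    by_cases h : w k = 0
    · simp [h]
    · exact (S.memLp_kernelRV (ne_of_lt_edist (hw.far k h))).const_mul _
  have hsq : ∀ ω, wsum X H i w ω ^ 2 =
      ∑ k, ∑ l, w k * kernelRV X H i k ω * (w l * kernelRV X H i l ω) := fun ω => by
    rw [sq, wsum, Finset.sum_mul_sum]
  have hint : Integrable (fun ω => wsum X H i w ω ^ 2) μ := by
    simp only [hsq]
    exact integrable_finsetSum _ fun k _ => integrable_finsetSum _ fun l _ =>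
      integrable_mul_of_memLp (hterm k) (hterm l)
  have h := eLpNorm_pow_eq_enorm_integral (q := 2) (by decide) (by norm_num) hint
  rw [Nat.cast_ofNat] at h
  rw [h]
  simp only [hsq]
  rw [integral_finsetSum _ fun k _ => integrable_finsetSum _ fun l _ =>
      integrable_mul_of_memLp (hterm k) (hterm l)]
  refine (enorm_sum_le _ _).trans ?_
  calc ∑ k, ‖∫ ω, ∑ l, w k * kernelRV X H i k ω * (w l * kernelRV X H i l ω) ∂μ‖ₑ
      ≤ ∑ k, ∑ l, ((if l ∈ nbhd m k then 4 * kernelMomentIndep μ X H 2 ^ 2 else 0) +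
      32 * (kernelMoment μ X H (2 + δ) ^ 2 * betaMax β 4 m ^ (δ / (2 + δ)))) := by
        refine Finset.sum_le_sum fun k _ => ?_
        rw [integral_finsetSum _ fun l _ => integrable_mul_of_memLp (hterm k) (hterm l)]
        exact (enorm_sum_le _ _).trans
          (Finset.sum_le_sum fun l _ => S.enorm_integral_pair_le hδ hw k l)
    _ = (∑ k, ((nbhd m k).card : ℝ≥0∞)) * (4 * kernelMomentIndep μ X H 2 ^ 2) +
        32 * ((Fintype.card ι : ℝ≥0∞) ^ 2 *
          kernelMoment μ X H (2 + δ) ^ 2 * betaMax β 4 m ^ (δ / (2 + δ))) := by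
        simp only [Finset.sum_add_distrib, Finset.sum_ite_mem, Finset.univ_inter,
          Finset.sum_const, Finset.card_univ, nsmul_eq_mul, Finset.sum_mul]
        ring
    _ ≤ tau ι m [2] * (32 * kernelMomentIndep μ X H 2 ^ 2) + 32 * ((Fintype.card ι : ℝ≥0∞) ^ 2 *
          kernelMoment μ X H (2 + δ) ^ 2 * betaMax β 4 m ^ (δ / (2 + δ))) := by
        gcongr
        · exact sum_card_nbhd_le
        · norm_num
    _ = _ := by rw [boundTwo]; ring

lemma enorm_integral_quadruple_le (S : IsMixingKernel μ X H β) {i : ι} {k : Fin 4 → ι}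
    (hk : ∀ j, ENNReal.ofReal m < edist i (k j)) :
    ‖∫ ω, ∏ j, kernelRV X H i (k j) ω ∂μ‖ₑ ≤ kernelMoment μ X H 4 ^ 4 := by
  have hm := fun j => (S.measurable_kernelRV i (k j)).aestronglyMeasurable (μ := μ)
  have hn := fun j => ne_of_lt_edist (hk j)
  have h := eLpNorm_mul_mul_mul_le_of_le (r := 1) one_pos (hm 0) (hm 1) (hm 2) (hm 3)
    (eLpNorm_kernelRV_le (hn 0) _) (eLpNorm_kernelRV_le (hn 1) _)
    (eLpNorm_kernelRV_le (hn 2) _) (eLpNorm_kernelRV_le (hn 3) _)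
  rw [mul_one] at h
  refine le_trans ?_ h
  have e : ∀ ω, ∏ j, kernelRV X H i (k j) ω = kernelRV X H i (k 0) ω * kernelRV X H i (k 1) ω *
      (kernelRV X H i (k 2) ω * kernelRV X H i (k 3) ω) := fun ω => by
    rw [Fin.prod_univ_four]; ring
  simp only [e]
  exact enorm_integral_le_eLpNorm (((hm 0).mul (hm 1)).mul ((hm 2).mul (hm 3))) (by simp)

lemma enorm_integral_quadruple_le_of_isolated (S : IsMixingKernel μ X H β) (hδ : 0 < δ) {i : ι}
    {k : Fin 4 → ι} (hk : ∀ j, ENNReal.ofReal m < edist i (k j)) {a : Fin 4}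
    (ha : ∀ b, b ≠ a → ENNReal.ofReal m < edist (k a) (k b)) :
    ‖∫ ω, ∏ j, kernelRV X H i (k j) ω ∂μ‖ₑ ≤
      8 * (kernelMoment μ X H (4 + δ) ^ 4 * β 1 6 m ^ (δ / (4 + δ))) := by
  have main : ∀ b c d : Fin 4, b ≠ a → c ≠ a → d ≠ a →
      (∀ f : Fin 4 → ℝ, ∏ j, f j = f a * f b * (f c * f d)) →
      ‖∫ ω, ∏ j, kernelRV X H i (k j) ω ∂μ‖ₑ ≤
      8 * (kernelMoment μ X H (4 + δ) ^ 4 * β 1 6 m ^ (δ / (4 + δ))) := by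
    intro b c d hb hc hd hf
    have := S.enorm_integral_isolated_quadruple_le hδ (hk a) (hk b) (hk c) (hk d) (ha b hb)
      (ha c hc) (ha d hd)
    simpa only [hf] using this
  rcases (by decide : ∀ a : Fin 4, a = 0 ∨ a = 1 ∨ a = 2 ∨ a = 3) a with rfl | rfl | rfl | rfl
  · exact main 1 2 3 (by decide) (by decide) (by decide)
      fun f => by rw [Fin.prod_univ_four]; ring
  · exact main 0 2 3 (by decide) (by decide) (by decide)
      fun f => by rw [Fin.prod_univ_four]; ring
  · exact main 0 1 3 (by decide) (by decide) (by decide)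
      fun f => by rw [Fin.prod_univ_four]; ring
  · exact main 0 1 2 (by decide) (by decide) (by decide)
      fun f => by rw [Fin.prod_univ_four]; ring

/-- The fourth power is expanded over index vectors of length four. Profiles (4) and (2, 2) are
bounded by Hölder; every other profile has an isolated node. The constant is 128 = 2⁴ · 8. -/
lemma eLpNorm_wsum_four_pow_le (S : IsMixingKernel μ X H β) (hδ : 0 < δ) {i : ι} {w : ι → ℝ}
    (hw : IsFarWeight m i w) : eLpNorm (wsum X H i w) 4 μ ^ 4 ≤ 128 * boundFour μ X H β m δ := by
  have hexp : ∀ ω, wsum X H i w ω ^ 4 =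
      ∑ k : Fin 4 → ι, (∏ j, w (k j)) * ∏ j, kernelRV X H i (k j) ω := fun ω => by
    rw [wsum, Fintype.sum_pow]
    simp only [Finset.prod_mul_distrib]
  have hzero : ∀ k : Fin 4 → ι, (∀ j, w (k j) ≠ 0) ∨ ∏ j, w (k j) = 0 := fun k => by
    by_cases h : ∀ j, w (k j) ≠ 0
    · exact .inl h
    · push Not at h
      obtain ⟨j, hj⟩ := h
      exact .inr (Finset.prod_eq_zero (Finset.mem_univ j) hj)
  have hint : ∀ k : Fin 4 → ι,
      Integrable (fun ω => (∏ j, w (k j)) * ∏ j, kernelRV X H i (k j) ω) μ := fun k => by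
    rcases hzero k with h | h
    · have hm := fun j => (S.measurable_kernelRV i (k j)).aestronglyMeasurable (μ := μ)
      have hn := fun j => ne_of_lt_edist (hw.far _ (h j))
      have := S.integrable_mul_mul_mul (hm 0) (hm 1) (hm 2) (hm 3)
        (eLpNorm_kernelRV_le (hn 0)) (eLpNorm_kernelRV_le (hn 1))
        (eLpNorm_kernelRV_le (hn 2)) (eLpNorm_kernelRV_le (hn 3))
      refine (this.congr (Filter.Eventually.of_forall fun ω => ?_)).const_mul _
      simp only [Fin.prod_univ_four]; ring
    · simp [h]
  have hw16 : ∀ k : Fin 4 → ι, ‖∏ j, w (k j)‖ₑ ≤ 16 := fun k => by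
    rw [Fin.prod_univ_four, enorm_mul, enorm_mul, enorm_mul]
    calc _ ≤ (2 : ℝ≥0∞) * 2 * 2 * 2 := by
          gcongr <;> exact hw.enorm_le _
      _ = 16 := by norm_num
  have h := eLpNorm_pow_eq_enorm_integral (q := 4) (by decide) (by norm_num) (f := wsum X H i w)
    (ν := μ) (by simp only [hexp]; exact integrable_finsetSum _ fun k _ => hint k)
  rw [Nat.cast_ofNat] at h
  rw [h]
  simp only [hexp]
  rw [integral_finsetSum _ fun k _ => hint k]
  refine (enorm_sum_le _ _).trans ?_
  have key := sum_le_tau_four (ι := ι) (m := m)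
    (f := fun k : Fin 4 → ι => ‖∫ ω, (∏ j, w (k j)) * ∏ j, kernelRV X H i (k j) ω ∂μ‖ₑ)
    (a := 16 * kernelMoment μ X H 4 ^ 4) (b := 16 * kernelMoment μ X H 4 ^ 4)
    (c := 16 * (8 * (kernelMoment μ X H (4 + δ) ^ 4 * β 1 6 m ^ (δ / (4 + δ)))))
  have hab : ∀ k : Fin 4 → ι, ‖∫ ω, (∏ j, w (k j)) * ∏ j, kernelRV X H i (k j) ω ∂μ‖ₑ ≤
      16 * kernelMoment μ X H 4 ^ 4 := fun k => by
    rw [integral_const_mul, enorm_mul]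
    rcases hzero k with h | h
    · exact mul_le_mul' (hw16 k) (S.enorm_integral_quadruple_le fun j => hw.far _ (h j))
    · simp [h]
  refine (key (fun k _ => hab k) (fun k _ => hab k) fun k hk => ?_).trans ?_
  · simp only [integral_const_mul, enorm_mul]
    rcases hzero k with h | h
    · obtain ⟨a, ha⟩ := exists_isolated hk
      exact mul_le_mul' (hw16 k)
        (S.enorm_integral_quadruple_le_of_isolated hδ (fun j => hw.far _ (h j)) ha)
    · simp [h]
  · calc _ = 16 * ((tau ι m [4] + tau ι m [2, 2]) * kernelMoment μ X H 4 ^ 4) +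
          128 * (tauHat4 ι m * kernelMoment μ X H (4 + δ) ^ 4 * β 1 6 m ^ (δ / (4 + δ))) := by ring
      _ ≤ 128 * ((tau ι m [4] + tau ι m [2, 2]) * kernelMoment μ X H 4 ^ 4) +
          128 * (tauHat4 ι m * kernelMoment μ X H (4 + δ) ^ 4 * β 1 6 m ^ (δ / (4 + δ))) := by
          gcongr; norm_num
      _ = _ := by rw [boundFour]; ring

end IsMixingKernel

end WeightedSums

/-! ### The kernels Γ: moments, degeneracy and covariances -/

section GammaKernel

variable {Ω : Type u} [MeasurableSpace Ω] {μ : Measure Ω} [IsProbabilityMeasure μ]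
  {ι : Type v} [EMetricSpace ι] {E : Type*} [MeasurableSpace E]
  {X : ι → Ω → E} {H : E → E → ℝ} {β : ℕ∞ → ℕ∞ → ℝ → ℝ≥0∞} {m δ : ℝ}

lemma enorm_covariance_le_two_mul {Y Z : Ω → ℝ} (hY : MemLp Y 2 μ) (hZ : MemLp Z 2 μ)
    {a b : ℝ≥0∞} (ha : eLpNorm Y 2 μ ≤ a) (hb : eLpNorm Z 2 μ ≤ b) :
    ‖cov[Y, Z; μ]‖ₑ ≤ 2 * (a * b) := by
  rw [covariance_eq_sub hY hZ]
  refine enorm_sub_le.trans ?_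
  rw [two_mul]
  refine add_le_add ?_ ?_
  · refine (enorm_integral_le_eLpNorm (p := ENNReal.ofReal 1) (hY.1.mul hZ.1) (by simp)).trans ?_
    exact eLpNorm_mul_le_of_le one_pos hY.1 hZ.1 (by simpa using ha) (by simpa using hb)
  · rw [enorm_mul]
    exact mul_le_mul' ((enorm_integral_le_eLpNorm hY.1 one_le_two).trans ha)
      ((enorm_integral_le_eLpNorm hZ.1 one_le_two).trans hb)

/-- The variance of a double sum whose summands are indexed by close pairs. -/
lemma enorm_variance_close_sum_le [Fintype ι] {Y : ι → ι → Ω → ℝ} (hL2 : ∀ k l, MemLp (Y k l) 2 μ)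
    (hzero : ∀ k l, ¬ edist k l ≤ ENNReal.ofReal m → Y k l = 0) {a b : ℝ≥0∞}
    (ha : ∀ k l k' l', edist k l ≤ ENNReal.ofReal m → edist k' l' ≤ ENNReal.ofReal m →
      ‖cov[Y k l, Y k' l'; μ]‖ₑ ≤ a)
    (hb : ∀ k l k' l', edist k l ≤ ENNReal.ofReal m → edist k' l' ≤ ENNReal.ofReal m →
      (∀ i ∈ ({k, l} : Set ι), ∀ j ∈ ({k', l'} : Set ι), ENNReal.ofReal m < edist i j) →
      ‖cov[Y k l, Y k' l'; μ]‖ₑ ≤ b) :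
    ‖Var[fun ω => ∑ k, ∑ l, Y k l ω; μ]‖ₑ ≤ tau ι m [4] * a + tau ι m [2, 2] * b := by
  have h1 : Var[fun ω => ∑ k, ∑ l, Y k l ω; μ] =
      ∑ k : Fin 4 → ι, cov[Y (k 0) (k 1), Y (k 2) (k 3); μ] := by
    have e : (fun ω => ∑ k, ∑ l, Y k l ω) = fun ω => ∑ p : ι × ι, Y p.1 p.2 ω := by
      ext ω; rw [Fintype.sum_prod_type]
    rw [e, variance_fun_sum' (X := fun p : ι × ι => Y p.1 p.2) fun p _ => hL2 _ _]
    simp only [Fintype.sum_prod_type]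
    rw [sum_fin_four]
    rfl
  rw [h1]
  refine (enorm_sum_le _ _).trans ?_
  have hz : ∀ k : Fin 4 → ι, ‖cov[Y (k 0) (k 1), Y (k 2) (k 3); μ]‖ₑ = 0 ∨
      (edist (k 0) (k 1) ≤ ENNReal.ofReal m ∧ edist (k 2) (k 3) ≤ ENNReal.ofReal m) := by
    intro k
    by_cases h1 : edist (k 0) (k 1) ≤ ENNReal.ofReal m
    · by_cases h2 : edist (k 2) (k 3) ≤ ENNReal.ofReal m
      · exact .inr ⟨h1, h2⟩
      · left; rw [hzero _ _ h2]; simp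
    · left; rw [hzero _ _ h1]; simp
  -- Vectors with an isolated position contribute exactly 0, since the summand vanishes unless
  -- positions 0, 1 and positions 2, 3 are adjacent.
  have key := sum_le_tau_four (ι := ι) (m := m)
    (f := fun k => ‖cov[Y (k 0) (k 1), Y (k 2) (k 3); μ]‖ₑ) (a := a) (b := b) (c := 0) ?_ ?_ ?_
  · simpa using key
  · intro k _
    rcases hz k with h | h
    · rw [h]; exact zero_le
    · exact ha _ _ _ _ h.1 h.2
  · intro k hk
    rcases hz k with h | h
    · rw [h]; exact zero_le
    · refine hb _ _ _ _ h.1 h.2 ?_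
      have := far_of_profile_two_two hk (a := 0) (b := 1) (c := 2) (d := 3) (by decide) h.1 h.2
      rintro i (rfl | rfl) j (rfl | rfl)
      exacts [this.1, this.2.1, this.2.2.1, this.2.2.2]
  · intro k hk
    obtain ⟨a, ha⟩ := exists_isolated hk
    rcases hz k with h | h
    · rw [h]
    · exfalso
      rcases (by decide : ∀ a : Fin 4, a = 0 ∨ a = 1 ∨ a = 2 ∨ a = 3) a with rfl | rfl | rfl | rfl
      · exact absurd h.1 (not_le.2 (ha 1 (by decide)))
      · exact absurd h.1 (not_le.2 (lt_edist_comm (ha 0 (by decide))))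
      · exact absurd h.2 (not_le.2 (ha 3 (by decide)))
      · exact absurd h.2 (not_le.2 (lt_edist_comm (ha 2 (by decide))))

/-- The random variable `Γ^{i,a}(X_k, X_l)`. -/
noncomputable def gammaRV (μ : Measure Ω) (X : ι → Ω → E) (H : E → E → ℝ) (i a k l : ι) (ω : Ω) :
    ℝ := gammaKernel μ X H i a (X k ω) (X l ω)

lemma gammaRV_swap (i a k l : ι) : gammaRV μ X H i a k l = gammaRV μ X H a i l k := by
  ext ω
  simp only [gammaRV, gammaKernel, mul_comm]

namespace IsMixingKernel

lemma measurable_gammaKernel (S : IsMixingKernel μ X H β) (i a : ι) :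
    Measurable fun z : E × E => gammaKernel μ X H i a z.1 z.2 := by
  have hX := S.measurable_sample
  have hH := S.regular.measurable
  have : Measurable fun q : (E × E) × Ω => H (X i q.2) q.1.1 * H (X a q.2) q.1.2 :=
    (hH.comp (((hX i).comp measurable_snd).prodMk measurable_fst.fst)).mul
      (hH.comp (((hX a).comp measurable_snd).prodMk measurable_fst.snd))
  exact (this.stronglyMeasurable.integral_prod_right').measurable

lemma measurable_gammaRV (S : IsMixingKernel μ X H β) (i a k l : ι) :
    Measurable (gammaRV μ X H i a k l) :=
  (S.measurable_gammaKernel i a).comp ((S.measurable_sample k).prodMk (S.measurable_sample l))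

lemma measurable_gammaRV_sigmaOf (S : IsMixingKernel μ X H β) {J : Set ι} (i a : ι) {k l : ι}
    (hk : k ∈ J) (hl : l ∈ J) : Measurable[sigmaOf X J] (gammaRV μ X H i a k l) :=
  (S.measurable_gammaKernel i a).comp ((measurable_sigmaOf hk).prodMk (measurable_sigmaOf hl))

/-- Jensen's inequality pulls the integral over (X_i, X_a) out of the norm, then Cauchy–Schwarz
separates the two kernels. U and V need not be independent, so the bound covers (X_k, X_l) as well
as independent copies. -/
lemma eLpNorm_gammaKernel_le (S : IsMixingKernel μ X H β) {i a k l : ι} (hik : i ≠ k) (hal : a ≠ l)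
    {T : Type*} [MeasurableSpace T] {ν : Measure T} [IsProbabilityMeasure ν] {U V : T → Ω}
    (hU : MeasurePreserving U ν μ) (hV : MeasurePreserving V ν μ) {r : ℝ} (hr : 1 ≤ r) :
    eLpNorm (fun t => gammaKernel μ X H i a (X k (U t)) (X l (V t))) (ENNReal.ofReal r) ν ≤
      kernelMomentIndep μ X H (2 * r) ^ 2 := by
  have hX := S.measurable_sample
  have hH := S.regular.measurable
  have m1 : Measurable fun q : Ω × T => H (X i q.1) (X k (U q.2)) :=
    hH.comp (((hX i).comp measurable_fst).prodMk ((hX k).comp (hU.measurable.comp measurable_snd)))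
  have m2 : Measurable fun q : Ω × T => H (X a q.1) (X l (V q.2)) :=
    hH.comp (((hX a).comp measurable_fst).prodMk ((hX l).comp (hV.measurable.comp measurable_snd)))
  refine (eLpNorm_integral_le (m1.mul m2) hr).trans ?_
  rw [sq]
  exact eLpNorm_mul_le_of_le (by linarith) m1.aestronglyMeasurable m2.aestronglyMeasurable
    (S.eLpNorm_indep_le hik _ ((MeasurePreserving.id μ).prod hU))
    (S.eLpNorm_indep_le hal _ ((MeasurePreserving.id μ).prod hV))

lemma eLpNorm_gammaRV_le (S : IsMixingKernel μ X H β) {i a k l : ι} (hik : i ≠ k) (hal : a ≠ l)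
    {r : ℝ} (hr : 1 ≤ r) :
    eLpNorm (gammaRV μ X H i a k l) (ENNReal.ofReal r) μ ≤ kernelMoment μ X H (2 * r) ^ 2 :=
  (S.eLpNorm_gammaKernel_le hik hal (MeasurePreserving.id μ) (MeasurePreserving.id μ) hr).trans
    (by gcongr; exact kernelMomentIndep_le _)

lemma memLp_gammaRV (S : IsMixingKernel μ X H β) {i a k l : ι} (hik : i ≠ k) (hal : a ≠ l) :
    MemLp (gammaRV μ X H i a k l) 2 μ := by
  refine ⟨(S.measurable_gammaRV i a k l).aestronglyMeasurable, ?_⟩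
  have := S.eLpNorm_gammaRV_le hik hal (r := 2) (by norm_num)
  rw [ENNReal.ofReal_ofNat] at this
  refine this.trans_lt (ENNReal.pow_lt_top ?_)
  have h := S.moment_four.lt_top
  norm_num
  exact h

lemma memLp_gammaKernel (S : IsMixingKernel μ X H β) {i a k l : ι} (hik : i ≠ k) (hal : a ≠ l)
    {T : Type*} [MeasurableSpace T] {ν : Measure T} [IsProbabilityMeasure ν] {U V : T → Ω}
    (hU : MeasurePreserving U ν μ) (hV : MeasurePreserving V ν μ) :
    MemLp (fun t => gammaKernel μ X H i a (X k (U t)) (X l (V t))) 2 ν := by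
  refine ⟨((S.measurable_gammaKernel i a).comp (((S.measurable_sample k).comp hU.measurable).prodMk
    ((S.measurable_sample l).comp hV.measurable))).aestronglyMeasurable, ?_⟩
  have := S.eLpNorm_gammaKernel_le hik hal hU hV (r := 2) (by norm_num)
  rw [ENNReal.ofReal_ofNat] at this
  refine this.trans_lt (ENNReal.pow_lt_top ?_)
  have h := (kernelMomentIndep_le (μ := μ) (X := X) (H := H) 4).trans_lt S.moment_four.lt_top
  norm_num
  exact h

/-- Γ inherits degeneracy: by Fubini X_k is integrated first, with X_i frozen, and degeneracy of H
makes that integral vanish. -/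
lemma ae_integral_gammaKernel_eq_zero (S : IsMixingKernel μ X H β) {i a k l : ι} (hik : i ≠ k)
    (hal : a ≠ l) : ∀ᵐ ω' ∂μ, ∫ ω, gammaKernel μ X H i a (X k ω) (X l ω') ∂μ = 0 := by
  have hX := S.measurable_sample
  have hH := S.regular.measurable
  have hm4 : ∀ {c d : ι}, c ≠ d → MemLp (fun t : Ω × Ω => H (X c t.1) (X d t.2)) 2 (μ.prod μ) := by
    intro c d hcd
    refine MemLp.mono_exponent (q := 4)
      ⟨(S.measurable_prod_kernel c d).aestronglyMeasurable, ?_⟩ (by norm_num)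
    have := (S.eLpNorm_prod_le hcd 4).trans_lt
      ((kernelMomentIndep_le (μ := μ) (X := X) (H := H) 4).trans_lt S.moment_four.lt_top)
    rwa [ENNReal.ofReal_ofNat] at this
  -- For almost every value of X_l the section H(X_a, X_l) is square integrable, which is what
  -- Fubini needs.
  filter_upwards [(hm4 hal).integrable_sq.prod_left_ae] with ω' hω'
  have hL : MemLp (fun ω => H (X a ω) (X l ω')) 2 μ :=
    (memLp_two_iff_integrable_sq (hH.comp ((hX a).prodMk measurable_const)).aestronglyMeasurable).2 hω'
  have hL' : MemLp (fun t : Ω × Ω => H (X a t.1) (X l ω')) 2 (μ.prod μ) :=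
    hL.comp_measurePreserving measurePreserving_fst
  have hint : Integrable (fun t : Ω × Ω => H (X i t.1) (X k t.2) * H (X a t.1) (X l ω'))
      (μ.prod μ) := (hm4 hik).integrable_mul hL'
  have e : ∫ ω, gammaKernel μ X H i a (X k ω) (X l ω') ∂μ =
      ∫ t : Ω × Ω, H (X i t.1) (X k t.2) * H (X a t.1) (X l ω') ∂(μ.prod μ) := by
    rw [integral_prod_symm _ hint]; rfl
  rw [e, integral_prod _ hint]
  refine integral_eq_zero_of_ae ?_
  filter_upwards [S.ae_integral_eq_zero hik] with ω hω
  simp only [integral_mul_const, Pi.zero_apply]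
  have : ∫ ω₁, H (X i ω) (X k ω₁) ∂μ = 0 := by
    rw [← hω]; congr with ω₁; exact S.regular.symm _ _
  rw [this, zero_mul]

/-- Γ(·, y) is centred, so the principle for an isolated node applies with Γ in place of H. -/
lemma enorm_integral_gamma_mul_le_of_isolated (S : IsMixingKernel μ X H β) (hδ : 0 < δ)
    {i a k l b c k' l' : ι} (hik : i ≠ k) (hal : a ≠ l) (hbk : b ≠ k') (hcl : c ≠ l')
    (h1 : ENNReal.ofReal m < edist k l) (h2 : ENNReal.ofReal m < edist k k')
    (h3 : ENNReal.ofReal m < edist k l') :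
    ‖∫ ω, gammaRV μ X H i a k l ω * gammaRV μ X H b c k' l' ω ∂μ‖ₑ ≤
      8 * (kernelMoment μ X H (4 + δ) ^ 4 * betaMax β 4 m ^ (δ / (4 + δ))) := by
  have hr0 : 0 < (4 + δ) / 4 := by positivity
  have e2 : 2 * (2 * ((4 + δ) / 4)) = 4 + δ := by ring
  have ex : 1 - 1 / ((4 + δ) / 4) = δ / (4 + δ) := by field_simp; ring
  have m1 := (S.measurable_gammaRV i a k l).aestronglyMeasurable (μ := μ)
  have m2 := (S.measurable_gammaRV b c k' l').aestronglyMeasurable (μ := μ)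
  have hr2 : 1 ≤ 2 * ((4 + δ) / 4) := by linarith
  have fst := measurePreserving_fst (μ := μ) (ν := μ)
  have snd := measurePreserving_snd (μ := μ) (ν := μ)
  have p1 := S.memLp_gammaKernel hik hal fst snd
  have p2 := S.memLp_gammaKernel hbk hcl snd snd
  have l1 := (S.eLpNorm_gammaKernel_le hik hal fst snd hr2)
  have l2 := (S.eLpNorm_gammaKernel_le hbk hcl snd snd hr2)
  have hle := kernelMomentIndep_le (μ := μ) (X := X) (H := H) (4 + δ)
  rw [e2] at l1 l2
  have key := enorm_integral_mul_le_of_centered S.measurable_sample S.mixing (J := {l, k', l'})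
    (n₂ := (3 : ℕ)) (k := k) (b := l) (by simp) (encard_triple_le l k' l')
    (m := m) (by rintro j (rfl | rfl | rfl) <;> assumption) (K := gammaKernel μ X H i a)
    (S.measurable_gammaKernel i a)
    (S.ae_integral_gammaKernel_eq_zero hik hal) (R := gammaRV μ X H b c k' l')
    (S.measurable_gammaRV_sigmaOf b c (by simp) (by simp)) (r := (4 + δ) / 4) (by linarith)
    (L := kernelMoment μ X H (4 + δ) ^ 4)
    ((S.memLp_gammaRV hik hal).integrable_mul (S.memLp_gammaRV hbk hcl))
    (p1.integrable_mul p2)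
    ((eLpNorm_mul_le_of_le hr0 m1 m2 (S.eLpNorm_gammaRV_le hik hal hr2)
      (S.eLpNorm_gammaRV_le hbk hcl hr2)).trans (by rw [e2, ← pow_add]))
    ((eLpNorm_mul_le_of_le hr0 p1.1 p2.1 l1 l2).trans (by rw [← pow_add]; gcongr))
  rw [ex] at key
  refine key.trans ?_
  rw [mul_assoc]
  gcongr
  exact le_betaMax β (q₁ := 1) (q₂ := 3) (by norm_num) (by norm_num) (by norm_num) m

/-- Since k and l are far apart they can be decoupled, and the second moment under the product law
is bounded by Γ_{m,2}². -/
lemma enorm_integral_gammaRV_sq_le (S : IsMixingKernel μ X H β) (hδ : 0 < δ) {i a k l : ι}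
    (hik : i ≠ k) (hal : a ≠ l) (hia : edist i a ≤ ENNReal.ofReal m)
    (hkl : ENNReal.ofReal m < edist k l) :
    ‖∫ ω, gammaRV μ X H i a k l ω * gammaRV μ X H i a k l ω ∂μ‖ₑ ≤ gammaMoment μ X H m 2 ^ 2 +
      8 * (kernelMoment μ X H (4 + δ) ^ 4 * betaMax β 4 m ^ (δ / (4 + δ))) := by
  have hr0 : 0 < (4 + δ) / 4 := by positivity
  have e2 : 2 * (2 * ((4 + δ) / 4)) = 4 + δ := by ring
  have ex : 1 - 1 / ((4 + δ) / 4) = δ / (4 + δ) := by field_simp; ring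
  have m1 := (S.measurable_gammaRV i a k l).aestronglyMeasurable (μ := μ)
  have hr2 : 1 ≤ 2 * ((4 + δ) / 4) := by linarith
  have fst := measurePreserving_fst (μ := μ) (ν := μ)
  have snd := measurePreserving_snd (μ := μ) (ν := μ)
  have p1 := S.memLp_gammaKernel hik hal fst snd
  have l1 := (S.eLpNorm_gammaKernel_le hik hal fst snd hr2)
  have hle := kernelMomentIndep_le (μ := μ) (X := X) (H := H) (4 + δ)
  rw [e2] at l1
  have hG := S.measurable_gammaKernel i a
  have hX := S.measurable_sample
  have key := enorm_integral_sub_integral_prod_le S.measurable_sample S.mixing (I := {k})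
    (J := {l}) (n₁ := (1 : ℕ)) (n₂ := (3 : ℕ)) (m := m) (by simp) (by simp)
    (by rintro x rfl j rfl; exact hkl) (Y := X k) (Z := X l)
    (measurable_sigmaOf (Set.mem_singleton k)) (measurable_sigmaOf (Set.mem_singleton l))
    (h := fun z : E × E => gammaKernel μ X H i a z.1 z.2 * gammaKernel μ X H i a z.1 z.2)
    (hG.mul hG) (r := (4 + δ) / 4) (by linarith) (K := kernelMoment μ X H (4 + δ) ^ 4)
    ((S.memLp_gammaRV hik hal).integrable_mul (S.memLp_gammaRV hik hal))
    (p1.integrable_mul p1)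
    ((eLpNorm_mul_le_of_le hr0 m1 m1 (S.eLpNorm_gammaRV_le hik hal hr2)
      (S.eLpNorm_gammaRV_le hik hal hr2)).trans (by rw [e2, ← pow_add]))
    ((eLpNorm_mul_le_of_le hr0 p1.1 p1.1 l1 l1).trans (by rw [← pow_add]; gcongr))
  rw [ex] at key
  have hmap : eLpNorm (fun t : Ω × Ω => gammaKernel μ X H i a (X k t.1) (X l t.2)) 2 (μ.prod μ) ≤
      gammaMoment μ X H m 2 := by
    have hm : Measurable (Prod.map (X k) (X l)) := (hX k).prodMap (hX l)
    have h1 : indepLaw μ X k l = (μ.prod μ).map (Prod.map (X k) (X l)) := by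
      have := Measure.isProbabilityMeasure_map (μ := μ) (hX k).aemeasurable
      have := Measure.isProbabilityMeasure_map (μ := μ) (hX l).aemeasurable
      exact Measure.map_prod_map _ _ (hX k) (hX l)
    have h2 := eLpNorm_map_measure (p := 2) (μ := μ.prod μ) hG.aestronglyMeasurable
      hm.aemeasurable
    rw [← h1] at h2
    refine h2.symm.le.trans ?_
    unfold gammaMoment
    rw [ENNReal.ofReal_ofNat]
    exact le_iSup_of_le i <| le_iSup_of_le a <| le_iSup_of_le k <| le_iSup_of_le l <|
      le_iSup_of_le hia <| le_iSup_of_le hkl le_rfl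
  have h2 : ‖∫ p : Ω × Ω, gammaKernel μ X H i a (X k p.1) (X l p.2) *
      gammaKernel μ X H i a (X k p.1) (X l p.2) ∂(μ.prod μ)‖ₑ ≤ gammaMoment μ X H m 2 ^ 2 := by
    refine (enorm_integral_le_eLpNorm (p := ENNReal.ofReal 1) (p1.1.mul p1.1) (by simp)).trans ?_
    rw [sq]
    refine eLpNorm_mul_le_of_le one_pos p1.1 p1.1 ?_ ?_ <;> simpa using hmap
  have h3 := enorm_add_le (∫ ω, gammaRV μ X H i a k l ω * gammaRV μ X H i a k l ω ∂μ -
      ∫ p : Ω × Ω, gammaKernel μ X H i a (X k p.1) (X l p.2) *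
      gammaKernel μ X H i a (X k p.1) (X l p.2) ∂(μ.prod μ))
    (∫ p : Ω × Ω, gammaKernel μ X H i a (X k p.1) (X l p.2) *
      gammaKernel μ X H i a (X k p.1) (X l p.2) ∂(μ.prod μ))
  rw [sub_add_cancel] at h3
  refine h3.trans ?_
  rw [add_comm]
  refine add_le_add h2 (key.trans ?_)
  rw [mul_assoc]
  gcongr
  exact le_betaMax β (q₁ := 1) (q₂ := 3) (by norm_num) (by norm_num) (by norm_num) m

lemma enorm_integral_gamma_mul_le (S : IsMixingKernel μ X H β)
    {i a k l b c k' l' : ι} (hik : i ≠ k) (hal : a ≠ l) (hbk : b ≠ k') (hcl : c ≠ l') :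
    ‖∫ ω, gammaRV μ X H i a k l ω * gammaRV μ X H b c k' l' ω ∂μ‖ₑ ≤
      kernelMoment μ X H 4 ^ 4 := by
  have p1 := S.memLp_gammaRV hik hal
  have p2 := S.memLp_gammaRV hbk hcl
  refine (enorm_integral_le_eLpNorm (p := ENNReal.ofReal 1) (p1.1.mul p2.1) (by simp)).trans ?_
  have := eLpNorm_mul_le_of_le one_pos p1.1 p2.1
    (S.eLpNorm_gammaRV_le hik hal (r := 2 * 1) (by norm_num))
    (S.eLpNorm_gammaRV_le hbk hcl (r := 2 * 1) (by norm_num))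
  refine this.trans (le_of_eq ?_)
  rw [← pow_add]; norm_num

/-- Each pair is internally far, but the two pairs may be close to one another, so they are not
decoupled from each other: |∫ fg| is at most the larger of ∫ f² and ∫ g², and each square is
decoupled internally. -/
lemma enorm_integral_gamma_mul_le_of_far (S : IsMixingKernel μ X H β) (hδ : 0 < δ)
    {i a k l k' l' : ι} (hik : i ≠ k) (hal : a ≠ l) (hik' : i ≠ k') (hal' : a ≠ l')
    (hia : edist i a ≤ ENNReal.ofReal m)
    (hkl : ENNReal.ofReal m < edist k l) (hkl' : ENNReal.ofReal m < edist k' l') :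
    ‖∫ ω, gammaRV μ X H i a k l ω * gammaRV μ X H i a k' l' ω ∂μ‖ₑ ≤ gammaMoment μ X H m 2 ^ 2 +
      8 * (kernelMoment μ X H (4 + δ) ^ 4 * betaMax β 4 m ^ (δ / (4 + δ))) := by
  have p1 := S.memLp_gammaRV hik hal
  have p2 := S.memLp_gammaRV hik' hal'
  have e1 := S.enorm_integral_gammaRV_sq_le hδ hik hal hia hkl
  have e2 := S.enorm_integral_gammaRV_sq_le hδ hik' hal' hia hkl'
  have q1 : Integrable (fun ω => gammaRV μ X H i a k l ω * gammaRV μ X H i a k l ω) μ :=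
    p1.integrable_mul p1
  have q2 : Integrable (fun ω => gammaRV μ X H i a k' l' ω * gammaRV μ X H i a k' l' ω) μ :=
    p2.integrable_mul p2
  have q3 : Integrable (fun ω => gammaRV μ X H i a k l ω * gammaRV μ X H i a k' l' ω) μ :=
    p1.integrable_mul p2
  set Q := gammaMoment μ X H m 2 ^ 2 +
      8 * (kernelMoment μ X H (4 + δ) ^ 4 * betaMax β 4 m ^ (δ / (4 + δ)))
  set A := ∫ ω, gammaRV μ X H i a k l ω * gammaRV μ X H i a k l ω ∂μ
  set B := ∫ ω, gammaRV μ X H i a k' l' ω * gammaRV μ X H i a k' l' ω ∂μ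
  have hA : 0 ≤ A := integral_nonneg fun ω => mul_self_nonneg _
  have hB : 0 ≤ B := integral_nonneg fun ω => mul_self_nonneg _
  have h : |∫ ω, gammaRV μ X H i a k l ω * gammaRV μ X H i a k' l' ω ∂μ| ≤ max A B := by
    have h1 : |∫ ω, gammaRV μ X H i a k l ω * gammaRV μ X H i a k' l' ω ∂μ| ≤ (A + B) / 2 := by
      refine abs_integral_le_integral_abs.trans ?_
      have h2 : (A + B) / 2 = ∫ ω, (gammaRV μ X H i a k l ω * gammaRV μ X H i a k l ω +
          gammaRV μ X H i a k' l' ω * gammaRV μ X H i a k' l' ω) / 2 ∂μ := by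
        rw [integral_div, integral_add q1 q2]
      rw [h2]
      refine integral_mono q3.abs ((q1.add q2).div_const 2) fun ω => ?_
      simp only
      rw [abs_le]
      constructor <;> nlinarith [sq_nonneg (gammaRV μ X H i a k l ω - gammaRV μ X H i a k' l' ω),
        sq_nonneg (gammaRV μ X H i a k l ω + gammaRV μ X H i a k' l' ω)]
    have := le_max_left A B
    have := le_max_right A B
    linarith
  rw [Real.enorm_eq_ofReal_abs]
  refine (ENNReal.ofReal_le_ofReal h).trans ?_
  rw [Real.enorm_of_nonneg hA] at e1
  rw [Real.enorm_of_nonneg hB] at e2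
  rcases max_cases A B with ⟨h, _⟩ | ⟨h, _⟩ <;> rw [h] <;> assumption

lemma enorm_covariance_gammaRV_le (S : IsMixingKernel μ X H β) (hδ : 0 < δ) {i a k l k' l' : ι}
    (hik : i ≠ k) (hal : a ≠ l) (hik' : i ≠ k') (hal' : a ≠ l')
    (hfar : ∀ i ∈ ({k, l} : Set ι), ∀ j ∈ ({k', l'} : Set ι), ENNReal.ofReal m < edist i j) :
    ‖cov[gammaRV μ X H i a k l, gammaRV μ X H i a k' l'; μ]‖ₑ ≤
      8 * (kernelMoment μ X H (4 + δ) ^ 4 * betaMax β 4 m ^ (δ / (4 + δ))) := by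
  have e2 : 2 * (2 * ((4 + δ) / 4)) = 4 + δ := by ring
  have ex : 1 - 1 / ((4 + δ) / 4) = δ / (4 + δ) := by field_simp; ring
  have hr2 : 1 ≤ 2 * ((4 + δ) / 4) := by linarith
  have key := enorm_covariance_le S.measurable_sample S.mixing (n₁ := (2 : ℕ)) (n₂ := (2 : ℕ))
    (encard_two_le k l) (encard_two_le k' l') hfar
    (S.measurable_gammaRV_sigmaOf i a (by simp) (by simp))
    (S.measurable_gammaRV_sigmaOf i a (by simp) (by simp))
    (S.memLp_gammaRV hik hal) (S.memLp_gammaRV hik' hal') (r := (4 + δ) / 4) (by linarith)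
    (S.eLpNorm_gammaRV_le hik hal hr2) (S.eLpNorm_gammaRV_le hik' hal' hr2)
  rw [ex, e2, ← pow_add] at key
  refine key.trans ?_
  rw [mul_assoc]
  gcongr
  exact le_betaMax β (q₁ := 2) (q₂ := 2) (by norm_num) (by norm_num) (by norm_num) m

/-- Integrating out the pair `(X_i, X_a)`. -/
lemma enorm_integral_mul_sub_gamma_le (S : IsMixingKernel μ X H β) (hδ : 0 < δ) {J : Set ι}
    {i a k l : ι} (hi : ∀ j ∈ J, ENNReal.ofReal m < edist i j)
    (ha : ∀ j ∈ J, ENNReal.ofReal m < edist a j) (hk : k ∈ J) (hl : l ∈ J) {φ : Ω → ℝ}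
    (hφ : Measurable[sigmaOf X J] φ) {c : NNReal} (hc : ∀ ω, |φ ω| ≤ c) :
    ‖∫ ω, kernelRV X H i k ω * kernelRV X H a l ω * φ ω ∂μ -
      ∫ ω, gammaRV μ X H i a k l ω * φ ω ∂μ‖ₑ ≤
      8 * c * (kernelMoment μ X H (2 + δ) ^ 2 * β 2 ⊤ m ^ (δ / (2 + δ))) := by
  have hik := ne_of_lt_edist (hi k hk)
  have hal := ne_of_lt_edist (ha l hl)
  have hφ' : Measurable φ := hφ.mono (sigmaOf_le S.measurable_sample J) le_rfl
  have hr0 : 0 < (2 + δ) / 2 := by positivity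
  have e2 : 2 * ((2 + δ) / 2) = 2 + δ := by ring
  have ex : 1 - 1 / ((2 + δ) / 2) = δ / (2 + δ) := by field_simp; ring
  have m1 := (S.measurable_kernelRV i k).aestronglyMeasurable (μ := μ)
  have m2 := (S.measurable_kernelRV a l).aestronglyMeasurable (μ := μ)
  have m3 := (S.measurable_prod_kernel i k).aestronglyMeasurable (μ := μ.prod μ)
  have m4 := (S.measurable_prod_kernel a l).aestronglyMeasurable (μ := μ.prod μ)
  have l3 := fun p => (S.eLpNorm_prod_le hik p).trans (kernelMomentIndep_le p)
  have l4 := fun p => (S.eLpNorm_prod_le hal p).trans (kernelMomentIndep_le p)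
  have hH := S.regular.measurable
  have hh : Measurable fun q : (E × E) × (E × E × ℝ) =>
      H q.1.1 q.2.1 * H q.1.2 q.2.2.1 * q.2.2.2 :=
    ((hH.comp (measurable_fst.fst.prodMk measurable_snd.fst)).mul
      (hH.comp (measurable_fst.snd.prodMk measurable_snd.snd.fst))).mul measurable_snd.snd.snd
  have i1 : Integrable (fun ω => kernelRV X H i k ω * kernelRV X H a l ω * φ ω) μ :=
    (S.integrable_mul m1 m2 (eLpNorm_kernelRV_le hik) (eLpNorm_kernelRV_le hal)).mul_bdd
      hφ'.aestronglyMeasurable (Filter.Eventually.of_forall fun ω => hc ω)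
  have i2 : Integrable (fun p : Ω × Ω => H (X i p.1) (X k p.2) * H (X a p.1) (X l p.2) * φ p.2)
      (μ.prod μ) :=
    (S.integrable_mul m3 m4 l3 l4).mul_bdd
      (hφ'.comp measurable_snd).aestronglyMeasurable (Filter.Eventually.of_forall fun p => hc p.2)
  have b1 := eLpNorm_mul_le_of_bound hc (eLpNorm_mul_le_of_le hr0 m1 m2
    (eLpNorm_kernelRV_le hik _) (eLpNorm_kernelRV_le hal _))
  have b2 := eLpNorm_mul_le_of_bound (g := fun p : Ω × Ω => φ p.2) (fun p => hc p.2)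
    (eLpNorm_mul_le_of_le hr0 m3 m4 (l3 _) (l4 _))
  rw [e2, ← sq] at b1 b2
  have key := enorm_integral_sub_integral_prod_le S.measurable_sample S.mixing (I := {i, a})
    (J := J) (n₁ := 2) (n₂ := ⊤) (m := m) (encard_two_le i a) le_top
    (by rintro x (rfl | rfl) j hj; exacts [hi j hj, ha j hj])
    (Y := fun ω => (X i ω, X a ω)) (Z := fun ω => (X k ω, X l ω, φ ω))
    ((measurable_sigmaOf (by simp)).prodMk (measurable_sigmaOf (by simp)))
    ((measurable_sigmaOf hk).prodMk ((measurable_sigmaOf hl).prodMk hφ)) hh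
    (r := (2 + δ) / 2) (by linarith) i1 i2 b1 b2
  rw [ex] at key
  -- Under the product law, integrating the first copy produces Γ by definition.
  have h0 : ∫ p : Ω × Ω, H (X i p.1) (X k p.2) * H (X a p.1) (X l p.2) * φ p.2 ∂(μ.prod μ) =
      ∫ ω, gammaRV μ X H i a k l ω * φ ω ∂μ := by
    rw [integral_prod_symm _ i2]
    simp only [integral_mul_const]
    rfl
  simp only [h0] at key
  refine key.trans (le_of_eq (by ring))

end IsMixingKernel

end GammaKernel

/-! ### Fluctuations of double sums of Γ -/

lemma ENNReal.le_mul_sqrt_of_sq_le {x c q : ℝ≥0∞} (h : x ^ 2 ≤ c ^ 2 * q) :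
    x ≤ c * q ^ (1 / 2 : ℝ) := by
  have h1 := ENNReal.rpow_le_rpow h (z := 1 / 2) (by norm_num)
  rw [ENNReal.mul_rpow_of_nonneg _ _ (by norm_num : (0 : ℝ) ≤ 1 / 2)] at h1
  simpa only [← ENNReal.rpow_natCast, ← ENNReal.rpow_mul, Nat.cast_ofNat, one_div,
    mul_inv_cancel₀ (two_ne_zero' ℝ), ENNReal.rpow_one] using h1

lemma sq_sum_sum_eq {ι : Type*} [Fintype ι] (g : ι → ι → ℝ) :
    (∑ k, ∑ l, g k l) ^ 2 = ∑ k : Fin 4 → ι, g (k 0) (k 1) * g (k 2) (k 3) := by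
  rw [sum_fin_four]
  simp_rw [sq, Finset.sum_mul, Finset.mul_sum]
  rfl

section GammaSum

variable {Ω : Type u} [MeasurableSpace Ω] {μ : Measure Ω} [IsProbabilityMeasure μ]
  {ι : Type v} [EMetricSpace ι] [Fintype ι] {E : Type*} [MeasurableSpace E]
  {X : ι → Ω → E} {H : E → E → ℝ} {β : ℕ∞ → ℕ∞ → ℝ → ℝ≥0∞} {m δ : ℝ}

lemma eLpNorm_sub_integral_sq {Y : Ω → ℝ} (hY : MemLp Y 2 μ) :
    eLpNorm (fun ω => Y ω - ∫ ω', Y ω' ∂μ) 2 μ ^ 2 = ‖Var[Y; μ]‖ₑ := by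
  have hint : Integrable (fun ω => (Y ω - ∫ ω', Y ω' ∂μ) ^ 2) μ :=
    (hY.sub (memLp_const _)).integrable_sq
  have h := eLpNorm_pow_eq_enorm_integral (q := 2) (by decide) (by norm_num) hint
  rw [Nat.cast_ofNat] at h
  rw [h, variance_eq_integral hY.1.aemeasurable]

namespace IsMixingKernel

/-- The bound on the fluctuations of sums of `Γ^{i,a}(X_k, X_l)`. -/
noncomputable def boundGamma (μ : Measure Ω) (X : ι → Ω → E) (H : E → E → ℝ)
    (β : ℕ∞ → ℕ∞ → ℝ → ℝ≥0∞) (m δ : ℝ) : ℝ≥0∞ :=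
  tau ι m [4] * kernelMoment μ X H 4 ^ 4 +
    tauHat4 ι m * kernelMoment μ X H (4 + δ) ^ 4 * betaMax β 4 m ^ (δ / (4 + δ)) +
    tau ι m [2, 2] * gammaMoment μ X H m 2 ^ 2

open Classical in
/-- The part of a sum of `Γ^{i,a}(X_k, X_l)` with indices in `J` that satisfy `p`. -/
noncomputable def gammaPart (μ : Measure Ω) (X : ι → Ω → E) (H : E → E → ℝ) (i a : ι)
    (J : Finset ι) (p : ι → ι → Prop) (k l : ι) : Ω → ℝ :=
  if k ∈ J ∧ l ∈ J ∧ p k l then gammaRV μ X H i a k l else 0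

variable {i a : ι} {J : Finset ι}

lemma memLp_gammaPart (S : IsMixingKernel μ X H β) (hi : ∀ j ∈ J, ENNReal.ofReal m < edist i j)
    (ha : ∀ j ∈ J, ENNReal.ofReal m < edist a j) (p : ι → ι → Prop) (k l : ι) :
    MemLp (gammaPart μ X H i a J p k l) 2 μ := by
  unfold gammaPart
  split_ifs with h
  · exact S.memLp_gammaRV (ne_of_lt_edist (hi k h.1)) (ne_of_lt_edist (ha l h.2.1))
  · exact MemLp.zero'

/-- For close k and l the mean of Γ(X_k, X_l) need not be small, hence the centring. Covariances of
separated pairs are mixing errors, so their count τ_{2,2} may be replaced by 3 τ̂₄; the constant 36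
dominates 2 and 3 · 8. -/
lemma enorm_variance_gamma_near_le (S : IsMixingKernel μ X H β) (hδ : 0 < δ)
    (hi : ∀ j ∈ J, ENNReal.ofReal m < edist i j) (ha : ∀ j ∈ J, ENNReal.ofReal m < edist a j) :
    ‖Var[fun ω => ∑ k, ∑ l, gammaPart μ X H i a J
      (fun k l => edist k l ≤ ENNReal.ofReal m) k l ω; μ]‖ₑ ≤ 6 ^ 2 * boundGamma μ X H β m δ := by
  set e := kernelMoment μ X H (4 + δ) ^ 4 * betaMax β 4 m ^ (δ / (4 + δ)) with he
  refine (enorm_variance_close_sum_le (m := m) (a := 2 * kernelMoment μ X H 4 ^ 4) (b := 8 * e)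
    (S.memLp_gammaPart hi ha _) ?_ ?_ ?_).trans ?_
  · intro k l h
    exact if_neg fun h' => h h'.2.2
  · intro k l k' l' _ _
    unfold gammaPart
    split_ifs with h h'
    · have n1 := ne_of_lt_edist (hi k h.1)
      have n2 := ne_of_lt_edist (ha l h.2.1)
      have n3 := ne_of_lt_edist (hi k' h'.1)
      have n4 := ne_of_lt_edist (ha l' h'.2.1)
      have := enorm_covariance_le_two_mul (S.memLp_gammaRV n1 n2) (S.memLp_gammaRV n3 n4)
        (a := kernelMoment μ X H 4 ^ 2) (b := kernelMoment μ X H 4 ^ 2)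
        (by have := S.eLpNorm_gammaRV_le n1 n2 (r := 2) (by norm_num); norm_num at this; exact this)
        (by have := S.eLpNorm_gammaRV_le n3 n4 (r := 2) (by norm_num); norm_num at this; exact this)
      rwa [← pow_add] at this
    all_goals simp
  · intro k l k' l' _ _ hfar
    unfold gammaPart
    split_ifs with h h'
    · exact S.enorm_covariance_gammaRV_le hδ (ne_of_lt_edist (hi k h.1))
        (ne_of_lt_edist (ha l h.2.1)) (ne_of_lt_edist (hi k' h'.1))
        (ne_of_lt_edist (ha l' h'.2.1)) hfar
    all_goals simp
  · calc _ ≤ tau ι m [4] * (2 * kernelMoment μ X H 4 ^ 4) + 3 * tauHat4 ι m * (8 * e) := by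
          gcongr; exact tau_two_two_le_tauHat
      _ = 2 * (tau ι m [4] * kernelMoment μ X H 4 ^ 4) + 24 * (tauHat4 ι m *
          kernelMoment μ X H (4 + δ) ^ 4 * betaMax β 4 m ^ (δ / (4 + δ))) := by rw [he]; ring
      _ ≤ 6 ^ 2 * (tau ι m [4] * kernelMoment μ X H 4 ^ 4) + 6 ^ 2 * (tauHat4 ι m *
          kernelMoment μ X H (4 + δ) ^ 4 * betaMax β 4 m ^ (δ / (4 + δ))) := by
          gcongr <;> norm_num
      _ ≤ _ := by
          rw [← mul_add, boundGamma]
          exact mul_le_mul_right le_self_add _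

/-- For far k and l degeneracy makes centring unnecessary, and second moments are bounded directly.
Only here does profile (2, 2) have a leading term, Γ_{m,2}²; its mixing error is again moved to τ̂₄.
-/
lemma enorm_integral_gammaPart_mul_le (S : IsMixingKernel μ X H β) (hδ : 0 < δ)
    (hi : ∀ j ∈ J, ENNReal.ofReal m < edist i j) (ha : ∀ j ∈ J, ENNReal.ofReal m < edist a j)
    (hia : edist i a ≤ ENNReal.ofReal m) :
    ∑ k : Fin 4 → ι, ‖∫ ω, gammaPart μ X H i a J (fun k l => ENNReal.ofReal m < edist k l)
        (k 0) (k 1) ω * gammaPart μ X H i a J (fun k l => ENNReal.ofReal m < edist k l)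
        (k 2) (k 3) ω ∂μ‖ₑ ≤ 6 ^ 2 * boundGamma μ X H β m δ := by
  set e := kernelMoment μ X H (4 + δ) ^ 4 * betaMax β 4 m ^ (δ / (4 + δ)) with he
  have red : ∀ (B : ℝ≥0∞) (k : Fin 4 → ι),
      ((∀ j, k j ∈ J) → ENNReal.ofReal m < edist (k 0) (k 1) →
        ENNReal.ofReal m < edist (k 2) (k 3) →
        ‖∫ ω, gammaRV μ X H i a (k 0) (k 1) ω * gammaRV μ X H i a (k 2) (k 3) ω ∂μ‖ₑ ≤ B) →
      ‖∫ ω, gammaPart μ X H i a J (fun k l => ENNReal.ofReal m < edist k l)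
        (k 0) (k 1) ω * gammaPart μ X H i a J (fun k l => ENNReal.ofReal m < edist k l)
        (k 2) (k 3) ω ∂μ‖ₑ ≤ B := by
    intro B k hB
    unfold gammaPart
    split_ifs with h h'
    · refine hB (fun j => ?_) h.2.2 h'.2.2
      rcases (by decide : ∀ a : Fin 4, a = 0 ∨ a = 1 ∨ a = 2 ∨ a = 3) j with rfl | rfl | rfl | rfl
      exacts [h.1, h.2.1, h'.1, h'.2.1]
    all_goals simp
  refine (sum_le_tau_four (m := m) (a := kernelMoment μ X H 4 ^ 4)
    (b := gammaMoment μ X H m 2 ^ 2 + 8 * e) (c := 8 * e) ?_ ?_ ?_).trans ?_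
  · refine fun k _ => red _ k fun hJ _ _ => ?_
    have n1 := fun j => ne_of_lt_edist (hi _ (hJ j))
    have n2 := fun j => ne_of_lt_edist (ha _ (hJ j))
    exact S.enorm_integral_gamma_mul_le (n1 _) (n2 _) (n1 _) (n2 _)
  · refine fun k _ => red _ k fun hJ h h' => ?_
    have n1 := fun j => ne_of_lt_edist (hi _ (hJ j))
    have n2 := fun j => ne_of_lt_edist (ha _ (hJ j))
    exact S.enorm_integral_gamma_mul_le_of_far hδ (n1 _) (n2 _) (n1 _) (n2 _) hia h h'
  · refine fun k hk => red _ k fun hJ _ _ => ?_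
    have n1 := fun j => ne_of_lt_edist (hi _ (hJ j))
    have n2 := fun j => ne_of_lt_edist (ha _ (hJ j))
    obtain ⟨b, hb⟩ := exists_isolated hk
    rcases (by decide : ∀ a : Fin 4, a = 0 ∨ a = 1 ∨ a = 2 ∨ a = 3) b with rfl | rfl | rfl | rfl
    · exact S.enorm_integral_gamma_mul_le_of_isolated hδ (n1 _) (n2 _) (n1 _) (n2 _)
        (hb 1 (by decide)) (hb 2 (by decide)) (hb 3 (by decide))
    -- The lemma wants the isolated node as first argument of the first factor; swapping arguments
    -- and factors covers the other three positions.
    · rw [gammaRV_swap i a (k 0)]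
      exact S.enorm_integral_gamma_mul_le_of_isolated hδ (n2 _) (n1 _) (n1 _) (n2 _)
        (hb 0 (by decide)) (hb 2 (by decide)) (hb 3 (by decide))
    · simp only [mul_comm (gammaRV μ X H i a (k 0) (k 1) _)]
      exact S.enorm_integral_gamma_mul_le_of_isolated hδ (n1 _) (n2 _) (n1 _) (n2 _)
        (hb 3 (by decide)) (hb 0 (by decide)) (hb 1 (by decide))
    · simp only [mul_comm (gammaRV μ X H i a (k 0) (k 1) _)]
      rw [gammaRV_swap i a (k 2)]
      exact S.enorm_integral_gamma_mul_le_of_isolated hδ (n2 _) (n1 _) (n1 _) (n2 _)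
        (hb 2 (by decide)) (hb 0 (by decide)) (hb 1 (by decide))
  · calc _ = tau ι m [4] * kernelMoment μ X H 4 ^ 4 + tau ι m [2, 2] * (8 * e) +
          tauHat4 ι m * (8 * e) + tau ι m [2, 2] * gammaMoment μ X H m 2 ^ 2 := by ring
      _ ≤ tau ι m [4] * kernelMoment μ X H 4 ^ 4 + 3 * tauHat4 ι m * (8 * e) +
          tauHat4 ι m * (8 * e) + tau ι m [2, 2] * gammaMoment μ X H m 2 ^ 2 := by
          gcongr; exact tau_two_two_le_tauHat
      _ = 1 * (tau ι m [4] * kernelMoment μ X H 4 ^ 4) + 32 * (tauHat4 ι m *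
          kernelMoment μ X H (4 + δ) ^ 4 * betaMax β 4 m ^ (δ / (4 + δ))) +
          1 * (tau ι m [2, 2] * gammaMoment μ X H m 2 ^ 2) := by rw [he]; ring
      _ ≤ 6 ^ 2 * (tau ι m [4] * kernelMoment μ X H 4 ^ 4) + 6 ^ 2 * (tauHat4 ι m *
          kernelMoment μ X H (4 + δ) ^ 4 * betaMax β 4 m ^ (δ / (4 + δ))) +
          6 ^ 2 * (tau ι m [2, 2] * gammaMoment μ X H m 2 ^ 2) := by
          gcongr <;> norm_num
      _ = _ := by rw [boundGamma]; ring

/-- Sums of `Γ^{i,a}(X_k, X_l)` are close to a constant. -/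
lemma exists_eLpNorm_sum_gamma_sub_le (S : IsMixingKernel μ X H β) (hδ : 0 < δ)
    (hi : ∀ j ∈ J, ENNReal.ofReal m < edist i j) (ha : ∀ j ∈ J, ENNReal.ofReal m < edist a j)
    (hia : edist i a ≤ ENNReal.ofReal m) :
    ∃ c : ℝ, eLpNorm (fun ω => ∑ k ∈ J, ∑ l ∈ J, gammaRV μ X H i a k l ω - c) 2 μ ≤
      12 * boundGamma μ X H β m δ ^ (1 / 2 : ℝ) := by
  set N : Ω → ℝ := fun ω => ∑ k, ∑ l, gammaPart μ X H i a J
      (fun k l => edist k l ≤ ENNReal.ofReal m) k l ω with hN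
  set F : Ω → ℝ := fun ω => ∑ k, ∑ l, gammaPart μ X H i a J
      (fun k l => ENNReal.ofReal m < edist k l) k l ω with hF
  have hsum : ∀ ω, ∑ k ∈ J, ∑ l ∈ J, gammaRV μ X H i a k l ω = N ω + F ω := by
    intro ω
    simp only [hN, hF, ← Finset.sum_add_distrib]
    rw [← Finset.sum_subset (Finset.subset_univ J)]
    · refine Finset.sum_congr rfl fun k hk => ?_
      rw [← Finset.sum_subset (Finset.subset_univ J)]
      · refine Finset.sum_congr rfl fun l hl => ?_
        unfold gammaPart
        by_cases h : edist k l ≤ ENNReal.ofReal m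
        · simp [hk, hl, h, not_lt.2 h]
        · simp [hk, hl, h, not_le.1 h]
      · intro l _ hl; simp [gammaPart, hl]
    · intro k _ hk; simp [gammaPart, hk]
  have mem : ∀ p : ι → ι → Prop, MemLp (fun ω => ∑ k, ∑ l, gammaPart μ X H i a J p k l ω) 2 μ :=
    fun p => memLp_finsetSum _ fun k _ => memLp_finsetSum _ fun l _ => S.memLp_gammaPart hi ha p k l
  have hNL : MemLp N 2 μ := mem _
  have hFL : MemLp F 2 μ := mem _
  -- The constant is the mean of the near part alone; the far part is small without centring.
  refine ⟨∫ ω, N ω ∂μ, ?_⟩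
  have b1 : eLpNorm (fun ω => N ω - ∫ ω', N ω' ∂μ) 2 μ ≤
      6 * boundGamma μ X H β m δ ^ (1 / 2 : ℝ) := by
    refine ENNReal.le_mul_sqrt_of_sq_le ?_
    rw [eLpNorm_sub_integral_sq hNL]
    exact S.enorm_variance_gamma_near_le hδ hi ha
  have b2 : eLpNorm F 2 μ ≤ 6 * boundGamma μ X H β m δ ^ (1 / 2 : ℝ) := by
    refine ENNReal.le_mul_sqrt_of_sq_le ?_
    have h := eLpNorm_pow_eq_enorm_integral (q := 2) (by decide) (by norm_num) hFL.integrable_sq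
    rw [Nat.cast_ofNat] at h
    rw [h]
    have hint : ∀ k : Fin 4 → ι, Integrable (fun ω =>
        gammaPart μ X H i a J (fun k l => ENNReal.ofReal m < edist k l) (k 0) (k 1) ω *
        gammaPart μ X H i a J (fun k l => ENNReal.ofReal m < edist k l) (k 2) (k 3) ω) μ :=
      fun k => (S.memLp_gammaPart hi ha _ _ _).integrable_mul (S.memLp_gammaPart hi ha _ _ _)
    have hsq : ∀ ω, F ω ^ 2 = ∑ k : Fin 4 → ι,
        gammaPart μ X H i a J (fun k l => ENNReal.ofReal m < edist k l) (k 0) (k 1) ω *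
        gammaPart μ X H i a J (fun k l => ENNReal.ofReal m < edist k l) (k 2) (k 3) ω := by
      intro ω
      exact sq_sum_sum_eq fun k l =>
        gammaPart μ X H i a J (fun k l => ENNReal.ofReal m < edist k l) k l ω
    simp only [hsq]
    rw [integral_finsetSum _ fun k _ => hint k]
    exact (enorm_sum_le _ _).trans (S.enorm_integral_gammaPart_mul_le hδ hi ha hia)
  have e : (fun ω => ∑ k ∈ J, ∑ l ∈ J, gammaRV μ X H i a k l ω - ∫ ω, N ω ∂μ) =
      (fun ω => N ω - ∫ ω', N ω' ∂μ) + F := by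
    ext ω; rw [hsum, Pi.add_apply]; ring
  rw [e]
  refine (eLpNorm_add_le (hNL.sub (memLp_const _)).1 hFL.1 one_le_two).trans ?_
  refine (add_le_add b1 b2).trans (le_of_eq ?_)
  rw [← add_mul]; norm_num

end IsMixingKernel

end GammaSum

/-! ### Taylor expansion of Stein solutions and integral Hölder bounds -/

namespace IsSteinFun

variable {f f' : ℝ → ℝ}

lemma measurable (hf : IsSteinFun f f') : Measurable f :=
  (continuous_iff_continuousAt.2 fun x => (hf.hasDerivAt x).continuousAt).measurable

lemma measurable_deriv (hf : IsSteinFun f f') : Measurable f' := by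
  have : LipschitzWith 8 f' := LipschitzWith.of_dist_le_mul fun x y => by
    simpa [Real.dist_eq] using hf.abs_deriv_sub_le x y
  exact this.continuous.measurable

/-- Mean value inequality for z ↦ f z - f'(x) z. The derivative is taken at x, later the full far
sum, so that one and the same f'(tF) appears for every node. -/
lemma abs_taylor_le (hf : IsSteinFun f f') (x y : ℝ) :
    |f x - f y - f' x * (x - y)| ≤ 8 * (x - y) ^ 2 := by
  have h := (convex_uIcc x y).norm_image_sub_le_of_norm_hasDerivWithin_le
    (f := fun z => f z - f' x * z) (f' := fun z => f' z - f' x * 1) (C := 8 * |x - y|)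
    (fun z _ => ((hf.hasDerivAt z).sub ((hasDerivAt_id z).const_mul _)).hasDerivWithinAt)
    (fun z hz => by
      rw [mul_one, Real.norm_eq_abs]
      refine (hf.abs_deriv_sub_le z x).trans ?_
      rw [abs_sub_comm x y]
      exact mul_le_mul_of_nonneg_left (Set.abs_sub_left_of_mem_uIcc hz) (by norm_num))
    Set.right_mem_uIcc Set.left_mem_uIcc
  rw [Real.norm_eq_abs, Real.norm_eq_abs, mul_assoc, abs_mul_abs_self, ← sq] at h
  refine le_trans (le_of_eq ?_) h
  congr 1; ring

end IsSteinFun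

section Holder

variable {Ω : Type u} [MeasurableSpace Ω] {μ : Measure Ω}

lemma lintegral_enorm_mul_le {f g : Ω → ℝ} (hf : AEStronglyMeasurable f μ)
    (hg : AEStronglyMeasurable g μ) :
    ∫⁻ ω, ‖f ω * g ω‖ₑ ∂μ ≤ eLpNorm f 2 μ * eLpNorm g 2 μ := by
  have := eLpNorm_mul_le_of_le (r := 1) one_pos hf hg (a := eLpNorm f 2 μ) (b := eLpNorm g 2 μ)
    (by simp) (by simp)
  rwa [ENNReal.ofReal_one, eLpNorm_one_eq_lintegral_enorm] at this

lemma lintegral_enorm_mul_mul_le {f g h : Ω → ℝ} (hf : AEStronglyMeasurable f μ)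
    (hg : AEStronglyMeasurable g μ) (hh : AEStronglyMeasurable h μ) :
    ∫⁻ ω, ‖f ω * (g ω * h ω)‖ₑ ∂μ ≤ eLpNorm f 2 μ * (eLpNorm g 4 μ * eLpNorm h 4 μ) := by
  refine (lintegral_enorm_mul_le hf (hg.mul hh)).trans ?_
  gcongr
  have := eLpNorm_mul_le_of_le (r := 2) two_pos hg hh (a := eLpNorm g 4 μ) (b := eLpNorm h 4 μ)
    (by norm_num) (by norm_num)
  rwa [ENNReal.ofReal_ofNat] at this

lemma enorm_integral_mul_le_of_abs_le {Y φ : Ω → ℝ} {c : NNReal} (hc : ∀ ω, |φ ω| ≤ c) :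
    ‖∫ ω, Y ω * φ ω ∂μ‖ₑ ≤ c * ∫⁻ ω, ‖Y ω‖ₑ ∂μ := by
  refine (enorm_integral_le_lintegral_enorm _).trans ?_
  rw [← lintegral_const_mul' _ _ ENNReal.coe_ne_top]
  refine lintegral_mono fun ω => ?_
  rw [enorm_mul, mul_comm]
  gcongr
  rw [Real.enorm_eq_ofReal_abs]
  exact ENNReal.ofReal_le_of_le_toReal (by simpa using hc ω)

end Holder

/-! ### Removing a set of nodes from the sum over far pairs -/

section Decomposition

open scoped Classical

variable {Ω : Type u} [MeasurableSpace Ω] {μ : Measure Ω} [IsProbabilityMeasure μ]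
  {ι : Type v} [EMetricSpace ι] [Fintype ι] {E : Type*} [MeasurableSpace E]
  {X : ι → Ω → E} {H : E → E → ℝ} {β : ℕ∞ → ℕ∞ → ℝ → ℝ≥0∞} {m δ : ℝ}

/-- The indicator of the pairs of nodes at distance more than `m`. -/
noncomputable def farIndicator (m : ℝ) (i k : ι) : ℝ :=
  if ENNReal.ofReal m < edist i k then 1 else 0

/-- The sum of `H(X_i, X_k)` over the far pairs of nodes in `J`. -/
noncomputable def farSum (X : ι → Ω → E) (H : E → E → ℝ) (m : ℝ) (J : Finset ι) (ω : Ω) : ℝ :=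
  ∑ i ∈ J, ∑ k ∈ J, farIndicator m i k * kernelRV X H i k ω

/-- The weights with which the summands of `a ∈ B` enter into the part of the sum over far pairs
that involves nodes in `B`. -/
noncomputable def crossWeight (m : ℝ) (B : Finset ι) (a k : ι) : ℝ :=
  farIndicator m a k * if k ∈ B then 1 else 2

lemma farIndicator_eq_one {i k : ι} (h : ENNReal.ofReal m < edist i k) :
    farIndicator m i k = 1 := if_pos h

lemma farIndicator_eq_zero {i k : ι} (h : edist i k ≤ ENNReal.ofReal m) :
    farIndicator m i k = 0 := if_neg (not_lt.2 h)

lemma farIndicator_comm (i k : ι) : farIndicator m i k = farIndicator m k i := by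
  simp only [farIndicator, edist_comm]

lemma isFarWeight_farIndicator (i : ι) : IsFarWeight m i (farIndicator m i) where
  abs_le k := by unfold farIndicator; split_ifs <;> norm_num
  far k h := by
    by_contra h'
    exact h (farIndicator_eq_zero (not_lt.1 h'))

lemma isFarWeight_crossWeight (B : Finset ι) (a : ι) : IsFarWeight m a (crossWeight m B a) where
  abs_le k := by unfold crossWeight farIndicator; split_ifs <;> norm_num
  far k h := (isFarWeight_farIndicator a).far k (left_ne_zero_of_mul h)

lemma isFarWeight_indicator {J : Finset ι} {a : ι} (hJ : ∀ j ∈ J, ENNReal.ofReal m < edist a j) :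
    IsFarWeight m a (fun k => if k ∈ J then 1 else 0) where
  abs_le k := by split_ifs <;> norm_num
  far k h := hJ k (by by_contra h'; simp [h'] at h)

lemma wsum_indicator (J : Finset ι) (i : ι) (ω : Ω) :
    wsum X H i (fun k => if k ∈ J then 1 else 0) ω = ∑ k ∈ J, kernelRV X H i k ω := by
  simp [wsum, ite_mul]

lemma wsum_add (i : ι) (w w' : ι → ℝ) (ω : Ω) :
    wsum X H i (w + w') ω = wsum X H i w ω + wsum X H i w' ω := by
  simp only [wsum, Pi.add_apply, add_mul, Finset.sum_add_distrib]

lemma farSum_univ (ω : Ω) :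
    farSum X H m Finset.univ ω = ∑ i, wsum X H i (farIndicator m i) ω := rfl

namespace IsMixingKernel

/-- The removed ordered pairs have at least one end in B. A pair with both ends in B occurs once for
each choice of first end; a pair with one end outside occurs in both orders, hence weight 2 after
symmetrisation. -/
lemma farSum_univ_sub (S : IsMixingKernel μ X H β) (B : Finset ι) (ω : Ω) :
    farSum X H m Finset.univ ω - farSum X H m Bᶜ ω = ∑ a ∈ B, wsum X H a (crossWeight m B a) ω := by
  set f : ι → ι → ℝ := fun i k => farIndicator m i k * kernelRV X H i k ω with hf
  have hsymm : ∀ i k, f i k = f k i := fun i k => by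
    simp only [hf]; rw [farIndicator_comm, S.kernelRV_comm]
  have h1 : ∀ a, wsum X H a (crossWeight m B a) ω = ∑ k, f a k + ∑ k ∈ Bᶜ, f a k := by
    intro a
    rw [wsum, ← Finset.sum_add_sum_compl B, ← Finset.sum_add_sum_compl B (f a), add_assoc,
      ← Finset.sum_add_distrib]
    congr 1
    · refine Finset.sum_congr rfl fun k hk => ?_
      simp [crossWeight, hk, hf]
    · refine Finset.sum_congr rfl fun k hk => ?_
      have hk' := Finset.mem_compl.1 hk
      simp only [crossWeight, hk', hf, if_false]; ring
  have h2 : ∑ a ∈ B, ∑ k ∈ Bᶜ, f a k = ∑ i ∈ Bᶜ, ∑ k ∈ B, f i k := by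
    rw [Finset.sum_comm]
    exact Finset.sum_congr rfl fun i _ => Finset.sum_congr rfl fun k _ => hsymm _ _
  have h3 : farSum X H m Finset.univ ω = ∑ i ∈ B, ∑ k, f i k +
      ∑ i ∈ Bᶜ, (∑ k ∈ B, f i k + ∑ k ∈ Bᶜ, f i k) := by
    simp only [Finset.sum_add_sum_compl]; rfl
  simp only [h1]
  rw [h3, Finset.sum_add_distrib, Finset.sum_add_distrib, h2]
  simp only [farSum, hf]
  ring

lemma measurable_farSum_sigmaOf (S : IsMixingKernel μ X H β) (J : Finset ι) :
    Measurable[sigmaOf X (J : Set ι)] (farSum X H m J) :=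
  Finset.measurable_sum _ fun _ hi => Finset.measurable_sum _ fun _ hk =>
    (S.measurable_kernelRV_sigmaOf hi hk).const_mul _

lemma measurable_farSum (S : IsMixingKernel μ X H β) (J : Finset ι) :
    Measurable (farSum X H m J) :=
  (S.measurable_farSum_sigmaOf J).mono (sigmaOf_le S.measurable_sample _) le_rfl

lemma memLp_farSum (S : IsMixingKernel μ X H β) (J : Finset ι) :
    MemLp (farSum X H m J) 4 μ := by
  refine memLp_finsetSum _ fun i _ => memLp_finsetSum _ fun k _ => ?_
  by_cases h : ENNReal.ofReal m < edist i k
  · exact (S.memLp_kernelRV (ne_of_lt_edist h)).const_mul _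
  · simp [farIndicator_eq_zero (not_lt.1 h)]

/-- The bound on the `L²` norm of weighted sums. -/
noncomputable def normTwo (μ : Measure Ω) (X : ι → Ω → E) (H : E → E → ℝ)
    (β : ℕ∞ → ℕ∞ → ℝ → ℝ≥0∞) (m δ : ℝ) : ℝ≥0∞ := (32 * boundTwo μ X H β m δ) ^ (1 / 2 : ℝ)

/-- The bound on the `L⁴` norm of weighted sums. -/
noncomputable def normFour (μ : Measure Ω) (X : ι → Ω → E) (H : E → E → ℝ)
    (β : ℕ∞ → ℕ∞ → ℝ → ℝ≥0∞) (m δ : ℝ) : ℝ≥0∞ := (128 * boundFour μ X H β m δ) ^ (1 / 4 : ℝ)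

lemma normTwo_mul_normFour_mul_normFour :
    normTwo μ X H β m δ * (normFour μ X H β m δ * normFour μ X H β m δ) =
      64 * (boundFour μ X H β m δ ^ (1 / 2 : ℝ) * boundTwo μ X H β m δ ^ (1 / 2 : ℝ)) := by
  have h : (32 : ℝ≥0∞) ^ (1 / 2 : ℝ) * 128 ^ (1 / 2 : ℝ) = 64 := by
    rw [← ENNReal.mul_rpow_of_nonneg _ _ (by norm_num),
      show (32 * 128 : ℝ≥0∞) = 64 ^ (2 : ℝ) by norm_num, ← ENNReal.rpow_mul]
    norm_num
  rw [normTwo, normFour, ← ENNReal.rpow_add_of_nonneg _ _ (by norm_num) (by norm_num),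
    ENNReal.mul_rpow_of_nonneg _ _ (by norm_num), ENNReal.mul_rpow_of_nonneg _ _ (by norm_num), ← h]
  norm_num
  ring

variable {i a : ι} {w : ι → ℝ}

lemma eLpNorm_wsum_two_le (S : IsMixingKernel μ X H β) (hδ : 0 < δ) (hw : IsFarWeight m i w) :
    eLpNorm (wsum X H i w) 2 μ ≤ normTwo μ X H β m δ := by
  have := ENNReal.rpow_le_rpow (S.eLpNorm_wsum_two_sq_le hδ hw) (z := 1 / 2) (by norm_num)
  rwa [← ENNReal.rpow_natCast, ← ENNReal.rpow_mul, Nat.cast_ofNat, mul_one_div_cancel two_ne_zero,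
    ENNReal.rpow_one] at this

lemma eLpNorm_wsum_four_le (S : IsMixingKernel μ X H β) (hδ : 0 < δ) (hw : IsFarWeight m i w) :
    eLpNorm (wsum X H i w) 4 μ ≤ normFour μ X H β m δ := by
  have := ENNReal.rpow_le_rpow (S.eLpNorm_wsum_four_pow_le hδ hw) (z := 1 / 4) (by norm_num)
  rwa [← ENNReal.rpow_natCast, ← ENNReal.rpow_mul, Nat.cast_ofNat, mul_one_div_cancel four_ne_zero,
    ENNReal.rpow_one] at this

/-- The triangle inequality over the nodes of B is enough here, since cancellation within each
weighted sum is already in the L⁴ bound. -/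
lemma eLpNorm_farSum_sub_le (S : IsMixingKernel μ X H β) (hδ : 0 < δ) (t : ℝ) (B : Finset ι) :
    eLpNorm (fun ω => t * farSum X H m Finset.univ ω - t * farSum X H m Bᶜ ω) 4 μ ≤
      ‖t‖ₑ * (B.card * normFour μ X H β m δ) := by
  have e : (fun ω => t * farSum X H m Finset.univ ω - t * farSum X H m Bᶜ ω) =
      t • ∑ a ∈ B, wsum X H a (crossWeight m B a) := by
    ext ω
    rw [← mul_sub, S.farSum_univ_sub, Pi.smul_apply, Finset.sum_apply, smul_eq_mul]
  rw [e, eLpNorm_const_smul]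
  gcongr
  refine (eLpNorm_sum_le (fun a _ => (S.measurable_wsum a _).aestronglyMeasurable)
    (by norm_num)).trans ?_
  refine (Finset.sum_le_card_nsmul _ _ _ fun a _ =>
    S.eLpNorm_wsum_four_le hδ (isFarWeight_crossWeight B a)).trans ?_
  rw [nsmul_eq_mul]

/-- For weights carried by few nodes no cancellation is needed; this handles what is lost on
restricting sums to nodes far from two given ones. -/
lemma eLpNorm_wsum_le_of_support (S : IsMixingKernel μ X H β) (hw : IsFarWeight m i w)
    {B : Finset ι} (hB : ∀ k, w k ≠ 0 → k ∈ B) :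
    eLpNorm (wsum X H i w) 2 μ ≤ 2 * (B.card * kernelMoment μ X H 2) := by
  have e : wsum X H i w = ∑ k ∈ B, fun ω => w k * kernelRV X H i k ω := by
    ext ω
    rw [wsum, Finset.sum_apply]
    refine (Finset.sum_subset (Finset.subset_univ B) fun k _ hk => ?_).symm
    rw [not_not.1 fun h => hk (hB k h), zero_mul]
  rw [e]
  refine (eLpNorm_sum_le (fun k _ => ((S.measurable_kernelRV i k).const_mul _).aestronglyMeasurable)
    (by norm_num)).trans ?_
  refine (Finset.sum_le_card_nsmul _ _ (2 * kernelMoment μ X H 2) fun k _ => ?_).trans ?_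
  · by_cases h : w k = 0
    · simp [h]
    · have h1 := eLpNorm_const_smul (w k) (kernelRV X H i k) 2 μ
      refine h1.le.trans ?_
      have h2 := eLpNorm_kernelRV_le (μ := μ) (X := X) (H := H) (ne_of_lt_edist (hw.far k h)) 2
      rw [ENNReal.ofReal_ofNat] at h2
      exact mul_le_mul' (hw.enorm_le k) h2
  · rw [nsmul_eq_mul]; exact le_of_eq (by ring)

/-- The remainder of a first order expansion. -/
lemma enorm_integral_taylor_le (S : IsMixingKernel μ X H β) (hδ : 0 < δ) {f f' : ℝ → ℝ}
    (hf : IsSteinFun f f') (t : ℝ) (B : Finset ι) (hw : IsFarWeight m i w) :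
    ‖∫ ω, wsum X H i w ω * (f (t * farSum X H m Finset.univ ω) - f (t * farSum X H m Bᶜ ω) -
      f' (t * farSum X H m Finset.univ ω) *
        (t * farSum X H m Finset.univ ω - t * farSum X H m Bᶜ ω)) ∂μ‖ₑ ≤
      8 * ‖t‖ₑ ^ 2 * (B.card : ℝ≥0∞) ^ 2 * (normTwo μ X H β m δ *
        (normFour μ X H β m δ * normFour μ X H β m δ)) := by
  have hD : Measurable (fun ω => t * farSum X H m Finset.univ ω - t * farSum X H m Bᶜ ω) :=
    ((S.measurable_farSum _).const_mul _).sub ((S.measurable_farSum _).const_mul _)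
  have hl := lintegral_enorm_mul_mul_le (μ := μ) (S.measurable_wsum i w).aestronglyMeasurable
    hD.aestronglyMeasurable hD.aestronglyMeasurable
  have b4 := S.eLpNorm_farSum_sub_le (m := m) hδ t B
  refine (enorm_integral_le_lintegral_enorm _).trans ?_
  calc _ ≤ ∫⁻ ω, 8 * ‖wsum X H i w ω *
        ((t * farSum X H m Finset.univ ω - t * farSum X H m Bᶜ ω) *
        (t * farSum X H m Finset.univ ω - t * farSum X H m Bᶜ ω))‖ₑ ∂μ := by
        refine lintegral_mono fun ω => ?_
        have h := hf.abs_taylor_le (t * farSum X H m Finset.univ ω) (t * farSum X H m Bᶜ ω)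
        rw [enorm_mul, enorm_mul, mul_left_comm]
        gcongr
        rw [show (8 : ℝ≥0∞) = ‖(8 : ℝ)‖ₑ by rw [Real.enorm_of_nonneg (by norm_num)]; simp,
          ← enorm_mul, Real.enorm_eq_ofReal_abs, Real.enorm_eq_ofReal_abs]
        refine ENNReal.ofReal_le_ofReal (h.trans ?_)
        rw [← sq]
        exact le_abs_self _
    _ = 8 * ∫⁻ ω, ‖wsum X H i w ω *
        ((t * farSum X H m Finset.univ ω - t * farSum X H m Bᶜ ω) *
        (t * farSum X H m Finset.univ ω - t * farSum X H m Bᶜ ω))‖ₑ ∂μ :=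
        lintegral_const_mul' _ _ (by norm_num)
    _ ≤ 8 * (normTwo μ X H β m δ * (‖t‖ₑ * (B.card * normFour μ X H β m δ) *
        (‖t‖ₑ * (B.card * normFour μ X H β m δ)))) := by
        gcongr
        refine hl.trans ?_
        gcongr
        exact S.eLpNorm_wsum_two_le hδ hw
    _ = _ := by ring

end IsMixingKernel

end Decomposition

/-! ### Products of two weighted sums against a centred function of the far sum -/

section PairBound

open scoped Classical

variable {Ω : Type u} [MeasurableSpace Ω] {μ : Measure Ω} [IsProbabilityMeasure μ]
  {ι : Type v} [EMetricSpace ι] [Fintype ι] {E : Type*} [MeasurableSpace E]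
  {X : ι → Ω → E} {H : E → E → ℝ} {β : ℕ∞ → ℕ∞ → ℝ → ℝ≥0∞} {m δ : ℝ}

namespace IsMixingKernel

variable {i a : ι}

/-- ψ ignores the nodes near i, so X_i is isolated in every summand. Used with ψ = f(tG_i) in
Stein's argument and with ψ = 1 for the mean of the far sum. -/
lemma enorm_integral_wsum_mul_bounded_le (S : IsMixingKernel μ X H β) (hδ : 0 < δ) {ψ : Ω → ℝ}
    (hψ : Measurable[sigmaOf X (((nbhd m i)ᶜ : Finset ι) : Set ι)] ψ) {c : NNReal}
    (hc : ∀ ω, |ψ ω| ≤ c) :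
    ‖∫ ω, wsum X H i (farIndicator m i) ω * ψ ω ∂μ‖ₑ ≤ 8 * c * (Fintype.card ι *
      (kernelMoment μ X H (1 + δ) * β 1 ⊤ m ^ (δ / (1 + δ)))) := by
  have hψ' : Measurable ψ := hψ.mono (sigmaOf_le S.measurable_sample _) le_rfl
  have hint : ∀ k, Integrable (fun ω => farIndicator m i k * kernelRV X H i k ω * ψ ω) μ := by
    intro k
    by_cases h : ENNReal.ofReal m < edist i k
    · exact (((S.memLp_kernelRV (ne_of_lt_edist h)).integrable (by norm_num)).const_mul _).mul_bdd
        hψ'.aestronglyMeasurable (Filter.Eventually.of_forall fun ω => hc ω)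
    · simp [farIndicator_eq_zero (not_lt.1 h)]
  simp only [wsum, Finset.sum_mul]
  rw [integral_finsetSum _ fun k _ => hint k]
  refine (enorm_sum_le _ _).trans ((Finset.sum_le_card_nsmul _ _
    (8 * c * (kernelMoment μ X H (1 + δ) * β 1 ⊤ m ^ (δ / (1 + δ)))) fun k _ => ?_).trans_eq ?_)
  · by_cases h : ENNReal.ofReal m < edist i k
    · simp only [farIndicator_eq_one h, one_mul]
      exact S.enorm_integral_mul_bounded_le hδ (J := (((nbhd m i)ᶜ : Finset ι) : Set ι))
        (by simpa [mem_nbhd] using h) (fun j hj => by simpa [mem_nbhd] using hj) hψ hc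
    · simp [farIndicator_eq_zero (not_lt.1 h)]
  · rw [nsmul_eq_mul, Finset.card_univ]; ring

/-- Decoupling (X_i, X_a) from J turns the product into a double sum of Γ's. That sum is close in L²
to a constant, which drops out because ψ has mean zero. -/
lemma enorm_integral_sum_mul_sum_mul_le (S : IsMixingKernel μ X H β) (hδ : 0 < δ) {J : Finset ι}
    (hi : ∀ j ∈ J, ENNReal.ofReal m < edist i j) (ha : ∀ j ∈ J, ENNReal.ofReal m < edist a j)
    (hia : edist i a ≤ ENNReal.ofReal m) {ψ : Ω → ℝ} (hψ : Measurable[sigmaOf X (J : Set ι)] ψ)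
    {c : NNReal} (hc : ∀ ω, |ψ ω| ≤ c) (h0 : ∫ ω, ψ ω ∂μ = 0) :
    ‖∫ ω, (∑ k ∈ J, kernelRV X H i k ω) * (∑ l ∈ J, kernelRV X H a l ω) * ψ ω ∂μ‖ₑ ≤
      c * (8 * ((Fintype.card ι : ℝ≥0∞) ^ 2 *
        (kernelMoment μ X H (2 + δ) ^ 2 * β 2 ⊤ m ^ (δ / (2 + δ)))) +
        12 * boundGamma μ X H β m δ ^ (1 / 2 : ℝ)) := by
  set q := kernelMoment μ X H (2 + δ) ^ 2 * β 2 ⊤ m ^ (δ / (2 + δ))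
  have hψ' : Measurable ψ := hψ.mono (sigmaOf_le S.measurable_sample _) le_rfl
  have hb : ∀ᵐ ω ∂μ, ‖ψ ω‖ ≤ c := Filter.Eventually.of_forall fun ω => hc ω
  have i1 : ∀ k ∈ J, ∀ l ∈ J,
      Integrable (fun ω => kernelRV X H i k ω * kernelRV X H a l ω * ψ ω) μ := fun k hk l hl =>
    (integrable_mul_of_memLp (S.memLp_kernelRV (ne_of_lt_edist (hi k hk)))
      (S.memLp_kernelRV (ne_of_lt_edist (ha l hl)))).mul_bdd hψ'.aestronglyMeasurable hb
  have m2 : ∀ k ∈ J, ∀ l ∈ J, MemLp (gammaRV μ X H i a k l) 2 μ := fun k hk l hl =>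
    S.memLp_gammaRV (ne_of_lt_edist (hi k hk)) (ne_of_lt_edist (ha l hl))
  have i2 : ∀ k ∈ J, ∀ l ∈ J, Integrable (fun ω => gammaRV μ X H i a k l ω * ψ ω) μ :=
    fun k hk l hl => ((m2 k hk l hl).integrable one_le_two).mul_bdd hψ'.aestronglyMeasurable hb
  obtain ⟨c₀, hc₀⟩ := S.exists_eLpNorm_sum_gamma_sub_le hδ hi ha hia
  have e1 : ∫ ω, (∑ k ∈ J, kernelRV X H i k ω) * (∑ l ∈ J, kernelRV X H a l ω) * ψ ω ∂μ =
      ∑ k ∈ J, ∑ l ∈ J, ∫ ω, kernelRV X H i k ω * kernelRV X H a l ω * ψ ω ∂μ := by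
    simp_rw [Finset.sum_mul_sum, Finset.sum_mul]
    rw [integral_finsetSum _ fun k hk => integrable_finsetSum _ fun l hl => i1 k hk l hl]
    exact Finset.sum_congr rfl fun k hk => integral_finsetSum _ fun l hl => i1 k hk l hl
  have e2 : ∫ ω, (∑ k ∈ J, ∑ l ∈ J, gammaRV μ X H i a k l ω - c₀) * ψ ω ∂μ =
      ∑ k ∈ J, ∑ l ∈ J, ∫ ω, gammaRV μ X H i a k l ω * ψ ω ∂μ := by
    simp only [sub_mul, Finset.sum_mul]
    rw [integral_sub (integrable_finsetSum _ fun k hk => integrable_finsetSum _ fun l hl =>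
      i2 k hk l hl) ((Integrable.of_bound hψ'.aestronglyMeasurable c hb).const_mul _),
      integral_const_mul, h0, mul_zero, sub_zero,
      integral_finsetSum _ fun k hk => integrable_finsetSum _ fun l hl => i2 k hk l hl]
    exact Finset.sum_congr rfl fun k hk => integral_finsetSum _ fun l hl => i2 k hk l hl
  have e3 : ∫ ω, (∑ k ∈ J, kernelRV X H i k ω) * (∑ l ∈ J, kernelRV X H a l ω) * ψ ω ∂μ =
      ∑ k ∈ J, ∑ l ∈ J, (∫ ω, kernelRV X H i k ω * kernelRV X H a l ω * ψ ω ∂μ -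
        ∫ ω, gammaRV μ X H i a k l ω * ψ ω ∂μ) +
      ∫ ω, (∑ k ∈ J, ∑ l ∈ J, gammaRV μ X H i a k l ω - c₀) * ψ ω ∂μ := by
    rw [e1, e2]; simp only [Finset.sum_sub_distrib]; ring
  rw [e3]
  refine (enorm_add_le _ _).trans ?_
  rw [mul_add]
  refine add_le_add ?_ ?_
  · refine (enorm_sum_le _ _).trans ?_
    calc _ ≤ ∑ k ∈ J, ∑ l ∈ J, 8 * c * q := by
          refine Finset.sum_le_sum fun k hk => (enorm_sum_le _ _).trans
            (Finset.sum_le_sum fun l hl => ?_)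
          exact S.enorm_integral_mul_sub_gamma_le hδ (J := (J : Set ι)) hi ha hk hl hψ hc
      _ ≤ ∑ k : ι, ∑ l : ι, 8 * c * q := by
          refine (Finset.sum_le_sum_of_subset (Finset.subset_univ J)).trans ?_
          exact Finset.sum_le_sum fun k _ => Finset.sum_le_sum_of_subset (Finset.subset_univ J)
      _ = _ := by simp only [Finset.sum_const, Finset.card_univ, nsmul_eq_mul]; ring
  · refine (enorm_integral_mul_le_of_abs_le hc).trans ?_
    gcongr
    rw [← eLpNorm_one_eq_lintegral_enorm]
    refine le_trans (eLpNorm_le_eLpNorm_of_exponent_le one_le_two ?_) hc₀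
    exact ((memLp_finsetSum _ fun k hk => memLp_finsetSum _ fun l hl => m2 k hk l hl).sub
      (memLp_const c₀)).1

/-- The covariance of a product of two weighted sums with a smooth function of the sum over far
pairs. -/
lemma enorm_integral_mul_sub_integral_le (S : IsMixingKernel μ X H β) (hδ : 0 < δ)
    (hia : edist i a ≤ ENNReal.ofReal m) {f f' : ℝ → ℝ} (hf : IsSteinFun f f') (t : ℝ) :
    ‖∫ ω, wsum X H i (farIndicator m i) ω * wsum X H a (crossWeight m (nbhd m i) a) ω *
      (f' (t * farSum X H m Finset.univ ω) -
        ∫ ω', f' (t * farSum X H m Finset.univ ω') ∂μ) ∂μ‖ₑ ≤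
    20 * (((nbhd m i).card + (nbhd m a).card) *
      (kernelMoment μ X H 2 * normTwo μ X H β m δ)) +
    32 * ‖t‖ₑ * (((nbhd m i).card + (nbhd m a).card) *
      (normTwo μ X H β m δ * (normFour μ X H β m δ * normFour μ X H β m δ))) +
    20 * (8 * ((Fintype.card ι : ℝ≥0∞) ^ 2 *
        (kernelMoment μ X H (2 + δ) ^ 2 * β 2 ⊤ m ^ (δ / (2 + δ)))) +
        12 * boundGamma μ X H β m δ ^ (1 / 2 : ℝ)) := by
  -- J consists of the nodes far from both i and a; only there can the pair (X_i, X_a) be decoupled.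
  set B := nbhd m i ∪ nbhd m a with hB
  set J : Finset ι := Bᶜ with hJ
  have hi : ∀ j ∈ J, ENNReal.ofReal m < edist i j := fun j hj => by
    simp only [hJ, hB, Finset.mem_compl, Finset.mem_union, mem_nbhd, not_or, not_le] at hj
    exact hj.1
  have ha : ∀ j ∈ J, ENNReal.ofReal m < edist a j := fun j hj => by
    simp only [hJ, hB, Finset.mem_compl, Finset.mem_union, mem_nbhd, not_or, not_le] at hj
    exact hj.2
  have hJ' : ∀ j, j ∉ J → j ∈ nbhd m i ∨ j ∈ nbhd m a := fun j hj => by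
    simpa only [hJ, hB, Finset.mem_compl, Finset.mem_union, not_not] using hj
  set w : ι → ℝ := fun k => if k ∈ J then 1 else 0 with hw
  have wi : IsFarWeight m i w := isFarWeight_indicator hi
  have wa : IsFarWeight m a w := isFarWeight_indicator ha
  set r : ι → ℝ := fun k => if k ∈ J then 0 else farIndicator m i k with hr
  set r' : ι → ℝ := fun k => if k ∈ J then 0 else crossWeight m (nbhd m i) a k with hr'
  have wr : IsFarWeight m i r :=
    ⟨fun k => by
      simp only [hr]; split_ifs
      · norm_num
      · exact (isFarWeight_farIndicator i).abs_le k,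
    fun k hk => (isFarWeight_farIndicator i).far k fun h => hk (by simp [hr, h])⟩
  have wr' : IsFarWeight m a r' :=
    ⟨fun k => by
      simp only [hr']; split_ifs
      · norm_num
      · exact (isFarWeight_crossWeight _ a).abs_le k,
    fun k hk => (isFarWeight_crossWeight (nbhd m i) a).far k fun h => hk (by simp [hr', h])⟩
  -- The leftover weights of i live outside J yet far from i, hence near a; symmetrically those of a
  -- live near i.
  have sr : ∀ k, r k ≠ 0 → k ∈ nbhd m a := fun k hk => by
    have h1 : k ∉ J := fun h => hk (by simp [hr, h])
    exact (hJ' k h1).resolve_left fun h => absurd (mem_nbhd.1 h) (not_le.2 (wr.far k hk))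
  have sr' : ∀ k, r' k ≠ 0 → k ∈ nbhd m i := fun k hk => by
    have h1 : k ∉ J := fun h => hk (by simp [hr', h])
    exact (hJ' k h1).resolve_right fun h => absurd (mem_nbhd.1 h) (not_le.2 (wr'.far k hk))
  set P := wsum X H i w with hP
  set Q := wsum X H a w with hQ
  set R := wsum X H i r with hR
  set R' := wsum X H a r' with hR'
  set C := wsum X H a (crossWeight m (nbhd m i) a) with hC
  have eA : ∀ ω, wsum X H i (farIndicator m i) ω = P ω + R ω := fun ω => by
    rw [hP, hR, ← wsum_add]
    congr 1
    ext k
    by_cases hk : k ∈ J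
    · simp [hw, hr, hk, farIndicator_eq_one (hi k hk)]
    · simp [hw, hr, hk]
  -- A node of J lies outside the neighbourhood of i and far from a, so its cross weight is 2.
  have eC : ∀ ω, C ω = 2 * Q ω + R' ω := fun ω => by
    rw [two_mul, hQ, ← wsum_add, hR', ← wsum_add, hC]
    congr 1
    ext k
    by_cases hk : k ∈ J
    · have : k ∉ nbhd m i := fun h => absurd (mem_nbhd.1 h) (not_le.2 (hi k hk))
      simp [hw, hr', hk, crossWeight, farIndicator_eq_one (ha k hk), this]; norm_num
    · simp [hw, hr', hk]
  set φ : Ω → ℝ := fun ω => f' (t * farSum X H m Finset.univ ω) with hφ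
  set ψ : Ω → ℝ := fun ω => f' (t * farSum X H m J ω) with hψ
  set D : Ω → ℝ := fun ω => t * farSum X H m Finset.univ ω - t * farSum X H m J ω with hD
  have mφ : Measurable φ := hf.measurable_deriv.comp ((S.measurable_farSum _).const_mul t)
  have mψJ : Measurable[sigmaOf X (J : Set ι)] ψ :=
    hf.measurable_deriv.comp ((S.measurable_farSum_sigmaOf J).const_mul t)
  have mψ : Measurable ψ := hf.measurable_deriv.comp ((S.measurable_farSum _).const_mul t)
  have mD : Measurable D :=
    ((S.measurable_farSum _).const_mul t).sub ((S.measurable_farSum _).const_mul t)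
  have bφ : ∀ ω, |φ ω| ≤ 5 := fun ω => hf.abs_deriv_le _
  have bψ : ∀ ω, |ψ ω| ≤ 5 := fun ω => hf.abs_deriv_le _
  have iφ : Integrable φ μ :=
    Integrable.of_bound mφ.aestronglyMeasurable 5 (Filter.Eventually.of_forall bφ)
  have iψ : Integrable ψ μ :=
    Integrable.of_bound mψ.aestronglyMeasurable 5 (Filter.Eventually.of_forall bψ)
  have center : ∀ g : Ω → ℝ, (∀ ω, |g ω| ≤ 5) → ∀ ω, |g ω - ∫ ω', g ω' ∂μ| ≤ (10 : NNReal) := by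
    intro g hg ω
    have h1 : |∫ ω', g ω' ∂μ| ≤ 5 := by
      have := norm_integral_le_of_norm_le_const (μ := μ) (f := g)
        (Filter.Eventually.of_forall hg)
      simpa using this
    have := abs_sub (g ω) (∫ ω', g ω' ∂μ)
    have := hg ω
    push_cast
    linarith
  set φ₀ : Ω → ℝ := fun ω => φ ω - ∫ ω', φ ω' ∂μ with hφ₀
  set ψ₀ : Ω → ℝ := fun ω => ψ ω - ∫ ω', ψ ω' ∂μ with hψ₀
  have bφ₀ : ∀ ω, |φ₀ ω| ≤ (10 : NNReal) := center φ bφ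
  have bψ₀ : ∀ ω, |ψ₀ ω| ≤ (10 : NNReal) := center ψ bψ
  have mφ₀ : Measurable φ₀ := mφ.sub_const _
  have mψ₀ : Measurable ψ₀ := mψ.sub_const _
  have hPL := S.memLp_wsum wi
  have hQL := S.memLp_wsum wa
  have hRL := S.memLp_wsum wr
  have hRL' := S.memLp_wsum wr'
  have hCL : MemLp C 4 μ := S.memLp_wsum (isFarWeight_crossWeight (nbhd m i) a)
  have bdd : ∀ {Y g : Ω → ℝ}, Integrable Y μ → Measurable g → (∀ ω, |g ω| ≤ (10 : NNReal)) →
      Integrable (fun ω => Y ω * g ω) μ := fun hY hg hb =>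
    hY.mul_bdd hg.aestronglyMeasurable (Filter.Eventually.of_forall fun ω => hb ω)
  have j1 := bdd (integrable_mul_of_memLp hPL hQL) mψ₀ bψ₀
  have j2 := bdd (integrable_mul_of_memLp hPL hQL) mφ₀ bφ₀
  have j3 := bdd (integrable_mul_of_memLp hPL hRL') mφ₀ bφ₀
  have j4 := bdd (integrable_mul_of_memLp hRL hCL) mφ₀ bφ₀
  have j5 : Integrable (fun ω => P ω * Q ω * (φ₀ ω - ψ₀ ω)) μ := by
    simp only [mul_sub]; exact j2.sub j1
  -- Expand (P + R) C with C = 2Q + R'. The terms with R or R' have small support, the third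
  -- replaces f' of the full sum by f' of the sum over J, and the last involves only J besides X_i
  -- and X_a.
  have hsplit : ∫ ω, wsum X H i (farIndicator m i) ω * C ω * φ₀ ω ∂μ =
      ∫ ω, P ω * R' ω * φ₀ ω ∂μ + ∫ ω, R ω * C ω * φ₀ ω ∂μ +
      2 * ∫ ω, P ω * Q ω * (φ₀ ω - ψ₀ ω) ∂μ + 2 * ∫ ω, P ω * Q ω * ψ₀ ω ∂μ := by
    have j6 : Integrable (fun ω => P ω * R' ω * φ₀ ω + R ω * C ω * φ₀ ω) μ := j3.add j4
    have j7 : Integrable (fun ω => P ω * R' ω * φ₀ ω + R ω * C ω * φ₀ ω +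
      2 * (P ω * Q ω * (φ₀ ω - ψ₀ ω))) μ := j6.add (j5.const_mul 2)
    rw [← integral_const_mul, ← integral_const_mul, ← integral_add j3 j4,
      ← integral_add j6 (j5.const_mul 2), ← integral_add j7 (j1.const_mul 2)]
    refine integral_congr_ae (Filter.Eventually.of_forall fun ω => ?_)
    simp only [eA, mul_sub]
    linear_combination (P ω * φ₀ ω) * eC ω
  have two : ‖(2 : ℝ)‖ₑ = 2 := by rw [Real.enorm_of_nonneg (by norm_num)]; simp
  rw [hsplit]
  refine (enorm_add_le _ _).trans (add_le_add ((enorm_add_le _ _).trans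
    (add_le_add ((enorm_add_le _ _).trans ?_) ?_)) ?_)
  · have h1 : ‖∫ ω, P ω * R' ω * φ₀ ω ∂μ‖ₑ ≤ 10 * (normTwo μ X H β m δ *
        (2 * ((nbhd m i).card * kernelMoment μ X H 2))) := by
      refine (enorm_integral_mul_le_of_abs_le bφ₀).trans ?_
      refine mul_le_mul' le_rfl ((lintegral_enorm_mul_le hPL.1 hRL'.1).trans ?_)
      exact mul_le_mul' (S.eLpNorm_wsum_two_le hδ wi) (S.eLpNorm_wsum_le_of_support wr' sr')
    have h2 : ‖∫ ω, R ω * C ω * φ₀ ω ∂μ‖ₑ ≤ 10 *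
        (2 * ((nbhd m a).card * kernelMoment μ X H 2) * normTwo μ X H β m δ) := by
      refine (enorm_integral_mul_le_of_abs_le bφ₀).trans ?_
      refine mul_le_mul' le_rfl ((lintegral_enorm_mul_le hRL.1 hCL.1).trans ?_)
      exact mul_le_mul' (S.eLpNorm_wsum_le_of_support wr sr)
        (S.eLpNorm_wsum_two_le hδ (isFarWeight_crossWeight _ _))
    refine (add_le_add h1 h2).trans (le_of_eq (by ring))
  · have hD4 : eLpNorm D 4 μ ≤ ‖t‖ₑ * (((nbhd m i).card + (nbhd m a).card) *
        normFour μ X H β m δ) := by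
      refine (S.eLpNorm_farSum_sub_le hδ t B).trans ?_
      gcongr
      exact_mod_cast Finset.card_union_le _ _
    have hd : ∀ ω, ‖φ ω - ψ ω‖ₑ ≤ 8 * ‖D ω‖ₑ := fun ω => by
      rw [show (8 : ℝ≥0∞) = ‖(8 : ℝ)‖ₑ by rw [Real.enorm_of_nonneg (by norm_num)]; simp,
        ← enorm_mul, Real.enorm_eq_ofReal_abs, Real.enorm_eq_ofReal_abs, abs_mul,
        abs_of_nonneg (by norm_num : (0 : ℝ) ≤ 8)]
      exact ENNReal.ofReal_le_ofReal (hf.abs_deriv_sub_le _ _)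
    have he : ‖∫ ω, φ ω ∂μ - ∫ ω, ψ ω ∂μ‖ₑ ≤ 8 * eLpNorm D 4 μ := by
      rw [← integral_sub iφ iψ]
      refine (enorm_integral_le_lintegral_enorm _).trans ((lintegral_mono hd).trans ?_)
      rw [lintegral_const_mul' _ _ (by norm_num), ← eLpNorm_one_eq_lintegral_enorm]
      gcongr
      exact eLpNorm_le_eLpNorm_of_exponent_le (by norm_num) mD.aestronglyMeasurable
    have hd₀ : ∀ ω, ‖φ₀ ω - ψ₀ ω‖ₑ ≤ 8 * ‖D ω‖ₑ + 8 * eLpNorm D 4 μ := fun ω => by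
      have : φ₀ ω - ψ₀ ω = (φ ω - ψ ω) - (∫ ω, φ ω ∂μ - ∫ ω, ψ ω ∂μ) := by
        simp only [hφ₀, hψ₀]; ring
      rw [this]
      exact enorm_sub_le.trans (add_le_add (hd ω) he)
    have hP2 : eLpNorm P 2 μ ≤ normTwo μ X H β m δ := S.eLpNorm_wsum_two_le hδ wi
    have hQ4 : eLpNorm Q 4 μ ≤ normFour μ X H β m δ := S.eLpNorm_wsum_four_le hδ wa
    -- The cruder L⁴ bound is used on purpose, so that both parts of the estimate share the product
    -- of one L² and two L⁴ norms.
    have hQ2 : eLpNorm Q 2 μ ≤ normFour μ X H β m δ :=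
      (eLpNorm_le_eLpNorm_of_exponent_le (by norm_num) hQL.1).trans hQ4
    rw [enorm_mul, two]
    calc 2 * ‖∫ ω, P ω * Q ω * (φ₀ ω - ψ₀ ω) ∂μ‖ₑ
        ≤ 2 * ∫⁻ ω, (8 * ‖P ω * (Q ω * D ω)‖ₑ + 8 * eLpNorm D 4 μ * ‖P ω * Q ω‖ₑ) ∂μ := by
          gcongr
          refine (enorm_integral_le_lintegral_enorm _).trans (lintegral_mono fun ω => ?_)
          rw [enorm_mul]
          refine (mul_le_mul' le_rfl (hd₀ ω)).trans (le_of_eq ?_)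
          simp only [enorm_mul]; ring
      _ = 2 * (8 * ∫⁻ ω, ‖P ω * (Q ω * D ω)‖ₑ ∂μ +
            8 * eLpNorm D 4 μ * ∫⁻ ω, ‖P ω * Q ω‖ₑ ∂μ) := by
          have hm : Measurable fun ω => P ω * (Q ω * D ω) :=
            (S.measurable_wsum i w).mul ((S.measurable_wsum a w).mul mD)
          have hm' : Measurable fun ω => P ω * Q ω :=
            (S.measurable_wsum i w).mul (S.measurable_wsum a w)
          rw [lintegral_add_left (hm.enorm.const_mul 8), lintegral_const_mul _ hm.enorm,
            lintegral_const_mul _ hm'.enorm]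
      _ ≤ 2 * (8 * (eLpNorm P 2 μ * (eLpNorm Q 4 μ * eLpNorm D 4 μ)) +
            8 * eLpNorm D 4 μ * (eLpNorm P 2 μ * eLpNorm Q 2 μ)) := by
          gcongr
          · exact lintegral_enorm_mul_mul_le hPL.1 hQL.1 mD.aestronglyMeasurable
          · exact lintegral_enorm_mul_le hPL.1 hQL.1
      _ ≤ 2 * (8 * (normTwo μ X H β m δ * (normFour μ X H β m δ * (‖t‖ₑ * (((nbhd m i).card +
            (nbhd m a).card) * normFour μ X H β m δ)))) +
            8 * (‖t‖ₑ * (((nbhd m i).card + (nbhd m a).card) * normFour μ X H β m δ)) *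
              (normTwo μ X H β m δ * normFour μ X H β m δ)) := by gcongr
      _ = _ := by ring
  · have h := S.enorm_integral_sum_mul_sum_mul_le hδ hi ha hia (ψ := ψ₀)
      (mψJ.sub measurable_const) bψ₀ (by
        simp only [hψ₀]
        rw [integral_sub iψ (integrable_const _)]; simp)
    rw [enorm_mul, two]
    simp only [hP, hQ, hw, wsum_indicator]
    refine (mul_le_mul' le_rfl h).trans (le_of_eq ?_)
    rw [← mul_assoc]; norm_num

end IsMixingKernel

end PairBound

/-! ### The Stein discrepancy of the sum over far pairs -/

lemma enorm_integral_add_le {Ω : Type*} [MeasurableSpace Ω] {μ : Measure Ω} {f g : Ω → ℝ}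
    (hf : Integrable f μ) (hg : Integrable g μ) :
    ‖∫ ω, (f ω + g ω) ∂μ‖ₑ ≤ ‖∫ ω, f ω ∂μ‖ₑ + ‖∫ ω, g ω ∂μ‖ₑ := by
  rw [integral_add hf hg]; exact enorm_add_le _ _

lemma enorm_integral_sum_le {Ω κ : Type*} [MeasurableSpace Ω] {μ : Measure Ω} {s : Finset κ}
    {f : κ → Ω → ℝ} (hf : ∀ i ∈ s, Integrable (f i) μ) :
    ‖∫ ω, ∑ i ∈ s, f i ω ∂μ‖ₑ ≤ ∑ i ∈ s, ‖∫ ω, f i ω ∂μ‖ₑ := by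
  rw [integral_finsetSum _ hf]; exact enorm_sum_le _ _

section SteinBound

open scoped Classical

variable {Ω : Type u} [MeasurableSpace Ω] {μ : Measure Ω} [IsProbabilityMeasure μ]
  {ι : Type v} [EMetricSpace ι] [Fintype ι] {E : Type*} [MeasurableSpace E]
  {X : ι → Ω → E} {H : E → E → ℝ} {β : ℕ∞ → ℕ∞ → ℝ → ℝ≥0∞} {m δ : ℝ}

lemma sum_nbhd_card_add_card :
    ∑ i : ι, ∑ a ∈ nbhd m i, (((nbhd m i).card : ℝ≥0∞) + (nbhd m a).card) =
      2 * ∑ i : ι, ((nbhd m i).card : ℝ≥0∞) ^ 2 := by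
  have h : ∑ i : ι, ∑ a ∈ nbhd m i, ((nbhd m a).card : ℝ≥0∞) =
      ∑ i : ι, ((nbhd m i).card : ℝ≥0∞) ^ 2 := by
    rw [Finset.sum_comm' (t' := Finset.univ) (s' := fun a => nbhd m a)
      (by intro x y; simp [mem_nbhd, edist_comm])]
    simp [sq]
  simp only [Finset.sum_add_distrib, h]
  simp only [Finset.sum_const, nsmul_eq_mul, ← sq]
  rw [two_mul]

namespace IsMixingKernel

/-- In every surviving summand H(X_i, X_k) H(X_b, X_c) the node i is far from k, b and c, hence
isolated. -/
lemma enorm_integral_wsum_mul_farSum_le (S : IsMixingKernel μ X H β) (hδ : 0 < δ) (i : ι) :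
    ‖∫ ω, wsum X H i (farIndicator m i) ω * farSum X H m (nbhd m i)ᶜ ω ∂μ‖ₑ ≤
      8 * ((Fintype.card ι : ℝ≥0∞) ^ 3 *
        (kernelMoment μ X H (2 + δ) ^ 2 * betaMax β 4 m ^ (δ / (2 + δ)))) := by
  set q := kernelMoment μ X H (2 + δ) ^ 2 * betaMax β 4 m ^ (δ / (2 + δ))
  have hterm : ∀ b c, MemLp (fun ω => farIndicator m b c * kernelRV X H b c ω) 4 μ := fun b c => by
    by_cases h : ENNReal.ofReal m < edist b c
    · exact (S.memLp_kernelRV (ne_of_lt_edist h)).const_mul _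
    · simp [farIndicator_eq_zero (not_lt.1 h)]
  have hint : ∀ k b c, Integrable (fun ω => farIndicator m i k * kernelRV X H i k ω *
      (farIndicator m b c * kernelRV X H b c ω)) μ := fun k b c =>
    integrable_mul_of_memLp (hterm i k) (hterm b c)
  have e : ∀ ω, wsum X H i (farIndicator m i) ω * farSum X H m (nbhd m i)ᶜ ω =
      ∑ k, ∑ b ∈ (nbhd m i)ᶜ, ∑ c ∈ (nbhd m i)ᶜ, farIndicator m i k * kernelRV X H i k ω *
      (farIndicator m b c * kernelRV X H b c ω) := fun ω => by
    rw [wsum, farSum, Finset.sum_mul]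
    refine Finset.sum_congr rfl fun k _ => ?_
    rw [Finset.mul_sum]
    exact Finset.sum_congr rfl fun b _ => Finset.mul_sum _ _ _
  simp only [e]
  have hfar : ∀ j ∈ (nbhd m i)ᶜ, ENNReal.ofReal m < edist i j := fun j hj => by
    simpa [mem_nbhd] using hj
  calc _ ≤ ∑ k, ∑ b ∈ (nbhd m i)ᶜ, ∑ c ∈ (nbhd m i)ᶜ,
        ‖∫ ω, farIndicator m i k * kernelRV X H i k ω *
          (farIndicator m b c * kernelRV X H b c ω) ∂μ‖ₑ := by
        refine (enorm_integral_sum_le fun k _ => integrable_finsetSum _ fun b _ =>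
          integrable_finsetSum _ fun c _ => hint k b c).trans (Finset.sum_le_sum fun k _ => ?_)
        refine (enorm_integral_sum_le fun b _ =>
          integrable_finsetSum _ fun c _ => hint k b c).trans (Finset.sum_le_sum fun b _ => ?_)
        exact enorm_integral_sum_le fun c _ => hint k b c
    _ ≤ ∑ k : ι, ∑ b ∈ (nbhd m i)ᶜ, ∑ c ∈ (nbhd m i)ᶜ, 8 * q := by
        refine Finset.sum_le_sum fun k _ => Finset.sum_le_sum fun b hb =>
          Finset.sum_le_sum fun c hc => ?_
        by_cases hk : ENNReal.ofReal m < edist i k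
        · by_cases hbc : ENNReal.ofReal m < edist b c
          · simp only [farIndicator_eq_one hk, farIndicator_eq_one hbc, one_mul]
            exact S.enorm_integral_isolated_pair_le hδ hk (hfar b hb) (hfar c hc)
              (ne_of_lt_edist hbc)
          · simp [farIndicator_eq_zero (not_lt.1 hbc)]
        · simp [farIndicator_eq_zero (not_lt.1 hk)]
    _ ≤ ∑ k : ι, ∑ b : ι, ∑ c : ι, 8 * q := by
        refine Finset.sum_le_sum fun k _ => ?_
        refine (Finset.sum_le_sum_of_subset (Finset.subset_univ _)).trans ?_
        exact Finset.sum_le_sum fun b _ => Finset.sum_le_sum_of_subset (Finset.subset_univ _)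
    _ = _ := by simp only [Finset.sum_const, Finset.card_univ, nsmul_eq_mul]; ring

/-- The Stein discrepancy of the sum over far pairs. -/
lemma enorm_integral_stein_le (S : IsMixingKernel μ X H β) (hδ : 0 < δ) {f f' : ℝ → ℝ}
    (hf : IsSteinFun f f') (t : ℝ) {V : ℝ≥0∞}
    (hV : ∑ i : ι, ((nbhd m i).card : ℝ≥0∞) ^ 2 ≤ V) :
    ‖∫ ω, (f' (t * farSum X H m Finset.univ ω) - t * farSum X H m Finset.univ ω *
      f (t * farSum X H m Finset.univ ω)) ∂μ‖ₑ ≤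
    24 * (‖t‖ₑ * (Fintype.card ι : ℝ≥0∞) ^ 2 *
      (kernelMoment μ X H (1 + δ) * β 1 ⊤ m ^ (δ / (1 + δ)))) +
    72 * (‖t‖ₑ ^ 3 * V *
      (normTwo μ X H β m δ * (normFour μ X H β m δ * normFour μ X H β m δ))) +
    40 * (‖t‖ₑ ^ 2 * V * (kernelMoment μ X H 2 * normTwo μ X H β m δ)) +
    240 * (‖t‖ₑ ^ 2 * tau ι m [2] * ((Fintype.card ι : ℝ≥0∞) ^ 2 *
      (kernelMoment μ X H (2 + δ) ^ 2 * β 2 ⊤ m ^ (δ / (2 + δ))) +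
      boundGamma μ X H β m δ ^ (1 / 2 : ℝ))) +
    5 * ‖∫ ω, (t * farSum X H m Finset.univ ω) ^ 2 ∂μ - 1‖ₑ +
    40 * (‖t‖ₑ ^ 2 * (Fintype.card ι : ℝ≥0∞) ^ 4 *
      (kernelMoment μ X H (2 + δ) ^ 2 * betaMax β 4 m ^ (δ / (2 + δ)))) := by
  set L := normTwo μ X H β m δ * (normFour μ X H β m δ * normFour μ X H β m δ)
  set q₁ := kernelMoment μ X H (1 + δ) * β 1 ⊤ m ^ (δ / (1 + δ))
  set q₂ := kernelMoment μ X H (2 + δ) ^ 2 * betaMax β 4 m ^ (δ / (2 + δ))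
  set q₃ := (Fintype.card ι : ℝ≥0∞) ^ 2 *
      (kernelMoment μ X H (2 + δ) ^ 2 * β 2 ⊤ m ^ (δ / (2 + δ)))
  set A : ι → Ω → ℝ := fun i => wsum X H i (farIndicator m i) with hA
  set C : ι → ι → Ω → ℝ := fun i a => wsum X H a (crossWeight m (nbhd m i) a) with hC
  set G : ι → Ω → ℝ := fun i => farSum X H m (nbhd m i)ᶜ with hG
  set F : Ω → ℝ := farSum X H m Finset.univ with hF
  set φ : Ω → ℝ := fun ω => f' (t * F ω) with hφ
  set e : ℝ := ∫ ω, φ ω ∂μ with he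
  have hAF : ∀ ω, ∑ i, A i ω = F ω := fun ω => rfl
  have hCF : ∀ i ω, ∑ a ∈ nbhd m i, C i a ω = F ω - G i ω := fun i ω =>
    (S.farSum_univ_sub (nbhd m i) ω).symm
  have LA : ∀ i, MemLp (A i) 4 μ := fun i => S.memLp_wsum (isFarWeight_farIndicator i)
  have LC : ∀ i a, MemLp (C i a) 4 μ := fun i a => S.memLp_wsum (isFarWeight_crossWeight _ a)
  have LG : ∀ i, MemLp (G i) 4 μ := fun i => S.memLp_farSum _
  have LF : MemLp F 4 μ := S.memLp_farSum _
  have mF : Measurable F := S.measurable_farSum _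
  have mφ : Measurable φ := hf.measurable_deriv.comp (mF.const_mul t)
  have bφ : ∀ ω, |φ ω| ≤ 5 := fun ω => hf.abs_deriv_le _
  have iφ : Integrable φ μ :=
    Integrable.of_bound mφ.aestronglyMeasurable 5 (Filter.Eventually.of_forall bφ)
  have be : ‖e‖ₑ ≤ 5 := by
    have := norm_integral_le_of_norm_le_const (μ := μ) (f := φ) (Filter.Eventually.of_forall bφ)
    rw [Real.enorm_eq_ofReal_abs, ← ENNReal.ofReal_ofNat]
    refine ENNReal.ofReal_le_ofReal ?_
    simpa using this
  have bdd : ∀ {Y g : Ω → ℝ}, Integrable Y μ → Measurable g → ∀ c : ℝ, (∀ ω, |g ω| ≤ c) →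
      Integrable (fun ω => Y ω * g ω) μ := fun hY hg c hb =>
    hY.mul_bdd hg.aestronglyMeasurable (Filter.Eventually.of_forall fun ω => hb ω)
  have iA : ∀ i, Integrable (A i) μ := fun i => (LA i).integrable (by norm_num)
  have i1 : ∀ i, Integrable (fun ω => A i ω * f (t * G i ω)) μ := fun i =>
    bdd (iA i) (hf.measurable.comp ((S.measurable_farSum _).const_mul t)) 3 fun ω => hf.abs_le _
  have i2 : ∀ i, Integrable (fun ω => A i ω * (f (t * F ω) - f (t * G i ω) -
      f' (t * F ω) * (t * F ω - t * G i ω))) μ := fun i => by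
    have a1 : Integrable (fun ω => A i ω * f (t * F ω)) μ :=
      bdd (iA i) (hf.measurable.comp (mF.const_mul t)) 3 fun ω => hf.abs_le _
    have a2 : Integrable (fun ω => A i ω * (t * F ω - t * G i ω) * φ ω) μ :=
      bdd (integrable_mul_of_memLp (LA i) ((LF.const_mul t).sub ((LG i).const_mul t))) mφ 5 bφ
    refine ((a1.sub (i1 i)).sub a2).congr (Filter.Eventually.of_forall fun ω => ?_)
    simp only [Pi.sub_apply, hφ]; ring
  have i3 : ∀ i a, Integrable (fun ω => A i ω * C i a ω * (φ ω - e)) μ := fun i a => by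
    simp only [mul_sub]
    exact (bdd (integrable_mul_of_memLp (LA i) (LC i a)) mφ 5 bφ).sub
      ((integrable_mul_of_memLp (LA i) (LC i a)).mul_const e)
  have i4 : Integrable (fun ω => (t * F ω) ^ 2 - 1) μ := by
    refine Integrable.sub ?_ (integrable_const _)
    simp only [sq]
    exact integrable_mul_of_memLp (LF.const_mul t) (LF.const_mul t)
  have i5 : ∀ i, Integrable (fun ω => A i ω * G i ω) μ := fun i =>
    integrable_mul_of_memLp (LA i) (LG i)
  -- With φ = f'(tF) and e its mean, T₁ + T₂ is -tF f(tF) plus the linear term t² ∑ A_i (F - G_i) φ;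
  -- T₃ centres φ in that term. T₄ and T₅ restore e t² F², since ∑ A_i (F - G_i) = F² - ∑ A_i G_i.
  set T₁ : Ω → ℝ := fun ω => ∑ i, -t * (A i ω * f (t * G i ω)) with hT₁
  set T₂ : Ω → ℝ := fun ω => ∑ i, -t * (A i ω * (f (t * F ω) - f (t * G i ω) -
      f' (t * F ω) * (t * F ω - t * G i ω))) with hT₂
  set T₃ : Ω → ℝ := fun ω => ∑ i, ∑ a ∈ nbhd m i, -t ^ 2 * (A i ω * C i a ω * (φ ω - e)) with hT₃
  set T₄ : Ω → ℝ := fun ω => -e * ((t * F ω) ^ 2 - 1) with hT₄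
  set T₅ : Ω → ℝ := fun ω => ∑ i, e * t ^ 2 * (A i ω * G i ω) with hT₅
  have hsplit : ∀ ω, φ ω - t * F ω * f (t * F ω) =
      T₁ ω + T₂ ω + T₃ ω + T₄ ω + T₅ ω + (φ ω - e) := fun ω => by
    have h3 : T₃ ω = ∑ i, -t ^ 2 * (A i ω * (F ω - G i ω) * (φ ω - e)) := by
      refine Finset.sum_congr rfl fun i _ => ?_
      rw [← hCF, Finset.mul_sum, Finset.sum_mul, Finset.mul_sum]
    have h : T₁ ω + T₂ ω + T₃ ω + T₅ ω = F ω * (-t * f (t * F ω) + e * t ^ 2 * F ω) := by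
      rw [h3, hT₁, hT₂, hT₅]
      simp only [← Finset.sum_add_distrib]
      rw [← hAF, Finset.sum_mul]
      refine Finset.sum_congr rfl fun i _ => ?_
      rw [hAF]
      simp only [hφ]
      ring
    have h4 : T₄ ω = -e * ((t * F ω) ^ 2 - 1) := rfl
    linear_combination -h - h4
  have I₁ : Integrable T₁ μ := integrable_finsetSum _ fun i _ => (i1 i).const_mul _
  have I₂ : Integrable T₂ μ := integrable_finsetSum _ fun i _ => (i2 i).const_mul _
  have I₃ : Integrable T₃ μ :=
    integrable_finsetSum _ fun i _ => integrable_finsetSum _ fun a _ => (i3 i a).const_mul _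
  have I₄ : Integrable T₄ μ := i4.const_mul _
  have I₅ : Integrable T₅ μ := integrable_finsetSum _ fun i _ => (i5 i).const_mul _
  have I₆ : Integrable (fun ω => φ ω - e) μ := iφ.sub (integrable_const _)
  have J₂ : Integrable (fun ω => T₁ ω + T₂ ω) μ := I₁.add I₂
  have J₃ : Integrable (fun ω => T₁ ω + T₂ ω + T₃ ω) μ := J₂.add I₃
  have J₄ : Integrable (fun ω => T₁ ω + T₂ ω + T₃ ω + T₄ ω) μ := J₃.add I₄
  have J₅ : Integrable (fun ω => T₁ ω + T₂ ω + T₃ ω + T₄ ω + T₅ ω) μ := J₄.add I₅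
  have b₁ : ‖∫ ω, T₁ ω ∂μ‖ₑ ≤ 24 * (‖t‖ₑ * (Fintype.card ι : ℝ≥0∞) ^ 2 * q₁) := by
    refine (enorm_integral_sum_le fun i _ => (i1 i).const_mul _).trans ?_
    refine (Finset.sum_le_card_nsmul _ _ (‖t‖ₑ * (8 * (3 : NNReal) * (Fintype.card ι * q₁)))
      fun i _ => ?_).trans_eq ?_
    · rw [integral_const_mul, enorm_mul, enorm_neg]
      gcongr
      exact S.enorm_integral_wsum_mul_bounded_le hδ
        (hf.measurable.comp ((S.measurable_farSum_sigmaOf _).const_mul t)) fun ω => hf.abs_le _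
    · rw [nsmul_eq_mul, Finset.card_univ]; push_cast; ring
  have b₂ : ‖∫ ω, T₂ ω ∂μ‖ₑ ≤ 8 * (‖t‖ₑ ^ 3 * V * L) := by
    refine (enorm_integral_sum_le fun i _ => (i2 i).const_mul _).trans ?_
    calc _ ≤ ∑ i : ι, ‖t‖ₑ * (8 * ‖t‖ₑ ^ 2 * ((nbhd m i).card : ℝ≥0∞) ^ 2 * L) := by
          refine Finset.sum_le_sum fun i _ => ?_
          rw [integral_const_mul, enorm_mul, enorm_neg]
          gcongr
          exact S.enorm_integral_taylor_le hδ hf t (nbhd m i) (isFarWeight_farIndicator i)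
      _ = 8 * (‖t‖ₑ ^ 3 * (∑ i : ι, ((nbhd m i).card : ℝ≥0∞) ^ 2) * L) := by
          rw [Finset.mul_sum, Finset.sum_mul, Finset.mul_sum]
          exact Finset.sum_congr rfl fun i _ => by ring
      _ ≤ _ := by gcongr
  have b₃ : ‖∫ ω, T₃ ω ∂μ‖ₑ ≤ 64 * (‖t‖ₑ ^ 3 * V * L) +
      40 * (‖t‖ₑ ^ 2 * V * (kernelMoment μ X H 2 * normTwo μ X H β m δ)) +
      240 * (‖t‖ₑ ^ 2 * tau ι m [2] * (q₃ + boundGamma μ X H β m δ ^ (1 / 2 : ℝ))) := by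
    set p := kernelMoment μ X H 2 * normTwo μ X H β m δ
    set g := boundGamma μ X H β m δ ^ (1 / 2 : ℝ)
    calc _ ≤ ∑ i : ι, ∑ a ∈ nbhd m i, ‖t‖ₑ ^ 2 *
          (20 * (((nbhd m i).card + (nbhd m a).card) * p) +
          32 * ‖t‖ₑ * (((nbhd m i).card + (nbhd m a).card) * L) + 20 * (8 * q₃ + 12 * g)) := by
          refine (enorm_integral_sum_le fun i _ => integrable_finsetSum _ fun a _ =>
            (i3 i a).const_mul _).trans (Finset.sum_le_sum fun i _ => ?_)
          refine (enorm_integral_sum_le fun a _ => (i3 i a).const_mul _).trans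
            (Finset.sum_le_sum fun a ha => ?_)
          rw [integral_const_mul, enorm_mul, enorm_neg, enorm_pow]
          gcongr
          exact S.enorm_integral_mul_sub_integral_le hδ (mem_nbhd.1 ha) hf t
      _ = ‖t‖ₑ ^ 2 * (20 * p + 32 * ‖t‖ₑ * L) *
            (∑ i : ι, ∑ a ∈ nbhd m i, (((nbhd m i).card : ℝ≥0∞) + (nbhd m a).card)) +
          ‖t‖ₑ ^ 2 * (20 * (8 * q₃ + 12 * g)) * ∑ i : ι, ((nbhd m i).card : ℝ≥0∞) := by
          rw [Finset.mul_sum, Finset.mul_sum, ← Finset.sum_add_distrib]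
          refine Finset.sum_congr rfl fun i _ => ?_
          rw [Finset.mul_sum, mul_comm _ ((nbhd m i).card : ℝ≥0∞), ← nsmul_eq_mul,
            ← Finset.sum_const, ← Finset.sum_add_distrib]
          exact Finset.sum_congr rfl fun a _ => by ring
      -- The 8 is raised to 12 to give both summands the common constant 240.
      _ ≤ ‖t‖ₑ ^ 2 * (20 * p + 32 * ‖t‖ₑ * L) * (2 * V) +
          ‖t‖ₑ ^ 2 * (20 * (12 * q₃ + 12 * g)) * tau ι m [2] := by
          rw [sum_nbhd_card_add_card]
          gcongr
          · norm_num
          · exact sum_card_nbhd_le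
      _ = _ := by ring
  have b₄ : ‖∫ ω, T₄ ω ∂μ‖ₑ ≤ 5 * ‖∫ ω, (t * F ω) ^ 2 ∂μ - 1‖ₑ := by
    rw [hT₄, integral_const_mul, enorm_mul, enorm_neg, integral_sub _ (integrable_const _)]
    · simp only [integral_const, probReal_univ, one_smul]
      gcongr
    · simp only [sq]
      exact integrable_mul_of_memLp (LF.const_mul t) (LF.const_mul t)
  have b₅ : ‖∫ ω, T₅ ω ∂μ‖ₑ ≤ 40 * (‖t‖ₑ ^ 2 * (Fintype.card ι : ℝ≥0∞) ^ 4 * q₂) := by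
    refine (enorm_integral_sum_le fun i _ => (i5 i).const_mul _).trans ?_
    refine (Finset.sum_le_card_nsmul _ _ (5 * ‖t‖ₑ ^ 2 *
      (8 * ((Fintype.card ι : ℝ≥0∞) ^ 3 * q₂))) fun i _ => ?_).trans_eq ?_
    · rw [integral_const_mul, enorm_mul, enorm_mul, enorm_pow]
      gcongr
      exact S.enorm_integral_wsum_mul_farSum_le hδ i
    · rw [nsmul_eq_mul, Finset.card_univ]; ring
  have b₆ : ‖∫ ω, (φ ω - e) ∂μ‖ₑ = 0 := by
    rw [integral_sub iφ (integrable_const _)]; simp [he]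
  have hmain : ‖∫ ω, (φ ω - t * F ω * f (t * F ω)) ∂μ‖ₑ ≤ ‖∫ ω, T₁ ω ∂μ‖ₑ + ‖∫ ω, T₂ ω ∂μ‖ₑ +
      ‖∫ ω, T₃ ω ∂μ‖ₑ + ‖∫ ω, T₄ ω ∂μ‖ₑ + ‖∫ ω, T₅ ω ∂μ‖ₑ := by
    simp only [hsplit]
    have h5 := enorm_integral_add_le J₅ I₆
    rw [b₆, add_zero] at h5
    refine h5.trans ?_
    refine (enorm_integral_add_le J₄ I₅).trans (add_le_add_left ?_ _)
    refine (enorm_integral_add_le J₃ I₄).trans (add_le_add_left ?_ _)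
    refine (enorm_integral_add_le J₂ I₃).trans (add_le_add_left ?_ _)
    exact enorm_integral_add_le I₁ I₂
  refine hmain.trans ?_
  refine (add_le_add (add_le_add (add_le_add (add_le_add b₁ b₂) b₃) b₄) b₅).trans (le_of_eq ?_)
  ring

end IsMixingKernel

end SteinBound

/-! ### Near pairs, standardisation and assembly of the bound -/

/-- Subtracting g(0) changes no difference of integrals and leaves |g(x) - g(0)| ≤ |x|. Serves as
the trivial bound when the far-pair approximation is poor. -/
lemma wassersteinDist_le_add {P Q : Measure ℝ} [IsProbabilityMeasure P] [IsProbabilityMeasure Q]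
    (hP : Integrable (fun x => x) P) (hQ : Integrable (fun x => x) Q) :
    wassersteinDist P Q ≤ ∫⁻ x, ‖x‖ₑ ∂P + ∫⁻ x, ‖x‖ₑ ∂Q := by
  refine iSup₂_le fun g hg => ?_
  have hle : ∀ x, ‖g x - g 0‖ₑ ≤ ‖x‖ₑ := fun x => by
    rw [Real.enorm_eq_ofReal_abs, Real.enorm_eq_ofReal_abs]
    refine ENNReal.ofReal_le_ofReal ?_
    simpa [Real.dist_eq] using hg.dist_le_mul x 0
  have hm : Measurable fun x => g x - g 0 := hg.continuous.measurable.sub_const _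
  have key : ∀ (ν : Measure ℝ) [IsProbabilityMeasure ν], Integrable (fun x => x) ν →
      ∫ x, (g x - g 0) ∂ν = ∫ x, g x ∂ν - g 0 := fun ν _ hν => by
    have hi : Integrable (fun x => g x - g 0) ν := hν.mono hm.aestronglyMeasurable
      (Filter.Eventually.of_forall fun x => by
        have := hg.dist_le_mul x 0
        simpa [Real.dist_eq] using this)
    have hi' : Integrable g ν :=
      (hi.add (integrable_const (g 0))).congr (Filter.Eventually.of_forall fun x => by simp)
    rw [integral_sub hi' (integrable_const _)]; simp
  have e : ∫ x, g x ∂P - ∫ x, g x ∂Q = ∫ x, (g x - g 0) ∂P - ∫ x, (g x - g 0) ∂Q := by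
    rw [key P hP, key Q hQ]; ring
  rw [e, ← Real.enorm_eq_ofReal_abs]
  refine enorm_sub_le.trans (add_le_add ?_ ?_) <;>
  exact (enorm_integral_le_lintegral_enorm _).trans (lintegral_mono hle)

lemma eLpNorm_id_gaussianReal : eLpNorm (fun x : ℝ => x) 2 (gaussianReal 0 1) = 1 := by
  have h2 : MemLp (fun x : ℝ => x) 2 (gaussianReal 0 1) := memLp_id_gaussianReal 2
  have h := eLpNorm_sub_integral_sq h2
  have h0 : ∫ x, x ∂(gaussianReal 0 1) = 0 := integral_id_gaussianReal
  have hv : Var[fun x : ℝ => x; gaussianReal 0 1] = 1 := by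
    simp [variance_fun_id_gaussianReal]
  simp only [h0, sub_zero] at h
  rw [hv, enorm_one] at h
  exact (ENNReal.pow_right_strictMono two_ne_zero).injective (h.trans (one_pow 2).symm)

section NearSum

open scoped Classical

variable {Ω : Type u} [MeasurableSpace Ω] {μ : Measure Ω} [IsProbabilityMeasure μ]
  {ι : Type v} [EMetricSpace ι] [Fintype ι] {E : Type*} [MeasurableSpace E]
  {X : ι → Ω → E} {H : E → E → ℝ} {β : ℕ∞ → ℕ∞ → ℝ → ℝ≥0∞} {m δ : ℝ}

/-- The summands of the U-statistic that belong to close pairs. -/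
noncomputable def nearRV (X : ι → Ω → E) (H : E → E → ℝ) (m : ℝ) (i k : ι) : Ω → ℝ :=
  if i ≠ k ∧ edist i k ≤ ENNReal.ofReal m then kernelRV X H i k else 0

lemma uStat_eq (ω : Ω) : uStat X H ω =
    farSum X H m Finset.univ ω + ∑ i, ∑ k, nearRV X H m i k ω := by
  rw [farSum, uStat, ← Finset.sum_add_distrib]
  refine Finset.sum_congr rfl fun i _ => ?_
  rw [← Finset.sum_add_distrib, Finset.sum_filter]
  refine Finset.sum_congr rfl fun k _ => ?_
  by_cases h : edist i k ≤ ENNReal.ofReal m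
  · by_cases hik : i = k
    · simp [nearRV, hik, farIndicator_eq_zero]
    · simp [nearRV, hik, Ne.symm hik, h, farIndicator_eq_zero h, kernelRV]
  · have hik := ne_of_lt_edist (not_le.1 h)
    simp [nearRV, hik.symm, h, farIndicator_eq_one (not_le.1 h), kernelRV]

namespace IsMixingKernel

lemma memLp_nearRV (S : IsMixingKernel μ X H β) (i k : ι) : MemLp (nearRV X H m i k) 4 μ := by
  unfold nearRV
  split_ifs with h
  · exact S.memLp_kernelRV h.1
  · exact MemLp.zero'

lemma memLp_sum_nearRV (S : IsMixingKernel μ X H β) :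
    MemLp (fun ω => ∑ i, ∑ k, nearRV X H m i k ω) 4 μ :=
  memLp_finsetSum _ fun i _ => memLp_finsetSum _ fun k _ => S.memLp_nearRV i k

lemma memLp_uStat (S : IsMixingKernel μ X H β) : MemLp (uStat X H) 4 μ := by
  have : uStat X H = fun ω => farSum X H 0 Finset.univ ω + ∑ i, ∑ k, nearRV X H 0 i k ω :=
    funext uStat_eq
  rw [this]
  exact (S.memLp_farSum _).add S.memLp_sum_nearRV

lemma measurable_uStat (S : IsMixingKernel μ X H β) : Measurable (uStat X H) :=
  Finset.measurable_sum _ fun i _ => Finset.measurable_sum _ fun k _ => S.measurable_kernelRV i k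

/-- The bound on the variance of the sum over close pairs. -/
noncomputable def boundNear (μ : Measure Ω) (X : ι → Ω → E) (H : E → E → ℝ)
    (β : ℕ∞ → ℕ∞ → ℝ → ℝ≥0∞) (m δ : ℝ) : ℝ≥0∞ :=
  tau ι (4 * m) [4] * kernelMoment μ X H 2 ^ 2 + tau ι (4 * m) [2, 2] *
    kernelMoment μ X H (2 + δ) ^ 2 * betaMax β 4 (4 * m) ^ (δ / (2 + δ))

/-- Near pairs at scale m are also close at scale 4m, where the count is made: separated pairs are
then at distance more than 4m and their covariance carries β₄(4m). -/
lemma enorm_variance_sum_nearRV_le (S : IsMixingKernel μ X H β) (hδ : 0 < δ) (hm : 0 < m) :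
    ‖Var[fun ω => ∑ i, ∑ k, nearRV X H m i k ω; μ]‖ₑ ≤ 3 ^ 2 * boundNear μ X H β m δ := by
  have mono : (2 : ℝ≥0∞) ≤ 4 := by norm_num
  set q := kernelMoment μ X H (2 + δ) ^ 2 * betaMax β 4 (4 * m) ^ (δ / (2 + δ)) with hq
  refine (enorm_variance_close_sum_le (m := 4 * m) (a := 2 * kernelMoment μ X H 2 ^ 2) (b := 8 * q)
    (fun i k => (S.memLp_nearRV i k).mono_exponent mono) ?_ ?_ ?_).trans ?_
  · intro k l h
    refine if_neg fun h' => h (h'.2.trans (ENNReal.ofReal_le_ofReal (by linarith)))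
  · intro k l k' l' _ _
    unfold nearRV
    split_ifs with h h'
    · have := enorm_covariance_le_two_mul ((S.memLp_kernelRV h.1).mono_exponent mono)
        ((S.memLp_kernelRV h'.1).mono_exponent mono)
        (a := kernelMoment μ X H 2) (b := kernelMoment μ X H 2)
        (by simpa using eLpNorm_kernelRV_le (μ := μ) (X := X) (H := H) h.1 2)
        (by simpa using eLpNorm_kernelRV_le (μ := μ) (X := X) (H := H) h'.1 2)
      rwa [← sq] at this
    all_goals simp
  · intro k l k' l' _ _ hfar
    unfold nearRV
    split_ifs with h h'
    · have e2 : 2 * ((2 + δ) / 2) = 2 + δ := by ring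
      have ex : 1 - 1 / ((2 + δ) / 2) = δ / (2 + δ) := by field_simp; ring
      have key := enorm_covariance_le S.measurable_sample S.mixing (n₁ := (2 : ℕ)) (n₂ := (2 : ℕ))
        (encard_two_le k l) (encard_two_le k' l') hfar
        (S.measurable_kernelRV_sigmaOf (by simp) (by simp))
        (S.measurable_kernelRV_sigmaOf (by simp) (by simp))
        ((S.memLp_kernelRV h.1).mono_exponent mono) ((S.memLp_kernelRV h'.1).mono_exponent mono)
        (r := (2 + δ) / 2) (by linarith) (eLpNorm_kernelRV_le h.1 _) (eLpNorm_kernelRV_le h'.1 _)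
      rw [ex, e2, ← sq] at key
      refine key.trans ?_
      rw [hq, mul_assoc]
      gcongr
      exact le_betaMax β (q₁ := 2) (q₂ := 2) (by norm_num) (by norm_num) (by norm_num) _
    all_goals simp
  · calc _ = 2 * (tau ι (4 * m) [4] * kernelMoment μ X H 2 ^ 2) +
          8 * (tau ι (4 * m) [2, 2] * kernelMoment μ X H (2 + δ) ^ 2 *
            betaMax β 4 (4 * m) ^ (δ / (2 + δ))) := by rw [hq]; ring
      _ ≤ 3 ^ 2 * (tau ι (4 * m) [4] * kernelMoment μ X H 2 ^ 2) +
          3 ^ 2 * (tau ι (4 * m) [2, 2] * kernelMoment μ X H (2 + δ) ^ 2 *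
            betaMax β 4 (4 * m) ^ (δ / (2 + δ))) := by gcongr <;> norm_num
      _ = _ := by rw [boundNear]; ring

lemma enorm_integral_farSum_le (S : IsMixingKernel μ X H β) (hδ : 0 < δ) :
    ‖∫ ω, farSum X H m Finset.univ ω ∂μ‖ₑ ≤ 8 * ((Fintype.card ι : ℝ≥0∞) ^ 2 *
      (kernelMoment μ X H (1 + δ) * β 1 ⊤ m ^ (δ / (1 + δ)))) := by
  simp only [farSum_univ]
  refine (enorm_integral_sum_le fun i _ =>
    (S.memLp_wsum (isFarWeight_farIndicator i)).integrable (by norm_num)).trans ?_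
  refine (Finset.sum_le_card_nsmul _ _ (8 * (1 : NNReal) * (Fintype.card ι *
    (kernelMoment μ X H (1 + δ) * β 1 ⊤ m ^ (δ / (1 + δ))))) fun i _ => ?_).trans_eq ?_
  · have := S.enorm_integral_wsum_mul_bounded_le hδ (m := m) (i := i) (ψ := fun _ => 1)
      measurable_const (c := 1) (by simp)
    simpa only [mul_one] using this
  · rw [nsmul_eq_mul, Finset.card_univ]; push_cast; ring

/-- The distance between the standardised U-statistic and the sum over far pairs. -/
lemma eLpNorm_uStatStd_sub_le (S : IsMixingKernel μ X H β) (hδ : 0 < δ) (hm : 0 < m) :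
    eLpNorm (fun ω => uStatStd μ X H ω - (uStd μ X H)⁻¹ * farSum X H m Finset.univ ω) 2 μ ≤
      ‖(uStd μ X H)⁻¹‖ₑ * (3 * boundNear μ X H β m δ ^ (1 / 2 : ℝ) +
        8 * ((Fintype.card ι : ℝ≥0∞) ^ 2 *
          (kernelMoment μ X H (1 + δ) * β 1 ⊤ m ^ (δ / (1 + δ))))) := by
  set t := (uStd μ X H)⁻¹ with ht
  set N : Ω → ℝ := fun ω => ∑ i, ∑ k, nearRV X H m i k ω with hN
  have LN : MemLp N 2 μ := S.memLp_sum_nearRV.mono_exponent (by norm_num)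
  have LF : MemLp (farSum X H m Finset.univ) 4 μ := S.memLp_farSum Finset.univ
  have hES : ∫ ω, uStat X H ω ∂μ = ∫ ω, farSum X H m Finset.univ ω ∂μ + ∫ ω, N ω ∂μ := by
    simp only [uStat_eq (m := m)]
    exact integral_add (LF.integrable (by norm_num)) (LN.integrable one_le_two)
  have e : (fun ω => uStatStd μ X H ω - t * farSum X H m Finset.univ ω) =
      t • ((fun ω => N ω - ∫ ω', N ω' ∂μ) -
        fun _ => ∫ ω, farSum X H m Finset.univ ω ∂μ) := by
    ext ω
    rw [uStatStd, hES, uStat_eq (m := m) ω, div_eq_inv_mul, ← ht]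
    simp only [Pi.smul_apply, Pi.sub_apply, smul_eq_mul, hN]
    ring
  rw [e, eLpNorm_const_smul]
  gcongr
  refine (eLpNorm_sub_le (LN.sub (memLp_const _)).1 aestronglyMeasurable_const one_le_two).trans ?_
  refine add_le_add ?_ ?_
  · refine ENNReal.le_mul_sqrt_of_sq_le ?_
    exact (eLpNorm_sub_integral_sq LN).trans_le (S.enorm_variance_sum_nearRV_le hδ hm)
  · rw [eLpNorm_const _ (by norm_num) (IsProbabilityMeasure.ne_zero μ)]
    simpa using S.enorm_integral_farSum_le hδ

lemma memLp_uStatStd (S : IsMixingKernel μ X H β) : MemLp (uStatStd μ X H) 4 μ := by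
  have : uStatStd μ X H = fun ω => (uStd μ X H)⁻¹ * (uStat X H ω - ∫ ω', uStat X H ω' ∂μ) := by
    ext ω; rw [uStatStd, div_eq_inv_mul]
  rw [this]
  exact (S.memLp_uStat.sub (memLp_const _)).const_mul _

lemma eLpNorm_uStatStd (S : IsMixingKernel μ X H β) (hs : 0 < uStd μ X H) :
    eLpNorm (uStatStd μ X H) 2 μ = 1 := by
  have e : uStatStd μ X H =
      (uStd μ X H)⁻¹ • fun ω => uStat X H ω - ∫ ω', uStat X H ω' ∂μ := by
    ext ω; simp [uStatStd, div_eq_inv_mul]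
  have h1 := eLpNorm_sub_integral_sq (μ := μ) (S.memLp_uStat.mono_exponent (by norm_num))
  have h2 : ‖Var[uStat X H; μ]‖ₑ = ‖uStd μ X H‖ₑ ^ 2 := by
    rw [← enorm_pow, uStd, Real.sq_sqrt (variance_nonneg _ _)]
  rw [h2] at h1
  have h3 := (ENNReal.pow_right_strictMono two_ne_zero).injective h1
  rw [e, eLpNorm_const_smul, h3, ← enorm_mul, inv_mul_cancel₀ hs.ne', enorm_one]

/-- Since E W² = 1, the defect is the mean of U² - W² = (W - U)(W - U - 2W); Cauchy–Schwarz gives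
the factor 1 + 2 = 3. -/
lemma enorm_integral_sq_sub_one_le {U W : Ω → ℝ} (hU : MemLp U 4 μ) (hW : MemLp W 4 μ)
    (h1 : eLpNorm W 2 μ = 1) (hr : eLpNorm (fun ω => W ω - U ω) 2 μ ≤ 1) :
    ‖∫ ω, U ω ^ 2 ∂μ - 1‖ₑ ≤ 3 * eLpNorm (fun ω => W ω - U ω) 2 μ := by
  have hU2 := hU.mono_exponent (by norm_num : (2 : ℝ≥0∞) ≤ 4)
  have hW2 := hW.mono_exponent (by norm_num : (2 : ℝ≥0∞) ≤ 4)
  have hWW : ∫ ω, W ω ^ 2 ∂μ = 1 := by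
    have h := eLpNorm_pow_eq_enorm_integral (q := 2) (by decide) (by norm_num) hW2.integrable_sq
    rw [Nat.cast_ofNat, h1, one_pow, Real.enorm_of_nonneg (integral_nonneg fun ω => sq_nonneg _)]
      at h
    exact (ENNReal.ofReal_eq_one.1 h.symm)
  have e : ∫ ω, U ω ^ 2 ∂μ - 1 = ∫ ω, (W ω - U ω) * (W ω - U ω - 2 * W ω) ∂μ := by
    rw [← hWW, ← integral_sub hU2.integrable_sq hW2.integrable_sq]
    congr with ω; ring
  have hD := hW2.sub hU2
  have h2W := hW2.const_mul (2 : ℝ)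
  rw [e]
  refine (enorm_integral_le_lintegral_enorm _).trans
    ((lintegral_enorm_mul_le hD.1 (hD.sub h2W).1).trans ?_)
  rw [mul_comm]
  refine mul_le_mul' ((eLpNorm_sub_le hD.1 h2W.1 one_le_two).trans ?_) le_rfl
  have h3 : eLpNorm (fun ω => 2 * W ω) 2 μ = 2 := by
    have h4 : eLpNorm (fun ω => 2 * W ω) 2 μ = ‖(2 : ℝ)‖ₑ * eLpNorm W 2 μ :=
      eLpNorm_const_smul (2 : ℝ) W 2 μ
    rw [h4, h1, mul_one, Real.enorm_of_nonneg (by norm_num)]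
    simp
  rw [h3]
  calc _ ≤ (1 : ℝ≥0∞) + 2 := add_le_add hr le_rfl
    _ = 3 := by norm_num

/-- Restricting to J in the pair bound leaves a term that none of the A's contains. It splits into a
part of the type of A₃, with H₂ ≤ H₄, and a part of the type of A₂. -/
lemma sqrt_boundTwo_le :
    (tau ι m [2] * tau ι m [4]) ^ (1 / 2 : ℝ) *
      (kernelMoment μ X H 2 * boundTwo μ X H β m δ ^ (1 / 2 : ℝ)) ≤
    tau ι m [2] * (tau ι m [4] * kernelMoment μ X H 2 ^ 4) ^ (1 / 2 : ℝ) +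
      (tau ι m [4] * kernelMoment μ X H 2 ^ 2 + (Fintype.card ι : ℝ≥0∞) ^ 4 *
        (kernelMoment μ X H (2 + δ) ^ 2 * betaMax β 4 m ^ (δ / (2 + δ)))) := by
  have half : (0 : ℝ) ≤ 1 / 2 := by norm_num
  have sqr : ∀ x : ℝ≥0∞, x ^ (1 / 2 : ℝ) * x ^ (1 / 2 : ℝ) = x := fun x => by
    rw [← ENNReal.rpow_add_of_nonneg _ _ half half]; norm_num
  have sqrt_sq : ∀ x : ℝ≥0∞, (x ^ 2) ^ (1 / 2 : ℝ) = x := fun x => by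
    rw [← ENNReal.rpow_natCast, ← ENNReal.rpow_mul]; norm_num
  set n := (Fintype.card ι : ℝ≥0∞)
  set q := kernelMoment μ X H (2 + δ) ^ 2 * betaMax β 4 m ^ (δ / (2 + δ)) with hq
  set h := kernelMoment μ X H 2
  set a := tau ι m [2] ^ (1 / 2 : ℝ)
  set b := tau ι m [4] ^ (1 / 2 : ℝ)
  have ha : a * a = tau ι m [2] := sqr _
  have hb : b * b = tau ι m [4] := sqr _
  have h1 : boundTwo μ X H β m δ ^ (1 / 2 : ℝ) ≤ a * h + n * q ^ (1 / 2 : ℝ) := by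
    have e : boundTwo μ X H β m δ ≤ tau ι m [2] * h ^ 2 + n ^ 2 * q := by
      rw [boundTwo, hq, mul_assoc (n ^ 2)]
      gcongr
      exact kernelMomentIndep_le _
    refine (ENNReal.rpow_le_rpow e half).trans
      ((ENNReal.rpow_add_le_add_rpow _ _ half (by norm_num)).trans ?_)
    rw [ENNReal.mul_rpow_of_nonneg _ _ half, ENNReal.mul_rpow_of_nonneg _ _ half, sqrt_sq, sqrt_sq]
  have amgm : ∀ x y : ℝ≥0∞, x * y ≤ x * x + y * y := fun x y => by
    rcases le_total x y with hxy | hxy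
    · exact (mul_le_mul' hxy le_rfl).trans le_add_self
    · exact (mul_le_mul' le_rfl hxy).trans le_self_add
  calc _ ≤ a * b * (h * (a * h + n * q ^ (1 / 2 : ℝ))) := by
        rw [ENNReal.mul_rpow_of_nonneg _ _ half]
        gcongr
    _ = a * a * (b * h ^ 2) + b * h * (a * n * q ^ (1 / 2 : ℝ)) := by ring
    -- The mixed product is split by xy ≤ x² + y²; the mixing part then has τ₂ n², absorbed into n⁴.
    _ ≤ a * a * (b * h ^ 2) + (b * h * (b * h) +
          a * n * q ^ (1 / 2 : ℝ) * (a * n * q ^ (1 / 2 : ℝ))) := by gcongr; exact amgm _ _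
    _ = a * a * (b * h ^ 2) + (b * b * h ^ 2 +
          a * a * n ^ 2 * (q ^ (1 / 2 : ℝ) * q ^ (1 / 2 : ℝ))) := by ring
    _ = tau ι m [2] * (b * h ^ 2) + (tau ι m [4] * h ^ 2 + tau ι m [2] * n ^ 2 * q) := by
        rw [ha, hb, sqr]
    _ ≤ tau ι m [2] * (b * h ^ 2) + (tau ι m [4] * h ^ 2 + n ^ 2 * n ^ 2 * q) := by
        gcongr; exact tau_two_le_sq
    _ = _ := by
        rw [ENNReal.mul_rpow_of_nonneg _ _ half, show h ^ 4 = (h ^ 2) ^ 2 by ring, sqrt_sq]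
        ring

/-- The normal approximation of the standardised U-statistic. -/
theorem wassersteinDist_uStatStd_le (S : IsMixingKernel μ X H β) (hδ : 0 < δ) (hm : 0 < m)
    (hs : 0 < uStd μ X H) {t : ℝ≥0∞} (ht : t = ‖(uStd μ X H)⁻¹‖ₑ) :
    wassersteinDist (μ.map (uStatStd μ X H)) (gaussianReal 0 1) ≤ 5000 *
      (t * boundNear μ X H β m δ ^ (1 / 2 : ℝ) +
      t * (Fintype.card ι : ℝ≥0∞) ^ 2 *
        (kernelMoment μ X H (1 + δ) * β 1 ⊤ m ^ (δ / (1 + δ))) +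
      t ^ 2 * (tau ι (4 * m) [4] * kernelMoment μ X H 2 ^ 2 + (Fintype.card ι : ℝ≥0∞) ^ 4 *
        (kernelMoment μ X H (2 + δ) ^ 2 * betaMax β 4 m ^ (δ / (2 + δ)))) +
      t ^ 2 * tau ι m [2] * ((Fintype.card ι : ℝ≥0∞) ^ 2 *
        (kernelMoment μ X H (2 + δ) ^ 2 * β 2 ⊤ m ^ (δ / (2 + δ))) +
        boundGamma μ X H β m δ ^ (1 / 2 : ℝ)) +
      t ^ 3 * (tau ι m [2] * tau ι m [4]) ^ (1 / 2 : ℝ) *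
        (boundFour μ X H β m δ ^ (1 / 2 : ℝ) * boundTwo μ X H β m δ ^ (1 / 2 : ℝ))) := by
  set R₀ := t * boundNear μ X H β m δ ^ (1 / 2 : ℝ) with hR₀
  set R₁ := t * (Fintype.card ι : ℝ≥0∞) ^ 2 *
        (kernelMoment μ X H (1 + δ) * β 1 ⊤ m ^ (δ / (1 + δ))) with hR₁
  set R₂ := t ^ 2 * (tau ι (4 * m) [4] * kernelMoment μ X H 2 ^ 2 + (Fintype.card ι : ℝ≥0∞) ^ 4 *
        (kernelMoment μ X H (2 + δ) ^ 2 * betaMax β 4 m ^ (δ / (2 + δ)))) with hR₂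
  set R₃ := t ^ 2 * tau ι m [2] * ((Fintype.card ι : ℝ≥0∞) ^ 2 *
        (kernelMoment μ X H (2 + δ) ^ 2 * β 2 ⊤ m ^ (δ / (2 + δ))) +
        boundGamma μ X H β m δ ^ (1 / 2 : ℝ)) with hR₃
  set R₄ := t ^ 3 * (tau ι m [2] * tau ι m [4]) ^ (1 / 2 : ℝ) *
        (boundFour μ X H β m δ ^ (1 / 2 : ℝ) * boundTwo μ X H β m δ ^ (1 / 2 : ℝ)) with hR₄
  set W := uStatStd μ X H with hW
  set U : Ω → ℝ := fun ω => (uStd μ X H)⁻¹ * farSum X H m Finset.univ ω with hU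
  have half : (0 : ℝ) ≤ 1 / 2 := by norm_num
  have mW : Measurable W := (S.measurable_uStat.sub_const _).div_const _
  have LW : MemLp W 4 μ := S.memLp_uStatStd
  have LU : MemLp U 4 μ := (S.memLp_farSum _).const_mul _
  have nW : eLpNorm W 2 μ = 1 := S.eLpNorm_uStatStd hs
  have iW : Integrable W μ := LW.integrable (by norm_num)
  have iU : Integrable U μ := LU.integrable (by norm_num)
  have hr : eLpNorm (fun ω => W ω - U ω) 2 μ ≤ 3 * R₀ + 8 * R₁ := by
    refine (S.eLpNorm_uStatStd_sub_le hδ hm).trans (le_of_eq ?_)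
    rw [← ht]; ring
  -- If W and U differ by at least 1 in L², then 3R₀ + 8R₁ ≥ 1 and the trivial bound E|W| + E|Z| ≤ 2
  -- suffices. Otherwise the normalisation defect is linear in the difference.
  rcases le_total 1 (eLpNorm (fun ω => W ω - U ω) 2 μ) with h1 | h1
  · have := Measure.isProbabilityMeasure_map (μ := μ) mW.aemeasurable
    have iW' : Integrable (fun x => x) (μ.map W) :=
      (integrable_map_measure aestronglyMeasurable_id mW.aemeasurable).2 iW
    have e1 : ∫⁻ x, ‖x‖ₑ ∂(μ.map W) ≤ 1 := by
      rw [lintegral_map measurable_enorm mW, ← eLpNorm_one_eq_lintegral_enorm]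
      exact (eLpNorm_le_eLpNorm_of_exponent_le one_le_two LW.1).trans_eq nW
    have e2 : ∫⁻ x, ‖x‖ₑ ∂(gaussianReal 0 1) ≤ 1 := by
      rw [← eLpNorm_one_eq_lintegral_enorm]
      exact (eLpNorm_le_eLpNorm_of_exponent_le one_le_two aestronglyMeasurable_id).trans_eq
        eLpNorm_id_gaussianReal
    have h2 := wassersteinDist_le_add (Q := gaussianReal 0 1) iW'
      ((memLp_id_gaussianReal 1).integrable (by simp))
    calc _ ≤ (1 : ℝ≥0∞) + 1 := h2.trans (add_le_add e1 e2)
      _ ≤ (3 * R₀ + 8 * R₁) + (3 * R₀ + 8 * R₁) := add_le_add (h1.trans hr) (h1.trans hr)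
      _ = 6 * R₀ + 16 * R₁ + 0 * R₂ + 0 * R₃ + 0 * R₄ := by ring
      _ ≤ 5000 * R₀ + 5000 * R₁ + 5000 * R₂ + 5000 * R₃ + 5000 * R₄ := by
          gcongr <;> norm_num
      _ = _ := by ring
  · have hsq := enorm_integral_sq_sub_one_le LU LW nW h1
    have hV : ∑ i : ι, ((nbhd m i).card : ℝ≥0∞) ^ 2 ≤ (tau ι m [2] * tau ι m [4]) ^ (1 / 2 : ℝ) := by
      refine (ENNReal.le_mul_sqrt_of_sq_le (c := 1) ?_).trans_eq (one_mul _)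
      rw [one_pow, one_mul]
      exact sq_sum_card_nbhd_sq_le
    have hL : normTwo μ X H β m δ ≤ 6 * boundTwo μ X H β m δ ^ (1 / 2 : ℝ) := by
      rw [normTwo, ENNReal.mul_rpow_of_nonneg _ _ half]
      gcongr
      calc (32 : ℝ≥0∞) ^ (1 / 2 : ℝ) ≤ (6 ^ (2 : ℝ)) ^ (1 / 2 : ℝ) :=
            ENNReal.rpow_le_rpow (by norm_num) half
        _ = 6 := by rw [← ENNReal.rpow_mul]; norm_num
    have hmid : t ^ 2 * (tau ι m [2] * tau ι m [4]) ^ (1 / 2 : ℝ) *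
        (kernelMoment μ X H 2 * normTwo μ X H β m δ) ≤ 6 * (R₃ + R₂) := by
      calc _ ≤ t ^ 2 * (tau ι m [2] * tau ι m [4]) ^ (1 / 2 : ℝ) *
            (kernelMoment μ X H 2 * (6 * boundTwo μ X H β m δ ^ (1 / 2 : ℝ))) := by gcongr
        _ = 6 * (t ^ 2 * ((tau ι m [2] * tau ι m [4]) ^ (1 / 2 : ℝ) *
            (kernelMoment μ X H 2 * boundTwo μ X H β m δ ^ (1 / 2 : ℝ)))) := by ring
        _ ≤ 6 * (t ^ 2 * (tau ι m [2] * boundGamma μ X H β m δ ^ (1 / 2 : ℝ) +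
            (tau ι (4 * m) [4] * kernelMoment μ X H 2 ^ 2 + (Fintype.card ι : ℝ≥0∞) ^ 4 *
        (kernelMoment μ X H (2 + δ) ^ 2 * betaMax β 4 m ^ (δ / (2 + δ)))))) := by
            refine mul_le_mul' le_rfl (mul_le_mul' le_rfl (sqrt_boundTwo_le.trans ?_))
            gcongr
            · rw [boundGamma, add_assoc]
              refine le_trans ?_ le_self_add
              gcongr
              exact S.kernelMoment_mono (by norm_num)
            · exact tau_four_mono (by linarith)
        _ ≤ _ := by
            rw [mul_add (t ^ 2), hR₃, hR₂, ← mul_assoc (t ^ 2)]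
            gcongr
            exact le_add_self
    refine (wassersteinDist_map_le mW iW iU fun f f' hf =>
      S.enorm_integral_stein_le hδ hf (uStd μ X H)⁻¹ hV).trans ?_
    have h0 : ∫⁻ ω, ‖W ω - U ω‖ₑ ∂μ ≤ 3 * R₀ + 8 * R₁ := by
      rw [← eLpNorm_one_eq_lintegral_enorm]
      exact (eLpNorm_le_eLpNorm_of_exponent_le one_le_two (iW.sub iU).1).trans hr
    rw [normTwo_mul_normFour_mul_normFour, ← ht]
    calc _ ≤ (3 * R₀ + 8 * R₁) + (24 * R₁ + 72 * (64 * R₄) + 40 * (6 * (R₃ + R₂)) + 240 * R₃ +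
          5 * (3 * (3 * R₀ + 8 * R₁)) + 40 * R₂) := by
          refine add_le_add h0 (add_le_add (add_le_add (add_le_add (add_le_add
            (add_le_add le_rfl ?_) ?_) le_rfl) ?_) ?_)
          · rw [hR₄]; exact le_of_eq (by ring)
          · gcongr
          · gcongr
            exact hsq.trans (by gcongr)
          · rw [hR₂, mul_assoc (t ^ 2)]
            gcongr
            exact le_add_self
      _ = 48 * R₀ + 152 * R₁ + 280 * R₂ + 480 * R₃ + 4608 * R₄ := by ring
      _ ≤ 5000 * R₀ + 5000 * R₁ + 5000 * R₂ + 5000 * R₃ + 5000 * R₄ := by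
          gcongr <;> norm_num
      _ = _ := by ring

end IsMixingKernel

end NearSum

/-! ### Conclusion: the constants and the case of an infinite fourth moment -/

lemma half_le_ofReal_sqrt_two_div_pi : (1 / 2 : ℝ≥0∞) ≤ ENNReal.ofReal √(2 / Real.pi) := by
  have h : (1 / 2 : ℝ) ≤ √(2 / Real.pi) := by
    refine Real.le_sqrt_of_sq_le ?_
    rw [le_div_iff₀ Real.pi_pos]
    linarith [Real.pi_le_four]
  refine le_trans (le_of_eq ?_) (ENNReal.ofReal_le_ofReal h)
  rw [ENNReal.ofReal_div_of_pos two_pos]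
  simp

/-- The smallest coefficient in the target is √(2/π) ≥ 1/2, so doubling the constant is enough. -/
lemma five_thousand_mul_add_le {r₀ r₁ r₂ r₃ r₄ c : ℝ≥0∞} (hc : 1 / 2 ≤ c) :
    5000 * (r₀ + r₁ + r₂ + r₃ + r₄) ≤ 10000 * r₀ + 2 * (10000 * r₁) + c * (10000 * r₂) +
      c * (10000 * r₃) + 2 * (10000 * r₄) + 0 := by
  have e : (1 / 2 : ℝ≥0∞) * 10000 = 5000 := by
    rw [show (10000 : ℝ≥0∞) = 2 * 5000 by norm_num, ← mul_assoc, one_div,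
      ENNReal.inv_mul_cancel two_ne_zero ENNReal.ofNat_ne_top, one_mul]
  have h : ∀ r, 5000 * r ≤ c * (10000 * r) := fun r => by
    rw [← e, mul_assoc]; gcongr
  have h' : ∀ r : ℝ≥0∞, 5000 * r ≤ 2 * (10000 * r) := fun r => by
    rw [← mul_assoc]; gcongr; norm_num
  simp only [mul_add, add_zero]
  refine add_le_add (add_le_add (add_le_add (add_le_add ?_ (h' _)) (h _)) (h _)) (h' _)
  gcongr
  norm_num

lemma nonempty_of_kernelMoment_eq_top {Ω : Type*} [MeasurableSpace Ω] {μ : Measure Ω} {ι E : Type*}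
    [MeasurableSpace E] {X : ι → Ω → E} {H : E → E → ℝ} {p : ℝ} (h : kernelMoment μ X H p = ∞) :
    Nonempty ι := by
  by_contra h'
  rw [not_nonempty_iff] at h'
  simp [kernelMoment, kernelMomentIndep] at h

theorem mainTheorem2 :
    ∃ C : ℝ≥0∞, C ≠ ∞ ∧
      ∀ (Ω : Type u) (mΩ : MeasurableSpace Ω) (μ : Measure Ω) (_ : IsProbabilityMeasure μ)
        (ι : Type v) (_ : Fintype ι) (_ : EMetricSpace ι) (d : ℕ)
        (X : ι → Ω → EuclideanSpace ℝ (Fin d))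
        (H : EuclideanSpace ℝ (Fin d) → EuclideanSpace ℝ (Fin d) → ℝ)
        (β : ℕ∞ → ℕ∞ → ℝ → ℝ≥0∞) (m δ : ℝ) (n s : ℝ≥0∞) (Hm : ℝ → ℝ≥0∞),
        (∀ i, Measurable (X i)) → IsBetaMixing μ X β →
        IsRegularKernel μ X H → IsDegenerate μ X H →
        0 < m → 0 < δ →
        n = (Fintype.card ι : ℝ≥0∞) →
        s = ENNReal.ofReal (uStd μ X H) → 0 < s →
        Hm = kernelMoment μ X H →
        ∃ A₀ A₁ A₂ A₃ A₄ A₅ : ℝ≥0∞,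
          wassersteinDist (μ.map (uStatStd μ X H)) (gaussianReal 0 1) ≤
            A₀ + 2 * A₁ + ENNReal.ofReal √(2 / Real.pi) * A₂
              + ENNReal.ofReal √(2 / Real.pi) * A₃ + 2 * A₄ + A₅ ∧
          A₀ ≤ C * (1 / s * (tau ι (4 * m) [4] * Hm 2 ^ 2
              + tau ι (4 * m) [2, 2] * Hm (2 + δ) ^ 2
                * betaMax β 4 (4 * m) ^ (δ / (2 + δ))) ^ (1 / 2 : ℝ)) ∧
          A₁ ≤ C * (n ^ 2 / s * Hm (1 + δ) * β 1 ⊤ m ^ (δ / (1 + δ))) ∧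
          A₂ ≤ C * (1 / s ^ 2 * (tau ι (4 * m) [4] * Hm 2 ^ 2
              + n ^ 4 * Hm (2 + δ) ^ 2 * betaMax β 4 m ^ (δ / (2 + δ)))) ∧
          A₃ ≤ C * (tau ι m [2] / s ^ 2 *
              (n ^ 2 * Hm (2 + δ) ^ 2 * β 2 ⊤ m ^ (δ / (2 + δ))
                + (tau ι m [4] * Hm 4 ^ 4
                    + tauHat4 ι m * Hm (4 + δ) ^ 4 * betaMax β 4 m ^ (δ / (4 + δ))
                    + tau ι m [2, 2] * gammaMoment μ X H m 2 ^ 2) ^ (1 / 2 : ℝ))) ∧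
          A₄ + A₅ ≤ C * ((tau ι m [2] * tau ι m [4] + n * tau ι m [5]) ^ (1 / 2 : ℝ) / s ^ 3
              * ((tau ι m [4] + tau ι m [2, 2]) * Hm 4 ^ 4
                  + tauHat4 ι m * Hm (4 + δ) ^ 4 * β 1 6 m ^ (δ / (4 + δ))) ^ (1 / 2 : ℝ)
              * (tau ι m [2] * kernelMomentIndep μ X H 2 ^ 2
                  + n ^ 2 * Hm (2 + δ) ^ 2 * betaMax β 4 m ^ (δ / (2 + δ))) ^ (1 / 2 : ℝ)) := by
  refine ⟨10000, by simp, ?_⟩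
  intro Ω mΩ μ _ ι _ _ d X H β m δ n s Hm hX hβ hH hdeg hm hδ hn hs hs0 hHm
  -- A₀, …, A₄ are taken equal to their upper bounds and A₅ = 0, so only the distance estimate
  -- remains.
  refine ⟨_, _, _, _, _, 0, ?_, le_rfl, le_rfl, le_rfl, le_rfl, (add_zero _).le⟩
  have hstd : 0 < uStd μ X H := by rw [hs] at hs0; exact ENNReal.ofReal_pos.1 hs0
  have hs_top : s ≠ ∞ := by rw [hs]; exact ENNReal.ofReal_ne_top
  have ht : s⁻¹ = ‖(uStd μ X H)⁻¹‖ₑ := by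
    rw [enorm_inv hstd.ne', Real.enorm_of_nonneg hstd.le, hs]
  have hc := half_le_ofReal_sqrt_two_div_pi
  -- An infinite fourth moment forces a node to exist, so τ₂ and τ₄ are nonzero. As s is finite, A₃
  -- is infinite and nothing is left to prove.
  by_cases h4 : kernelMoment μ X H 4 = ∞
  · have := nonempty_of_kernelMoment_eq_top h4
    have hcard : (Fintype.card ι : ℝ≥0∞) ≠ 0 := by simp
    have h2 : tau ι m [2] ≠ 0 := fun h => hcard (le_zero_iff.1 (h ▸ card_le_tau_two))
    have h4' : tau ι m [4] ≠ 0 := fun h => hcard (le_zero_iff.1 (h ▸ card_le_tau_four))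
    have htop : ∀ x y z : ℝ≥0∞, tau ι m [2] / s ^ 2 *
        (x + (tau ι m [4] * Hm 4 ^ 4 + y + z) ^ (1 / 2 : ℝ)) = ∞ := fun x y z => by
      rw [hHm, h4, ENNReal.top_pow (by norm_num), ENNReal.mul_top h4', top_add, top_add,
        ENNReal.top_rpow_of_pos (by norm_num), add_top, ENNReal.mul_top]
      exact ENNReal.div_ne_zero.2 ⟨h2, ENNReal.pow_ne_top hs_top⟩
    have hc0 : ENNReal.ofReal √(2 / Real.pi) ≠ 0 :=
      (lt_of_lt_of_le (by simp : (0 : ℝ≥0∞) < 1 / 2) hc).ne'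
    rw [htop, ENNReal.mul_top (by norm_num), ENNReal.mul_top hc0]
    simp
  · have S : IsMixingKernel μ X H β := ⟨hX, hβ, hH, hdeg, h4⟩
    refine (S.wassersteinDist_uStatStd_le hδ hm hstd ht).trans ?_
    refine le_trans (mul_le_mul_right ?_ (5000 : ℝ≥0∞)) (five_thousand_mul_add_le hc)
    refine add_le_add (add_le_add (add_le_add (add_le_add ?_ ?_) ?_) ?_) ?_
    · rw [one_div s, hHm]; rfl
    · rw [hHm, hn, ENNReal.div_eq_inv_mul]; exact le_of_eq (by ring)
    · rw [hHm, hn, one_div, ENNReal.inv_pow]; exact le_of_eq (by ring)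
    · rw [hHm, hn, ENNReal.div_eq_inv_mul, ← ENNReal.inv_pow, IsMixingKernel.boundGamma]
      exact le_of_eq (by ring)
    · rw [hHm, hn, ENNReal.div_eq_inv_mul, ← ENNReal.inv_pow, ← mul_assoc,
        IsMixingKernel.boundFour, IsMixingKernel.boundTwo]
      gcongr
      -- The summand n τ₅ is not needed and is added for free.
      exact le_self_add
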